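/- Let $d\ge 1$ and $k\ge 1$ be integers, $1\le p\le\infty$, $\delta>0$, and let $C_a,C_b,C_c,C_d,C_e\in\mathbb R$ and $C_0>0$ be constants. Let $\mathcal F$ be the class of probability densities $f$ on $\mathbb R^d$ such that (a) $f(x)\le C_a$ for almost every $x$; (b) for some $\gamma>0$, $\int f(x)\,|\log f(x)|^{1+\gamma}\,dx\le C_b$ (in particular the integral is finite); (c) $\int f(x)\,e^{-b f(x)}\,dx\le C_c\,e^{-C_0 b}$ for all $b>1$; (d) for almost every $x$, $f$ is twice continuously differentiable in a neighbourhood of $x$ and its Hessian satisfies $\|H_f(x)\|_2<C_d$ (spectral norm); (e) the set of points $x$ at which the condition in (d) fails has $(d-1)$-dimensional Hausdorff measure less than $C_e$. For $f\in\mathcal F$ let $H=-\int f\log f$ be its differential entropy. Given i.i.d. samples $X_1,\dots,X_N$ from $f$ with $N>k$, let $\rho_{k,i,p}$ be the $\ell_p$ distance from $X_i$ to its $k$-th nearest neighbour among the other samples, let $c_{d,p}$ be the volume of the unit $\ell_p$ ball of $\mathbb R^d$, let $\psi=\Gamma'/\Gamma$ be the digamma function, and put $a_N=\big((\log N)^{1+\delta}/N\big)^{1/d}$.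 The truncated Kozachenko--Leonenko (KL) estimator is $$\widehat H_{\rm tKL}=\frac1N\sum_{i=1}^N\xi_i,\qquad \xi_i=\begin{cases}-\psi(k)+\log N+\log c_{d,p}+d\log\rho_{k,i,p}&\text{if }\rho_{k,i,p}\le a_N,\\ 0&\text{if }\rho_{k,i,p}>a_N.\end{cases}$$ Then there are $C$ and $N_0$, depending only on $d,k,p,\delta,C_a,C_b,C_c,C_d,C_e,C_0$, such that for every $f\in\mathcal F$ the function $f\log f$ is integrable and, for every $N\ge N_0$, the squared error $(\widehat H_{\rm tKL}-H)^2$ is integrable with $$\mathbb E\big[(\widehat H_{\rm tKL}-H)^2\big]\le C\left(\frac{(\log N)^{(1+\delta)(2+2/d)}}{N^{2/d}}+\frac{(\log\log N)^2(\log N)^{(2k+2)(1+\delta)}}{N}\right).$$ Consequently, if $d\le 2$, the mean squared error attains the parametric rate up to logarithmic factors: there are $A$, $C'$ and $N_1$, depending only on the same quantities, such that $\mathbb E[(\widehat H_{\rm tKL}-H)^2]\le C'(\log N)^{A}/N$ for all $f\in\mathcal F$ and $N\ge N_1$. -/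

import Mathlib

open MeasureTheory
open scoped ENNReal

noncomputable section

namespace TruncKL

/-- `ℝ^d` with the Euclidean norm, its Borel sigma-algebra and Lebesgue measure `volume`. -/
abbrev Space (d : ℕ) : Type := EuclideanSpace ℝ (Fin d)

/-- The `ℓ_p` norm on `ℝ^d`. -/
def lpNorm {d : ℕ} (p : ℝ≥0∞) (x : Space d) : ℝ :=
  ‖(WithLp.toLp p x.ofLp : PiLp p fun _ : Fin d => ℝ)‖

/-- The volume `c_{d,p}` of the unit `ℓ_p` ball of `ℝ^d`. -/
def unitBallVolume (d : ℕ) (p : ℝ≥0∞) : ℝ :=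
  (volume {x : Space d | lpNorm p x ≤ 1}).toReal

/-- The digamma function `ψ(x) = Γ'(x) / Γ(x)` of a real variable. -/
def digamma (x : ℝ) : ℝ := logDeriv Real.Gamma x

/-! ### Densities -/

/-- `f` is a probability density on `ℝ^d` with respect to Lebesgue measure. -/
structure IsDensity {d : ℕ} (f : Space d → ℝ) : Prop where
  measurable : Measurable f
  nonneg : ∀ x, 0 ≤ f x
  integral_eq_one : ∫ x, f x = 1

/-- The law of a random vector with density `f`. -/
def law {d : ℕ} (f : Space d → ℝ) : Measure (Space d) :=
  volume.withDensity fun x => ENNReal.ofReal (f x)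

/-- The joint law of `N` independent samples with density `f`. -/
def sampleLaw {d : ℕ} (f : Space d → ℝ) (N : ℕ) : Measure (Fin N → Space d) :=
  Measure.pi fun _ => law f

/-- The differential entropy `H = -∫ f log f` (natural logarithm; `0 log 0 = 0`). -/
def entropy {d : ℕ} (f : Space d → ℝ) : ℝ := -∫ x, f x * Real.log (f x)

/-- The Hessian of `f` at `x` as a continuous bilinear form on Euclidean space. Its operator norm
is the spectral norm of the Hessian matrix. -/
def hessian {d : ℕ} (f : Space d → ℝ) (x : Space d) : Space d →L[ℝ] Space d →L[ℝ] ℝ :=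
  fderiv ℝ (fderiv ℝ f) x

/-- `f` is twice continuously differentiable at (that is, near) `x` and its Hessian at `x` has
spectral norm less than `C`. -/
def SmoothAt {d : ℕ} (f : Space d → ℝ) (C : ℝ) (x : Space d) : Prop :=
  ContDiffAt ℝ 2 f x ∧ ‖hessian f x‖ < C

/-- The regularity class of densities on `ℝ^d`, with its constants. The Hausdorff measure
`μH[d - 1]` is computed from the Euclidean distance and is the counting measure for `d = 1`. -/
structure Regular {d : ℕ} (Ca Cb Cc Cd Ce C0 : ℝ) (f : Space d → ℝ) : Prop where
  isDensity : IsDensity f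
  bounded : ∀ᵐ x, f x ≤ Ca
  logMoment : ∃ γ : ℝ, 0 < γ ∧
    Integrable (fun x => f x * |Real.log (f x)| ^ (1 + γ)) ∧
    ∫ x, f x * |Real.log (f x)| ^ (1 + γ) ≤ Cb
  tail : ∀ b : ℝ, 1 < b → ∫ x, f x * Real.exp (-b * f x) ≤ Cc * Real.exp (-C0 * b)
  smooth : ∀ᵐ x, SmoothAt f Cd x
  boundary : Measure.hausdorffMeasure ((d : ℝ) - 1) {x | ¬ SmoothAt f Cd x} < ENNReal.ofReal Ce

/-! ### The truncated estimator -/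

/-- The `ℓ_p` distance `ρ_{k,i,p}` from `X i` to its `k`-th nearest neighbour among the other
sample points: the least `r ≥ 0` such that at least `k` indices `j ≠ i` satisfy
`‖X j - X i‖_p ≤ r`. (Meaningful for `1 ≤ k < N`.) -/
def knnDist {d N : ℕ} (p : ℝ≥0∞) (k : ℕ) (X : Fin N → Space d) (i : Fin N) : ℝ :=
  sInf {r : ℝ | 0 ≤ r ∧ k ≤ {j : Fin N | j ≠ i ∧ lpNorm p (X j - X i) ≤ r}.ncard}

/-- The truncation threshold `a_N = ((log N)^{1+δ} / N)^{1/d}`. -/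
def threshold (d : ℕ) (δ : ℝ) (N : ℕ) : ℝ :=
  (Real.log N ^ (1 + δ) / N) ^ (1 / (d : ℝ))

open Classical in
/-- The truncated local estimate `ξ_{k,i,p}`. -/
def localEstimate {d N : ℕ} (p : ℝ≥0∞) (k : ℕ) (δ : ℝ) (X : Fin N → Space d) (i : Fin N) : ℝ :=
  if knnDist p k X i ≤ threshold d δ N then
    -digamma k + Real.log N + Real.log (unitBallVolume d p) + d * Real.log (knnDist p k X i)
  else 0

/-- The truncated Kozachenko-Leonenko estimator of differential entropy. -/
def estimator {d N : ℕ} (p : ℝ≥0∞) (k : ℕ) (δ : ℝ) (X : Fin N → Space d) : ℝ :=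
  (1 / (N : ℝ)) * ∑ i, localEstimate p k δ X i

/-- The squared error of the truncated estimator on the sample `X`. -/
def sqError {d N : ℕ} (p : ℝ≥0∞) (k : ℕ) (δ : ℝ) (f : Space d → ℝ) (X : Fin N → Space d) : ℝ :=
  (estimator p k δ X - entropy f) ^ 2

/-- The mean squared error of the truncated estimator with `N` independent samples from `f`. -/
def mse {d : ℕ} (p : ℝ≥0∞) (k : ℕ) (δ : ℝ) (f : Space d → ℝ) (N : ℕ) : ℝ :=
  ∫ X, sqError p k δ f X ∂(sampleLaw f N)

/-- The rate
`(log N)^{(1+δ)(2+2/d)} / N^{2/d} + (log log N)^2 (log N)^{(2k+2)(1+δ)} / N`. -/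
def rate (d k : ℕ) (δ : ℝ) (N : ℕ) : ℝ :=
  Real.log N ^ ((1 + δ) * (2 + 2 / (d : ℝ))) / (N : ℝ) ^ (2 / (d : ℝ)) +
    Real.log (Real.log N) ^ 2 * Real.log N ^ ((2 * (k : ℝ) + 2) * (1 + δ)) / N

end TruncKL

end

/-! Everything rests on a rigidity of the class: letting `b → ∞` in the tail condition (c) forces `f
= 0` or `C0 ≤ f ≤ Ca` almost everywhere (`Regular.ae_eq_zero_or_mem_Icc`). So the support has volume
at most `1 / C0` and `log f` is bounded under the law of `f`.

Smoothness enters through L¹ norms only. The Hessian bound controls second differences along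
segments that avoid the exceptional set, and the segments of length `2t` in a coordinate direction
that meet this set start in a region of volume O(t). Second differences are therefore O(t) in L¹,
and repeated doubling of the step gives ‖f(· + z) - f‖₁ = O(|z| log(1/|z|)), although no gradient
bound is available (`Regular.translationModulus_le`). Summing mean oscillations over dyadic radii
below a_N gives one function S with ∫ S = O(a_N log N) that controls |P(B(x,r)) - c r^d f(x)| for
all r ≤ a_N at once (`IsDensity.abs_ballMass_sub_le`).

Bias: for a frozen centre x, P(B(x,ρ)) is distributed as the k-th order statistic of N - 1 uniform
variables. The mean of its logarithm is exactly minus a difference of harmonic numbers, which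
cancels log N - ψ(k) up to 1/N. Where S(x) is small, passing from P(B(x,ρ)) to c ρ^d f(x) costs a
multiple of S(x), and truncation has probability of order exp(-c' (log N)^{1+δ}). Where S(x) is not
small, a crude moment bound times a multiple of S(x) suffices. Averaging over x gives a bias O(a_N
(log N)^{1+δ}), whose square is the first term of the rate.

Variance: `efron_stein` compares the estimator with its version computed without X_i. Thanks to the
truncation, deleting X_i alters only the local estimates at points within a_N of X_i, of which there
are O((log N)^{1+δ}) on average. Cauchy–Schwarz and integration of one coordinate at a time bound
each of the N comparisons by a power of log N over N². -/

open scoped Pointwise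

noncomputable section

namespace TruncKL

/-! ### The `ℓ_p` norm and its balls -/

section Norm

variable {d : ℕ} {p : ℝ≥0∞}

theorem lpNorm_nonneg (hp : 1 ≤ p) (x : Space d) : 0 ≤ lpNorm p x := by
  have : Fact (1 ≤ p) := ⟨hp⟩
  exact norm_nonneg _

theorem lpNorm_zero (hp : 1 ≤ p) : lpNorm p (0 : Space d) = 0 := by
  have : Fact (1 ≤ p) := ⟨hp⟩
  exact norm_zero (E := PiLp p fun _ : Fin d => ℝ)

theorem lpNorm_smul (hp : 1 ≤ p) (c : ℝ) (x : Space d) : lpNorm p (c • x) = |c| * lpNorm p x := by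
  have : Fact (1 ≤ p) := ⟨hp⟩
  exact norm_smul c (WithLp.toLp p x.ofLp : PiLp p fun _ : Fin d => ℝ)

theorem lpNorm_neg (hp : 1 ≤ p) (x : Space d) : lpNorm p (-x) = lpNorm p x := by
  have := lpNorm_smul hp (-1) x
  simpa using this

theorem lpNorm_sub_comm (hp : 1 ≤ p) (x y : Space d) : lpNorm p (x - y) = lpNorm p (y - x) := by
  rw [← lpNorm_neg hp, neg_sub]

theorem abs_apply_le_lpNorm (hp : 1 ≤ p) (x : Space d) (i : Fin d) : |x i| ≤ lpNorm p x := by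
  have : Fact (1 ≤ p) := ⟨hp⟩
  exact PiLp.norm_apply_le (WithLp.toLp p x.ofLp : PiLp p fun _ : Fin d => ℝ) i

theorem continuous_lpNorm (hp : 1 ≤ p) : Continuous (lpNorm p : Space d → ℝ) := by
  have : Fact (1 ≤ p) := ⟨hp⟩
  exact continuous_norm.comp ((PiLp.continuous_toLp p _).comp (PiLp.continuous_ofLp 2 _))

theorem measurable_lpNorm (hp : 1 ≤ p) : Measurable (lpNorm p : Space d → ℝ) :=
  (continuous_lpNorm hp).measurable

theorem norm_le_sqrt_mul_lpNorm (hp : 1 ≤ p) (x : Space d) : ‖x‖ ≤ √d * lpNorm p x := by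
  rw [EuclideanSpace.norm_eq]
  have h : ∑ i, ‖x i‖ ^ 2 ≤ d * lpNorm p x ^ 2 := by
    calc ∑ i, ‖x i‖ ^ 2 ≤ ∑ _i : Fin d, lpNorm p x ^ 2 := by
          gcongr with i
          exact abs_apply_le_lpNorm hp x i
      _ = d * lpNorm p x ^ 2 := by simp
  calc √(∑ i, ‖x i‖ ^ 2) ≤ √(d * lpNorm p x ^ 2) := Real.sqrt_le_sqrt h
    _ = √d * lpNorm p x := by
      rw [Real.sqrt_mul (by positivity), Real.sqrt_sq (lpNorm_nonneg hp x)]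

theorem unitBall_volume_lt_top (hp : 1 ≤ p) : volume {x : Space d | lpNorm p x ≤ 1} < ⊤ := by
  refine lt_of_le_of_lt (measure_mono (t := Metric.closedBall 0 (√d)) fun x hx => ?_)
    measure_closedBall_lt_top
  rw [mem_closedBall_zero_iff]
  refine (norm_le_sqrt_mul_lpNorm hp x).trans ?_
  simpa using mul_le_mul_of_nonneg_left (a := √d) hx (Real.sqrt_nonneg _)

theorem unitBallVolume_pos (hp : 1 ≤ p) : 0 < unitBallVolume d p := by
  refine ENNReal.toReal_pos (ne_of_gt ?_) (unitBall_volume_lt_top hp).ne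
  refine lt_of_lt_of_le (IsOpen.measure_pos volume (U := {x : Space d | lpNorm p x < 1})
    (isOpen_lt (continuous_lpNorm hp) continuous_const) ⟨0, ?_⟩)
    (measure_mono fun x hx => show lpNorm p x ≤ 1 from le_of_lt hx)
  simp [lpNorm_zero hp]

theorem measurableSet_lpBall (hp : 1 ≤ p) (x : Space d) (r : ℝ) :
    MeasurableSet {y : Space d | lpNorm p (y - x) ≤ r} :=
  measurableSet_le ((measurable_lpNorm hp).comp (measurable_id.sub_const x)) measurable_const

theorem volume_lpBall_zero (hd : 1 ≤ d) (hp : 1 ≤ p) {r : ℝ} (hr : 0 ≤ r) :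
    volume {y : Space d | lpNorm p y ≤ r} = ENNReal.ofReal (unitBallVolume d p * r ^ d) := by
  have key : ∀ r : ℝ, 0 < r → volume {y : Space d | lpNorm p y ≤ r}
      = ENNReal.ofReal (unitBallVolume d p * r ^ d) := by
    intro r hr
    have h : {y : Space d | lpNorm p y ≤ r} = r • {y : Space d | lpNorm p y ≤ 1} := by
      ext y
      rw [Set.mem_smul_set_iff_inv_smul_mem₀ hr.ne']
      simp only [Set.mem_ofPred_eq, lpNorm_smul hp, abs_inv, abs_of_pos hr]
      rw [inv_mul_le_iff₀ hr, mul_one]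
    rw [h, Measure.addHaar_smul_of_nonneg _ hr.le, finrank_euclideanSpace_fin, mul_comm,
      ENNReal.ofReal_mul (unitBallVolume_pos hp).le, unitBallVolume,
      ENNReal.ofReal_toReal (unitBall_volume_lt_top hp).ne]
  rcases hr.eq_or_lt with rfl | hr
  · have hd0 : d ≠ 0 := by omega
    rw [zero_pow hd0, mul_zero, ENNReal.ofReal_zero]
    -- Radius zero is not reached by scaling; the volume is bounded by those of the balls of radius
    -- `1 / (n + 1)`, which tend to 0 because `d ≠ 0`.
    refine le_antisymm (ge_of_tendsto' (x := Filter.atTop) (f := fun n : ℕ => ENNReal.ofReal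
      (unitBallVolume d p * (1 / ((n : ℝ) + 1)) ^ d)) ?_ fun n => ?_) zero_le
    · have : Filter.Tendsto (fun n : ℕ => unitBallVolume d p * (1 / ((n : ℝ) + 1)) ^ d)
          Filter.atTop (nhds (unitBallVolume d p * 0 ^ d)) :=
        (tendsto_one_div_add_atTop_nhds_zero_nat.pow d).const_mul _
      have h2 := ENNReal.tendsto_ofReal this
      simpa [hd0] using h2
    · rw [← key _ (by positivity)]
      exact measure_mono fun y hy => le_trans (Set.mem_ofPred.1 hy) (by positivity)
  · exact key r hr

theorem volume_lpBall (hd : 1 ≤ d) (hp : 1 ≤ p) (x : Space d) {r : ℝ} (hr : 0 ≤ r) :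
    volume {y : Space d | lpNorm p (y - x) ≤ r}
      = ENNReal.ofReal (unitBallVolume d p * r ^ d) := by
  rw [← volume_lpBall_zero hd hp hr]
  simp_rw [sub_eq_add_neg]
  exact measure_preimage_add_right volume (-x) {y : Space d | lpNorm p y ≤ r}

end Norm

/-! ### Densities of the regularity class -/

section Density

variable {d : ℕ} {f : Space d → ℝ}

theorem IsDensity.integrable (h : IsDensity f) : Integrable f := by
  by_contra hn
  have := h.integral_eq_one
  rw [integral_undef hn] at this
  exact zero_ne_one this

theorem IsDensity.lintegral_eq_one (h : IsDensity f) : ∫⁻ x, ENNReal.ofReal (f x) = 1 := by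
  rw [← ofReal_integral_eq_lintegral_ofReal h.integrable (ae_of_all _ h.nonneg),
    h.integral_eq_one, ENNReal.ofReal_one]

theorem IsDensity.isProbabilityMeasure_law (h : IsDensity f) : IsProbabilityMeasure (law f) :=
  ⟨by rw [law, withDensity_apply _ MeasurableSet.univ, Measure.restrict_univ, h.lintegral_eq_one]⟩

theorem law_apply {s : Set (Space d)} (hs : MeasurableSet s) :
    law f s = ∫⁻ x in s, ENNReal.ofReal (f x) :=
  withDensity_apply _ hs

theorem integral_law (h : IsDensity f) (g : Space d → ℝ) :
    ∫ x, g x ∂law f = ∫ x, f x * g x := by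
  rw [law, integral_withDensity_eq_integral_toReal_smul h.measurable.ennreal_ofReal
    (ae_of_all _ fun x => ENNReal.ofReal_lt_top)]
  simp [ENNReal.toReal_ofReal (h.nonneg _)]

variable {Ca Cb Cc Cd Ce C0 : ℝ}

/-- The tail condition is a Laplace transform bound: e^{-bq} ∫_{f ≤ q} f ≤ ∫ f e^{-bf} ≤ Cc e^{-C0
b}. For q < C0 the mass of {f ≤ q} is thus exponentially small in b, hence zero. Rational q give a
common null set. -/
theorem Regular.ae_eq_zero_or_mem_Icc (h : Regular Ca Cb Cc Cd Ce C0 f) :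
    ∀ᵐ x, f x = 0 ∨ f x ∈ Set.Icc C0 Ca := by
  have hI : ∀ b : ℝ, 1 < b → Integrable fun x => f x * Real.exp (-b * f x) := fun b hb => by
    refine h.isDensity.integrable.mono' ?_ (ae_of_all _ fun x => ?_)
    · exact (h.isDensity.measurable.mul
        (h.isDensity.measurable.const_mul _).exp).aestronglyMeasurable
    · have h0 := h.isDensity.nonneg x
      rw [Real.norm_of_nonneg (by positivity)]
      refine mul_le_of_le_one_right h0 (Real.exp_le_one_iff.2 ?_)
      nlinarith
  have hq : ∀ q : ℚ, (q : ℝ) < C0 → ∀ᵐ x, f x ≤ q → f x = 0 := by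
    intro q hq
    have hm : MeasurableSet {x | f x ≤ q} := measurableSet_le h.isDensity.measurable
      measurable_const
    have hle : ∀ b : ℝ, 1 < b →
        ∫ x in {x | f x ≤ q}, f x ≤ Cc * Real.exp (-(C0 - q) * b) := by
      intro b hb
      have h1 : Real.exp (-b * q) * ∫ x in {x | f x ≤ q}, f x ≤ Cc * Real.exp (-C0 * b) := by
        calc Real.exp (-b * q) * ∫ x in {x | f x ≤ q}, f x
            = ∫ x in {x | f x ≤ q}, Real.exp (-b * q) * f x := by rw [integral_const_mul]
          _ ≤ ∫ x in {x | f x ≤ q}, f x * Real.exp (-b * f x) := by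
            refine setIntegral_mono_on (h.isDensity.integrable.const_mul _).integrableOn
              (hI b hb).integrableOn hm fun x hx => ?_
            rw [mul_comm]
            refine mul_le_mul_of_nonneg_left (Real.exp_le_exp.2 ?_) (h.isDensity.nonneg x)
            have : f x ≤ q := hx
            nlinarith
          _ ≤ ∫ x, f x * Real.exp (-b * f x) := by
            refine setIntegral_le_integral (hI b hb) (ae_of_all _ fun x => ?_)
            have := h.isDensity.nonneg x
            simp only [Pi.zero_apply]
            positivity
          _ ≤ Cc * Real.exp (-C0 * b) := h.tail b hb
      have h2 : Real.exp (-(C0 - q) * b) = Real.exp (-C0 * b) * Real.exp (b * q) := by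
        rw [← Real.exp_add]
        ring_nf
      have h3 : Real.exp (b * q) * Real.exp (-b * q) = 1 := by
        rw [← Real.exp_add]
        simp
      rw [h2]
      calc ∫ x in {x | f x ≤ q}, f x
          = Real.exp (b * q) * (Real.exp (-b * q) * ∫ x in {x | f x ≤ q}, f x) := by
            rw [← mul_assoc, h3, one_mul]
        _ ≤ Real.exp (b * q) * (Cc * Real.exp (-C0 * b)) := by gcongr
        _ = _ := by ring
    have hlim : Filter.Tendsto (fun b : ℝ => Cc * Real.exp (-(C0 - q) * b)) Filter.atTop
        (nhds 0) := by
      have : Filter.Tendsto (fun b : ℝ => Real.exp (-(C0 - q) * b)) Filter.atTop (nhds 0) := by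
        refine Real.tendsto_exp_atBot.comp ?_
        exact Filter.tendsto_id.const_mul_atTop_of_neg (by linarith)
      simpa using this.const_mul Cc
    have h0 : ∫ x in {x | f x ≤ q}, f x ≤ 0 :=
      ge_of_tendsto hlim ((Filter.eventually_gt_atTop 1).mono fun b hb => hle b hb)
    have h0' : ∫ x in {x | f x ≤ q}, f x = 0 :=
      le_antisymm h0 (setIntegral_nonneg hm fun x _ => h.isDensity.nonneg x)
    rw [setIntegral_eq_zero_iff_of_nonneg_ae (ae_of_all _ h.isDensity.nonneg)
      h.isDensity.integrable.integrableOn] at h0'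
    exact (ae_restrict_iff' hm).1 h0'
  have hall : ∀ᵐ x, ∀ q : ℚ, (q : ℝ) < C0 → f x ≤ q → f x = 0 := by
    rw [ae_all_iff]
    intro q
    by_cases hqC : (q : ℝ) < C0
    · filter_upwards [hq q hqC] with x hx _ using hx
    · exact ae_of_all _ fun x hx => absurd hx hqC
  filter_upwards [hall, h.bounded] with x hx hb
  rcases lt_or_ge (f x) C0 with hlt | hge
  · obtain ⟨q, h1, h2⟩ := exists_rat_btwn hlt
    exact Or.inl (hx q h2 h1.le)
  · exact Or.inr ⟨hge, hb⟩

theorem Regular.lower_le_upper (h : Regular Ca Cb Cc Cd Ce C0 f) : C0 ≤ Ca := by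
  by_contra hlt
  have : ∀ᵐ x, f x = 0 := by
    filter_upwards [h.ae_eq_zero_or_mem_Icc] with x hx
    rcases hx with hx | hx
    · exact hx
    · exact absurd (hx.1.trans hx.2) hlt
  have h1 := h.isDensity.integral_eq_one
  rw [integral_congr_ae this] at h1
  simp at h1

/-- Markov's inequality: total mass one, at height at least `C0` on the support. -/
theorem Regular.volume_support_le (h : Regular Ca Cb Cc Cd Ce C0 f) (hC0 : 0 < C0) :
    volume {x | f x ≠ 0} ≤ ENNReal.ofReal (1 / C0) := by
  have h1 : ENNReal.ofReal C0 * volume {x | ENNReal.ofReal C0 ≤ ENNReal.ofReal (f x)} ≤ 1 := by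
    rw [← h.isDensity.lintegral_eq_one]
    exact mul_meas_ge_le_lintegral h.isDensity.measurable.ennreal_ofReal _
  have h2 : volume {x | f x ≠ 0} ≤ volume {x | ENNReal.ofReal C0 ≤ ENNReal.ofReal (f x)} := by
    refine measure_mono_ae ?_
    filter_upwards [h.ae_eq_zero_or_mem_Icc] with x hx hne
    exact ENNReal.ofReal_le_ofReal ((hx.resolve_left hne).1)
  refine h2.trans ?_
  rw [ENNReal.ofReal_div_of_pos hC0, ENNReal.ofReal_one, ENNReal.le_div_iff_mul_le
    (Or.inl (by simpa using hC0)) (Or.inl ENNReal.ofReal_ne_top), mul_comm]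
  exact h1

theorem Regular.law_le (h : Regular Ca Cb Cc Cd Ce C0 f) :
    law f ≤ ENNReal.ofReal Ca • (volume : Measure (Space d)) := by
  rw [law, ← withDensity_const]
  exact withDensity_mono (h.bounded.mono fun x hx => ENNReal.ofReal_le_ofReal hx)

theorem Regular.ae_law (h : Regular Ca Cb Cc Cd Ce C0 f) :
    ∀ᵐ x ∂law f, f x ∈ Set.Icc C0 Ca := by
  rw [law, ae_withDensity_iff h.isDensity.measurable.ennreal_ofReal]
  filter_upwards [h.ae_eq_zero_or_mem_Icc] with x hx h0
  refine hx.resolve_left fun hx0 => h0 (by simp [hx0])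

/-- A bound for `|log y|` on `[C0, Ca]`. -/
def logBound (C0 Ca : ℝ) : ℝ := |Real.log C0| + |Real.log Ca|

theorem logBound_nonneg : 0 ≤ logBound C0 Ca := by unfold logBound; positivity

theorem abs_log_le_logBound (hC0 : 0 < C0) {y : ℝ} (hy : y ∈ Set.Icc C0 Ca) :
    |Real.log y| ≤ logBound C0 Ca := by
  have h1 := Real.log_le_log hC0 hy.1
  have h2 := Real.log_le_log (hC0.trans_le hy.1) hy.2
  unfold logBound
  rw [abs_le]
  constructor
  · linarith [neg_abs_le (Real.log C0), abs_nonneg (Real.log Ca)]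
  · linarith [le_abs_self (Real.log Ca), abs_nonneg (Real.log C0)]

theorem Regular.integrable_mul_log (h : Regular Ca Cb Cc Cd Ce C0 f) (hC0 : 0 < C0) :
    Integrable fun x => f x * Real.log (f x) := by
  refine (h.isDensity.integrable.const_mul (logBound C0 Ca)).mono'
    (h.isDensity.measurable.mul h.isDensity.measurable.log).aestronglyMeasurable ?_
  filter_upwards [h.ae_eq_zero_or_mem_Icc] with x hx
  rcases hx with hx | hx
  · simp [hx]
  · rw [norm_mul, Real.norm_of_nonneg (h.isDensity.nonneg x), mul_comm]
    exact mul_le_mul_of_nonneg_right (abs_log_le_logBound hC0 hx) (h.isDensity.nonneg x)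

theorem entropy_eq_integral_law (h : IsDensity f) :
    entropy f = -∫ x, Real.log (f x) ∂law f := by
  rw [entropy, integral_law h]

end Density

/-! ### The modulus of continuity in `L¹` of a density of the class -/

section Geometry

variable {n : ℕ}

/-- The volume of a cylinder over an arbitrary base, in a coordinate direction. -/
theorem volume_cylinder (i : Fin (n + 1)) (s : Set ℝ) (B : Set (Fin n → ℝ)) :
    volume {x : Space (n + 1) | x i ∈ s ∧ (fun j => x (i.succAbove j)) ∈ B}
      = volume s * volume B := by
  have e1 := EuclideanSpace.volume_preserving_symm_measurableEquiv_toLp (Fin (n + 1))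
  have e2 := volume_preserving_piFinSuccAbove (fun _ : Fin (n + 1) => ℝ) i
  have h := e1.trans e2
  rw [← Measure.prod_prod s B, ← Measure.volume_eq_prod]
  exact h.measure_preimage_equiv (f := (MeasurableEquiv.toLp 2 (Fin (n + 1) → ℝ)).symm.trans
    (MeasurableEquiv.piFinSuccAbove (fun _ : Fin (n + 1) => ℝ) i)) (s ×ˢ B)

/-- Dropping a coordinate is 1-Lipschitz from the Euclidean to the sup distance, and on `Fin n → ℝ`
with the sup distance the n-dimensional Hausdorff measure is Lebesgue measure. -/
theorem volume_image_succAbove_le (i : Fin (n + 1)) (B : Set (Space (n + 1))) :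
    volume ((fun (x : Space (n + 1)) (j : Fin n) => x (i.succAbove j)) '' B)
      ≤ Measure.hausdorffMeasure (n : ℝ) B := by
  have hL : LipschitzWith 1 (fun (x : Space (n + 1)) (j : Fin n) => x (i.succAbove j)) := by
    refine LipschitzWith.of_dist_le_mul fun x y => ?_
    rw [NNReal.coe_one, one_mul, dist_pi_le_iff dist_nonneg]
    intro j
    rw [dist_eq_norm, dist_eq_norm]
    exact PiLp.norm_apply_le (x - y) (i.succAbove j)
  have h := hL.hausdorffMeasure_image_le (d := n) (by positivity) B
  have h2 := hausdorffMeasure_pi_real (ι := Fin n)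
  rw [Fintype.card_fin] at h2
  rw [h2] at h
  simpa using h

/-- The points from which a segment of length `2 t` in a coordinate direction meets a set `B`
fill a volume of order `t` times the codimension one Hausdorff measure of `B`. -/
theorem volume_segment_meets_le (i : Fin (n + 1)) {t : ℝ} (ht : 0 < t) (B : Set (Space (n + 1))) :
    volume {x : Space (n + 1) | ∃ s ∈ Set.Icc 0 (2 * t), x + s • EuclideanSpace.single i 1 ∈ B}
      ≤ ENNReal.ofReal (3 * t) * Measure.hausdorffMeasure (n : ℝ) B := by
  -- Slabs of thickness t: a segment hitting `B` inside one slab starts in a cylinder of length 3t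
  -- (thickness t plus segment length 2t) over the projection of that piece of `B`.
  let slab : ℤ → Set (Space (n + 1)) := fun m => {x | ⌊x i / t⌋ = m}
  have hslab : ∀ m, MeasurableSet (slab m) := fun m => by
    have : Measurable fun x : Space (n + 1) => ⌊x i / t⌋ := by fun_prop
    exact this (measurableSet_singleton m)
  let π : Space (n + 1) → Fin n → ℝ := fun x j => x (i.succAbove j)
  have hsub : {x : Space (n + 1) | ∃ s ∈ Set.Icc 0 (2 * t),
      x + s • EuclideanSpace.single i 1 ∈ B} ⊆ ⋃ m : ℤ, {x : Space (n + 1) |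
        x i ∈ Set.Ico ((m - 2) * t) ((m + 1) * t) ∧
        (fun j => x (i.succAbove j)) ∈ π '' (slab m ∩ B)} := by
    rintro x ⟨s, hs, hx⟩
    refine Set.mem_iUnion.2
      ⟨⌊(x + s • EuclideanSpace.single i 1 : Space (n + 1)) i / t⌋, ?_, ?_⟩
    · have h1 := Int.floor_le ((x + s • EuclideanSpace.single i 1 : Space (n + 1)) i / t)
      have h2 := Int.lt_floor_add_one ((x + s • EuclideanSpace.single i 1 : Space (n + 1)) i / t)
      rw [le_div_iff₀ ht] at h1
      rw [div_lt_iff₀ ht] at h2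
      set m := ⌊(x + s • EuclideanSpace.single i 1 : Space (n + 1)) i / t⌋
      have h3 : (x + s • EuclideanSpace.single i 1 : Space (n + 1)) i = x i + s := by simp
      rw [h3] at h1 h2
      constructor
      · linarith [hs.2]
      · linarith [hs.1]
    · refine ⟨_, ⟨rfl, hx⟩, ?_⟩
      ext j
      simp [π, Fin.succAbove_ne]
  refine (measure_mono hsub).trans ((measure_iUnion_le _).trans ?_)
  have hcyl : ∀ m : ℤ, volume {x : Space (n + 1) |
        x i ∈ Set.Ico ((m - 2) * t) ((m + 1) * t) ∧
        (fun j => x (i.succAbove j)) ∈ π '' (slab m ∩ B)}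
      ≤ ENNReal.ofReal (3 * t) *
        (Measure.hausdorffMeasure (n : ℝ)).restrict B (slab m) := by
    intro m
    -- `B` need not be measurable. Restricting the Hausdorff measure to `B` and testing it on the
    -- measurable slabs keeps the pieces additive.
    rw [volume_cylinder, Real.volume_Ico, Measure.restrict_apply (hslab m)]
    have : ((m : ℝ) + 1) * t - (m - 2) * t = 3 * t := by ring
    rw [this]
    gcongr
    exact volume_image_succAbove_le i _
  refine (ENNReal.tsum_le_tsum hcyl).trans ?_
  rw [ENNReal.tsum_mul_left, ← measure_iUnion]
  · refine mul_le_mul_right (le_trans (measure_mono (Set.subset_univ _)) ?_) _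
    rw [Measure.restrict_apply_univ]
  · intro a b hab
    refine Set.disjoint_left.2 fun x hx hx' => hab ?_
    exact (show ⌊x i / t⌋ = a from hx).symm.trans hx'
  · exact hslab

end Geometry

/-! ### Second differences along a segment of smooth points. -/

section SecondDifference

variable {d : ℕ} {f : Space d → ℝ}

/-- The mean value inequality, twice: the Hessian bound makes the directional derivative
`C`-Lipschitz along the segment, so s ↦ f(x + (s+t)e) - f(x + se) has derivative at most C t, and
its increment over [0, t] is the second difference. -/
theorem abs_second_difference_le {C t : ℝ} (ht : 0 ≤ t) (x e : Space d) (he : ‖e‖ = 1)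
    (hs : ∀ s ∈ Set.Icc 0 (2 * t), SmoothAt f C (x + s • e)) :
    |f (x + (2 * t) • e) - 2 * f (x + t • e) + f x| ≤ C * t ^ 2 := by
  have hline : ∀ s : ℝ, HasDerivAt (fun s : ℝ => x + s • e) e s := fun s => by
    simpa using ((hasDerivAt_id s).smul_const e).const_add x
  have hg : ∀ s ∈ Set.Icc 0 (2 * t),
      HasDerivAt (fun s : ℝ => f (x + s • e)) (fderiv ℝ f (x + s • e) e) s := fun s h =>
    ((hs s h).1.differentiableAt (by norm_num)).hasFDerivAt.comp_hasDerivAt s (hline s)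
  have hg' : ∀ s ∈ Set.Icc 0 (2 * t),
      HasDerivAt (fun s : ℝ => fderiv ℝ f (x + s • e) e) (hessian f (x + s • e) e e) s := by
    intro s h
    have h1 : ContDiffAt ℝ 1 (fderiv ℝ f) (x + s • e) :=
      (hs s h).1.fderiv_right (by norm_num)
    have h2 := (h1.differentiableAt (by norm_num)).hasFDerivAt.comp_hasDerivAt s (hline s)
    exact h2.clm_apply (hasDerivAt_const s e) |>.congr_deriv (by simp [hessian])
  have hb : ∀ s ∈ Set.Icc 0 (2 * t), ‖hessian f (x + s • e) e e‖ ≤ C := by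
    intro s h
    refine (((hessian f (x + s • e)).le_opNorm₂ e e).trans ?_).trans (hs s h).2.le
    simp [he]
  have hinc : ∀ s ∈ Set.Icc 0 t, ‖fderiv ℝ f (x + (s + t) • e) e - fderiv ℝ f (x + s • e) e‖
      ≤ C * t := by
    intro s h
    have := (convex_Icc 0 (2 * t)).norm_image_sub_le_of_norm_hasDerivWithin_le
      (f := fun s : ℝ => fderiv ℝ f (x + s • e) e)
      (fun s h => (hg' s h).hasDerivWithinAt) hb (x := s) (y := s + t)
      ⟨h.1, by linarith [h.2]⟩ ⟨by linarith [h.1], by linarith [h.2]⟩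
    simpa [abs_of_nonneg ht] using this
  have hD : ∀ s ∈ Set.Icc 0 t, HasDerivWithinAt
      (fun s : ℝ => f (x + (s + t) • e) - f (x + s • e))
      (fderiv ℝ f (x + (s + t) • e) e - fderiv ℝ f (x + s • e) e) (Set.Icc 0 t) s := by
    intro s h
    have h1 := (hg (s + t) ⟨by linarith [h.1], by linarith [h.2]⟩).comp_add_const s t
    exact (h1.sub (hg s ⟨h.1, by linarith [h.2]⟩)).hasDerivWithinAt
  have := (convex_Icc 0 t).norm_image_sub_le_of_norm_hasDerivWithin_le hD hinc (x := 0) (y := t)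
    ⟨le_rfl, ht⟩ ⟨ht, le_rfl⟩
  simp only [zero_add, zero_smul, add_zero, sub_zero, Real.norm_eq_abs, abs_of_nonneg ht,
    ← two_mul] at this
  calc _ = |f (x + (2 * t) • e) - f (x + t • e) - (f (x + t • e) - f x)| := by ring_nf
    _ ≤ C * t * t := this
    _ = C * t ^ 2 := by ring

end SecondDifference

/-! ### The L¹ translation modulus. -/

section Modulus

variable {d : ℕ} {f : Space d → ℝ}

/-- The `L¹` distance between a function and its translate. -/
def translationModulus (f : Space d → ℝ) (z : Space d) : ℝ := ∫ x, |f (x + z) - f x|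

theorem translationModulus_zero (f : Space d → ℝ) : translationModulus f 0 = 0 := by
  simp [translationModulus]

theorem translationModulus_neg (f : Space d → ℝ) (z : Space d) :
    translationModulus f (-z) = translationModulus f z := by
  unfold translationModulus
  rw [← integral_add_right_eq_self _ z]
  refine integral_congr_ae (ae_of_all _ fun x => ?_)
  simp only [add_neg_cancel_right]
  exact abs_sub_comm _ _

theorem IsDensity.integrable_abs_translate_sub (h : IsDensity f) (z : Space d) :
    Integrable fun x => |f (x + z) - f x| :=
  ((h.integrable.comp_add_right z).sub h.integrable).abs

theorem IsDensity.translationModulus_add_le (h : IsDensity f) (z w : Space d) :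
    translationModulus f (z + w) ≤ translationModulus f z + translationModulus f w := by
  have h1 : translationModulus f w = ∫ x, |f (x + z + w) - f (x + z)| :=
    (integral_add_right_eq_self (fun x => |f (x + w) - f x|) z).symm
  have hi : Integrable fun x => |f (x + z + w) - f (x + z)| :=
    (h.integrable_abs_translate_sub w).comp_add_right z
  rw [h1, add_comm (translationModulus f z), translationModulus, translationModulus,
    ← integral_add hi (h.integrable_abs_translate_sub z)]
  refine integral_mono (h.integrable_abs_translate_sub _)
    (hi.add (h.integrable_abs_translate_sub z)) fun x => ?_
  simp only [← add_assoc]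
  exact abs_sub_le _ _ _

theorem IsDensity.translationModulus_le_two (h : IsDensity f) (z : Space d) :
    translationModulus f z ≤ 2 := by
  have : translationModulus f z ≤ ∫ x, (f (x + z) + f x) := by
    refine integral_mono (h.integrable_abs_translate_sub z)
      ((h.integrable.comp_add_right z).add h.integrable) fun x => ?_
    exact abs_le.2 ⟨by linarith [h.nonneg x, h.nonneg (x + z)],
      by linarith [h.nonneg x, h.nonneg (x + z)]⟩
  rw [integral_add (h.integrable.comp_add_right z) h.integrable,
    integral_add_right_eq_self f z, h.integral_eq_one] at this
  linarith

/-- Twice a first difference equals the first difference with doubled step minus a second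
difference. Iterating this trade replaces the missing gradient bound. -/
theorem IsDensity.translationModulus_double (h : IsDensity f) (z : Space d) :
    2 * translationModulus f z ≤ translationModulus f ((2 : ℝ) • z)
      + ∫ x, |f (x + (2 : ℝ) • z) - 2 * f (x + z) + f x| := by
  have hi : Integrable fun x => |f (x + (2 : ℝ) • z) - 2 * f (x + z) + f x| :=
    (((h.integrable.comp_add_right _).sub ((h.integrable.comp_add_right z).const_mul 2)).add
      h.integrable).abs
  rw [translationModulus, translationModulus, ← integral_const_mul,
    ← integral_add (h.integrable_abs_translate_sub _) hi]
  refine integral_mono ((h.integrable_abs_translate_sub z).const_mul 2)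
    ((h.integrable_abs_translate_sub _).add hi) fun x => ?_
  calc 2 * |f (x + z) - f x|
      = |f (x + (2 : ℝ) • z) - f x - (f (x + (2 : ℝ) • z) - 2 * f (x + z) + f x)| := by
        rw [← abs_two, ← abs_mul, abs_two]
        ring_nf
    _ ≤ _ := abs_sub _ _

variable {Ca Cb Cc Cd Ce C0 : ℝ}

/-- The constant in the `L¹` bound of second differences. -/
def secondDifferenceConst (Ca Cd Ce C0 : ℝ) : ℝ := 3 * |Cd| / C0 + 12 * |Ca| * |Ce| + 4

theorem secondDifferenceConst_pos (hC0 : 0 < C0) : 0 < secondDifferenceConst Ca Cd Ce C0 := by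
  unfold secondDifferenceConst
  positivity

/-- For t < 1 space is split by the set `E` of starting points whose segment meets the exceptional
set. On `E` the integrand is at most 4 Ca and the volume at most 3t|Ce|. Off `E` the integrand is at
most |Cd| t² and vanishes outside three translates of the support, each of volume at most 1/C0. -/
theorem Regular.integral_second_difference_le (h : Regular Ca Cb Cc Cd Ce C0 f) (hd : 1 ≤ d)
    (hC0 : 0 < C0) (i : Fin d) {t : ℝ} (ht : 0 < t) :
    ∫ x, |f (x + (2 : ℝ) • t • EuclideanSpace.single i 1) -
        2 * f (x + t • EuclideanSpace.single i 1) + f x|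
      ≤ secondDifferenceConst Ca Cd Ce C0 * t := by
  have hden := h.isDensity
  set e : Space d := EuclideanSpace.single i 1 with he
  have hi2 := hden.integrable.comp_add_right ((2 : ℝ) • t • e)
  have hi1 := hden.integrable.comp_add_right (t • e)
  have hint := ((hi2.sub (hi1.const_mul 2)).add hden.integrable).abs
  -- For t ≥ 1 the total mass 1 + 2 + 1 is enough; the summand 4 of the constant is there for this
  -- case.
  rcases le_or_gt 1 t with h1 | h1
  · have hle : ∫ x, |f (x + (2 : ℝ) • t • e) - 2 * f (x + t • e) + f x|
        ≤ ∫ x, (f (x + (2 : ℝ) • t • e) + 2 * f (x + t • e) + f x) := by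
      refine integral_mono hint ((hi2.add (hi1.const_mul 2)).add hden.integrable) fun x => ?_
      have a1 := hden.nonneg (x + (2 : ℝ) • t • e)
      have a2 := hden.nonneg (x + t • e)
      have a3 := hden.nonneg x
      exact abs_le.2 ⟨by linarith, by linarith⟩
    have heq : ∫ x, (f (x + (2 : ℝ) • t • e) + 2 * f (x + t • e) + f x) = 4 := by
      have hj : Integrable fun x => f (x + (2 : ℝ) • t • e) + 2 * f (x + t • e) :=
        hi2.add (hi1.const_mul 2)
      rw [integral_add hj hden.integrable, integral_add hi2 (hi1.const_mul 2), integral_const_mul,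
        integral_add_right_eq_self f, integral_add_right_eq_self f, hden.integral_eq_one]
      norm_num
    rw [heq] at hle
    have h4 : 4 ≤ secondDifferenceConst Ca Cd Ce C0 := by
      unfold secondDifferenceConst
      have : 0 ≤ 3 * |Cd| / C0 + 12 * |Ca| * |Ce| := by positivity
      linarith
    nlinarith
  · obtain ⟨n, rfl⟩ : ∃ n, d = n + 1 := ⟨d - 1, by omega⟩
    set B : Set (Space (n + 1)) := {x | ¬ SmoothAt f Cd x} with hB
    have hBm : Measure.hausdorffMeasure (n : ℝ) B ≤ ENNReal.ofReal |Ce| := by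
      have := h.boundary.le
      rw [Nat.cast_add, Nat.cast_one, add_sub_cancel_right] at this
      exact this.trans (ENNReal.ofReal_le_ofReal (le_abs_self _))
    -- The set of bad starting points need not be measurable; a measurable hull has the same volume.
    set E := toMeasurable volume {x : Space (n + 1) | ∃ s ∈ Set.Icc 0 (2 * t), x + s • e ∈ B}
      with hE
    have hEm : MeasurableSet E := measurableSet_toMeasurable _ _
    have hEv : volume E ≤ ENNReal.ofReal (3 * t * |Ce|) := by
      rw [hE, measure_toMeasurable, ENNReal.ofReal_mul (by positivity)]
      exact (volume_segment_meets_le i ht B).trans (by gcongr)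
    have hsm : MeasurableSet {x | f x ≠ 0} :=
      (hden.measurable (measurableSet_singleton 0)).compl
    let T : Space (n + 1) → Set (Space (n + 1)) := fun z => {x | f (x + z) ≠ 0}
    have hTm : ∀ z, MeasurableSet (T z) := fun z => hsm.preimage (measurable_id.add_const z)
    have hTv : ∀ z, volume (T z) ≤ ENNReal.ofReal (1 / C0) := fun z => by
      refine le_of_eq_of_le ?_ (h.volume_support_le hC0)
      exact measure_preimage_add_right volume z {x | f x ≠ 0}
    have htr : ∀ z, ∀ᵐ x, f (x + z) ≤ Ca := fun z =>
      (measurePreserving_add_right volume z).quasiMeasurePreserving.ae h.bounded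
    have hCa : 0 ≤ Ca := hC0.le.trans h.lower_le_upper
    have hpt : ∀ᵐ x, |f (x + (2 : ℝ) • t • e) - 2 * f (x + t • e) + f x|
        ≤ E.indicator (fun _ => 4 * Ca) x + ((T ((2 : ℝ) • t • e)).indicator
          (fun _ => |Cd| * t ^ 2) x + ((T (t • e)).indicator (fun _ => |Cd| * t ^ 2) x
          + (T 0).indicator (fun _ => |Cd| * t ^ 2) x)) := by
      filter_upwards [htr ((2 : ℝ) • t • e), htr (t • e), h.bounded] with x b2 b1 b0
      have a1 := hden.nonneg (x + (2 : ℝ) • t • e)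
      have a2 := hden.nonneg (x + t • e)
      have a3 := hden.nonneg x
      have n1 : ∀ s : Set (Space (n + 1)), 0 ≤ s.indicator (fun _ => |Cd| * t ^ 2) x := fun s =>
        Set.indicator_nonneg (fun _ _ => by positivity) x
      by_cases hxE : x ∈ E
      · rw [Set.indicator_of_mem hxE]
        have := n1 (T ((2 : ℝ) • t • e))
        have := n1 (T (t • e))
        have := n1 (T 0)
        exact abs_le.2 ⟨by linarith, by linarith⟩
      · rw [Set.indicator_of_notMem hxE, zero_add]
        have hseg : ∀ s ∈ Set.Icc 0 (2 * t), SmoothAt f Cd (x + s • e) := by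
          intro s hs
          by_contra hns
          exact hxE (subset_toMeasurable _ _ ⟨s, hs, hns⟩)
        have hd2 := abs_second_difference_le ht.le x e (by simp [he]) hseg
        rw [mul_smul] at hd2
        have hd3 : Cd * t ^ 2 ≤ |Cd| * t ^ 2 := by gcongr; exact le_abs_self _
        by_cases hz2 : x ∈ T ((2 : ℝ) • t • e)
        · rw [Set.indicator_of_mem hz2]
          linarith [n1 (T (t • e)), n1 (T 0)]
        by_cases hz1 : x ∈ T (t • e)
        · rw [Set.indicator_of_mem hz1]
          linarith [n1 (T ((2 : ℝ) • t • e)), n1 (T 0)]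
        by_cases hz0 : x ∈ T 0
        · rw [Set.indicator_of_mem hz0]
          linarith [n1 (T ((2 : ℝ) • t • e)), n1 (T (t • e))]
        have e2 : f (x + (2 : ℝ) • t • e) = 0 := not_not.1 hz2
        have e1 : f (x + t • e) = 0 := not_not.1 hz1
        have e0 : f (x + 0) = 0 := not_not.1 hz0
        rw [add_zero] at e0
        rw [e2, e1, e0]
        simp only [mul_zero, sub_zero, add_zero, abs_zero]
        linarith [n1 (T ((2 : ℝ) • t • e)), n1 (T (t • e)), n1 (T 0)]
    have hfin : ∀ z, volume (T z) ≠ ⊤ := fun z => ((hTv z).trans_lt ENNReal.ofReal_lt_top).ne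
    have hEfin : volume E ≠ ⊤ := (hEv.trans_lt ENNReal.ofReal_lt_top).ne
    have iE : Integrable (E.indicator fun _ : Space (n + 1) => 4 * Ca) :=
      (integrable_indicator_iff hEm).2 (integrableOn_const hEfin)
    have iT : ∀ z, Integrable ((T z).indicator fun _ : Space (n + 1) => |Cd| * t ^ 2) :=
      fun z => (integrable_indicator_iff (hTm z)).2 (integrableOn_const (hfin z))
    have vT : ∀ z, ∫ x, (T z).indicator (fun _ : Space (n + 1) => |Cd| * t ^ 2) x
        ≤ 1 / C0 * (|Cd| * t ^ 2) := fun z => by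
      rw [integral_indicator_const _ (hTm z), smul_eq_mul]
      gcongr
      exact ENNReal.toReal_le_of_le_ofReal (by positivity) (hTv z)
    have vE : ∫ x, E.indicator (fun _ : Space (n + 1) => 4 * Ca) x ≤ 3 * t * |Ce| * (4 * Ca) := by
      rw [integral_indicator_const _ hEm, smul_eq_mul]
      gcongr
      exact ENNReal.toReal_le_of_le_ofReal (by positivity) hEv
    have iT2 : Integrable fun x => (T (t • e)).indicator (fun _ => |Cd| * t ^ 2) x
        + (T 0).indicator (fun _ => |Cd| * t ^ 2) x := (iT _).add (iT _)
    have iT3 : Integrable fun x => (T ((2 : ℝ) • t • e)).indicator (fun _ => |Cd| * t ^ 2) x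
        + ((T (t • e)).indicator (fun _ => |Cd| * t ^ 2) x
        + (T 0).indicator (fun _ => |Cd| * t ^ 2) x) := (iT _).add iT2
    refine (integral_mono_ae hint (iE.add iT3) hpt).trans ?_
    rw [integral_add' iE iT3, integral_add (iT _) iT2, integral_add (iT _) (iT _)]
    have hsq : t ^ 2 ≤ t := by nlinarith
    have hC : 1 / C0 * (|Cd| * t ^ 2) ≤ |Cd| / C0 * t := by
      calc 1 / C0 * (|Cd| * t ^ 2) ≤ 1 / C0 * (|Cd| * t) := by gcongr
        _ = _ := by ring
    calc _ ≤ 3 * t * |Ce| * (4 * Ca) + (|Cd| / C0 * t + (|Cd| / C0 * t + |Cd| / C0 * t)) := by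
          gcongr
          · exact (vT _).trans hC
          · exact (vT _).trans hC
          · exact (vT _).trans hC
      _ ≤ secondDifferenceConst Ca Cd Ce C0 * t := by
          unfold secondDifferenceConst
          rw [abs_of_nonneg hCa]
          have : 3 * t * |Ce| * (4 * Ca) + (|Cd| / C0 * t + (|Cd| / C0 * t + |Cd| / C0 * t))
            = (3 * |Cd| / C0 + 12 * Ca * |Ce|) * t := by ring
          rw [this]
          exact mul_le_mul_of_nonneg_right (by linarith) ht.le

/-- After m doublings of ω(t) ≤ ω(2t)/2 + Kt/2 the trivial bound ω ≤ 2 carries the weight 2^{-m},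
while each doubling costs at most K t, the doubled step offsetting the halved weight. With 2^{-m}
comparable to t this is of order t log(1/t). -/
theorem Regular.translationModulus_single_le (h : Regular Ca Cb Cc Cd Ce C0 f) (hd : 1 ≤ d)
    (hC0 : 0 < C0) (i : Fin d) (m : ℕ) {t : ℝ} (ht : 0 < t) :
    translationModulus f (t • EuclideanSpace.single i 1)
      ≤ 2 * (1 / 2) ^ m + m * secondDifferenceConst Ca Cd Ce C0 * t := by
  induction m generalizing t with
  | zero => simpa using h.isDensity.translationModulus_le_two _
  | succ m ih =>
    have h1 := h.isDensity.translationModulus_double (t • EuclideanSpace.single i 1)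
    have h2 := h.integral_second_difference_le hd hC0 i ht
    have h3 := ih (t := 2 * t) (by positivity)
    rw [mul_smul] at h3
    have h4 := mul_pos (secondDifferenceConst_pos (Ca := Ca) (Cd := Cd) (Ce := Ce) hC0) ht
    push_cast
    rw [pow_succ]
    nlinarith

/-- The displacement is decomposed along the coordinate axes; the modulus is subadditive and even.
-/
theorem Regular.translationModulus_le (h : Regular Ca Cb Cc Cd Ce C0 f) (hd : 1 ≤ d)
    (hC0 : 0 < C0) (m : ℕ) {R : ℝ} (hR : 0 ≤ R) (z : Space d) (hz : ∀ i, |z i| ≤ R) :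
    translationModulus f z
      ≤ d * (2 * (1 / 2) ^ m + m * secondDifferenceConst Ca Cd Ce C0 * R) := by
  have hK := secondDifferenceConst_pos (Ca := Ca) (Cd := Cd) (Ce := Ce) hC0
  set b := 2 * (1 / 2 : ℝ) ^ m + m * secondDifferenceConst Ca Cd Ce C0 * R with hb
  have hb0 : 0 ≤ b := by positivity
  have hone : ∀ i, translationModulus f (z i • EuclideanSpace.single i 1) ≤ b := by
    intro i
    have hle : ∀ t : ℝ, 0 < t → t ≤ R →
        translationModulus f (t • EuclideanSpace.single i 1) ≤ b := fun t ht htR => by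
      refine (h.translationModulus_single_le hd hC0 i m ht).trans ?_
      rw [hb]
      gcongr
    rcases lt_trichotomy (z i) 0 with hz0 | hz0 | hz0
    · rw [← translationModulus_neg, ← neg_smul]
      exact hle _ (by linarith) ((neg_le_abs _).trans (hz i))
    · rw [hz0, zero_smul, translationModulus_zero]
      exact hb0
    · exact hle _ hz0 ((le_abs_self _).trans (hz i))
  have hsum : ∀ s : Finset (Fin d),
      translationModulus f (∑ i ∈ s, z i • EuclideanSpace.single i 1) ≤ s.card * b := by
    intro s
    induction s using Finset.induction_on with
    | empty => simp [translationModulus_zero]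
    | insert i s hi ih =>
      rw [Finset.sum_insert hi, Finset.card_insert_of_notMem hi]
      refine (h.isDensity.translationModulus_add_le _ _).trans ?_
      push_cast
      linarith [hone i]
  have hz' : z = ∑ i, z i • (EuclideanSpace.single i 1 : Space d) := by
    ext j
    simp [Pi.single_apply]
  rw [hz']
  simpa using hsum Finset.univ

end Modulus

/-! ### Oscillation of a density over small balls -/

section Oscillation

variable {d : ℕ} {p : ℝ≥0∞} {f : Space d → ℝ}

/-- The mean of `|f (x + z) - f x|` over the `ℓ_p` ball of radius `R`. -/
def localOscillation (p : ℝ≥0∞) (f : Space d → ℝ) (R : ℝ) (x : Space d) : ℝ≥0∞ :=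
  (ENNReal.ofReal (unitBallVolume d p * R ^ d))⁻¹ *
    ∫⁻ z in {z : Space d | lpNorm p z ≤ R}, ENNReal.ofReal |f (x + z) - f x|

/-- The sum of the local oscillations over the dyadic radii below `a`. -/
def dyadicOscillation (p : ℝ≥0∞) (f : Space d → ℝ) (a : ℝ) (x : Space d) : ℝ≥0∞ :=
  ∑' j : ℕ, localOscillation p f (a * (1 / 2) ^ j) x

/-- The mass which the law of density `f` gives to the closed `ℓ_p` ball. -/
def ballMass (p : ℝ≥0∞) (f : Space d → ℝ) (x : Space d) (r : ℝ) : ℝ :=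
  (law f {y | lpNorm p (y - x) ≤ r}).toReal

theorem measurable_localOscillation (h : Measurable f) (R : ℝ) :
    Measurable (localOscillation p f R) := by
  refine Measurable.const_mul ?_ _
  refine Measurable.lintegral_prod_right' (f := fun q : Space d × Space d =>
    ENNReal.ofReal |f (q.1 + q.2) - f q.1|) ?_
  fun_prop

theorem measurable_dyadicOscillation (h : Measurable f) (a : ℝ) :
    Measurable (dyadicOscillation p f a) :=
  Measurable.tsum fun _ => measurable_localOscillation h _

/-- Tonelli: integrating in x first leaves a mean of translation moduli over the ball. -/
theorem IsDensity.lintegral_localOscillation_le (h : IsDensity f) (hd : 1 ≤ d) (hp : 1 ≤ p)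
    {R b : ℝ} (hR : 0 < R)
    (hb : ∀ z : Space d, lpNorm p z ≤ R → translationModulus f z ≤ b) :
    ∫⁻ x, localOscillation p f R x ≤ ENNReal.ofReal b := by
  have hf := h.measurable
  have hm : MeasurableSet {z : Space d | lpNorm p z ≤ R} :=
    measurableSet_le (measurable_lpNorm hp) measurable_const
  have hsw : ∫⁻ x, ∫⁻ z in {z : Space d | lpNorm p z ≤ R}, ENNReal.ofReal |f (x + z) - f x|
      = ∫⁻ z in {z : Space d | lpNorm p z ≤ R}, ∫⁻ x, ENNReal.ofReal |f (x + z) - f x| :=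
    lintegral_lintegral_swap (by fun_prop)
  have hv : ENNReal.ofReal (unitBallVolume d p * R ^ d) ≠ 0 := by
    have := unitBallVolume_pos (d := d) hp
    rw [ne_eq, ENNReal.ofReal_eq_zero, not_le]
    positivity
  unfold localOscillation
  rw [lintegral_const_mul' _ _ (ENNReal.inv_ne_top.2 hv), hsw]
  calc _ ≤ (ENNReal.ofReal (unitBallVolume d p * R ^ d))⁻¹ *
        ∫⁻ _z in {z : Space d | lpNorm p z ≤ R}, ENNReal.ofReal b := by
        refine mul_le_mul_right (setLIntegral_mono measurable_const fun z hz => ?_) _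
        rw [← ofReal_integral_eq_lintegral_ofReal (h.integrable_abs_translate_sub z)
          (ae_of_all _ fun _ => abs_nonneg _)]
        exact ENNReal.ofReal_le_ofReal (hb z hz)
    _ = ENNReal.ofReal b := by
        rw [setLIntegral_const, volume_lpBall_zero hd hp hR.le, mul_comm (ENNReal.ofReal b),
          ← mul_assoc, ENNReal.inv_mul_cancel hv ENNReal.ofReal_ne_top, one_mul]

variable {Ca Cb Cc Cd Ce C0 : ℝ}

/-- At radius a 2^{-j} the modulus is used with M + j doublings. Both of its parts are then at most
a 2^{-j} times an affine function of M + j, which sums over j to a multiple of a, with a factor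
affine in M. -/
theorem Regular.lintegral_dyadicOscillation_le (h : Regular Ca Cb Cc Cd Ce C0 f) (hd : 1 ≤ d)
    (hC0 : 0 < C0) (hp : 1 ≤ p) {a : ℝ} (ha : 0 < a) (M : ℕ) (hM : (1 / 2) ^ M ≤ a) :
    ∫⁻ x, dyadicOscillation p f a x
      ≤ ENNReal.ofReal (d * a * (4 + 2 * secondDifferenceConst Ca Cd Ce C0 * (M + 1))) := by
  have hK := secondDifferenceConst_pos (Ca := Ca) (Cd := Cd) (Ce := Ce) hC0
  set K := secondDifferenceConst Ca Cd Ce C0 with hKdef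
  let u : ℕ → ℝ := fun j => d * a * (2 + K * M) * (1 / 2) ^ j + d * a * K * (j * (1 / 2) ^ j)
  have hterm : ∀ j : ℕ, ∫⁻ x, localOscillation p f (a * (1 / 2) ^ j) x ≤ ENNReal.ofReal (u j) := by
    intro j
    refine h.isDensity.lintegral_localOscillation_le hd hp (by positivity) fun z hz => ?_
    refine (h.translationModulus_le hd hC0 (M + j) (by positivity) z
      (fun i => (abs_apply_le_lpNorm hp z i).trans hz)).trans ?_
    have h1 : (1 / 2 : ℝ) ^ (M + j) ≤ a * (1 / 2) ^ j := by
      rw [pow_add]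
      gcongr
    push_cast
    calc (d : ℝ) * (2 * (1 / 2) ^ (M + j) + (M + j) * K * (a * (1 / 2) ^ j))
        ≤ d * (2 * (a * (1 / 2) ^ j) + (M + j) * K * (a * (1 / 2) ^ j)) := by gcongr
      _ = u j := by simp only [u]; ring
  have hgeo : HasSum (fun j : ℕ => (1 / 2 : ℝ) ^ j) 2 := hasSum_geometric_two
  have hgeo' : HasSum (fun j : ℕ => (j : ℝ) * (1 / 2) ^ j) 2 := by
    have := hasSum_coe_mul_geometric_of_norm_lt_one (r := (1 / 2 : ℝ)) (by norm_num)
    norm_num at this ⊢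
    exact this
  have hu : HasSum u (d * a * (4 + 2 * K * (M + 1))) := by
    have := (hgeo.mul_left (d * a * (2 + K * M))).add (hgeo'.mul_left (d * a * K))
    have e : d * a * (4 + 2 * K * (M + 1)) = d * a * (2 + K * M) * 2 + d * a * K * 2 := by ring
    rw [e]
    exact this
  unfold dyadicOscillation
  rw [lintegral_tsum fun j => (measurable_localOscillation h.isDensity.measurable _).aemeasurable,
    ← hu.tsum_eq, ENNReal.ofReal_tsum_of_nonneg (fun j => by positivity) hu.summable]
  exact ENNReal.tsum_le_tsum hterm

theorem IsDensity.ballMass_eq_integral (h : IsDensity f) (hp : 1 ≤ p) (x : Space d) (r : ℝ) :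
    ballMass p f x r = ∫ y in {y | lpNorm p (y - x) ≤ r}, f y := by
  rw [ballMass, law_apply (measurableSet_lpBall hp x r),
    ← ofReal_integral_eq_lintegral_ofReal h.integrable.integrableOn (ae_of_all _ h.nonneg),
    ENNReal.toReal_ofReal (integral_nonneg h.nonneg)]

/-- Some dyadic radius satisfies r ≤ R ≤ 2r; the integral of |f - f(x)| over the small ball is at
most that over the ball of radius R, and the ratio of volumes is at most 2^d. -/
theorem IsDensity.abs_ballMass_sub_le (h : IsDensity f) (hd : 1 ≤ d) (hp : 1 ≤ p) {a s r : ℝ}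
    (ha : 0 < a) (hs : 0 ≤ s) {x : Space d} (hx : dyadicOscillation p f a x ≤ ENNReal.ofReal s)
    (hr : 0 < r) (hra : r ≤ a) :
    |ballMass p f x r - unitBallVolume d p * r ^ d * f x|
      ≤ 2 ^ d * s * (unitBallVolume d p * r ^ d) := by
  have hc := unitBallVolume_pos (d := d) hp
  obtain ⟨j, hj1, hj2⟩ := exists_nat_pow_near_of_lt_one (x := r / a) (y := 1 / 2) (by positivity)
    ((div_le_one ha).2 hra) (by norm_num) (by norm_num)
  rw [lt_div_iff₀ ha] at hj1
  rw [div_le_iff₀ ha] at hj2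
  set R := a * (1 / 2) ^ j with hR
  have hR0 : 0 < R := by positivity
  have hrR : r ≤ R := by linarith
  have hR2 : R ≤ 2 * r := by
    rw [pow_succ] at hj1
    linarith
  have hball : MeasurableSet {y : Space d | lpNorm p (y - x) ≤ r} := measurableSet_lpBall hp x r
  have hvol := volume_lpBall hd hp x hr.le
  have hosc : localOscillation p f R x ≤ ENNReal.ofReal s := (ENNReal.le_tsum j).trans hx
  have hv0 : ENNReal.ofReal (unitBallVolume d p * R ^ d) ≠ 0 := by
    rw [ne_eq, ENNReal.ofReal_eq_zero, not_le]
    positivity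
  have hI : ∫⁻ z in {z : Space d | lpNorm p z ≤ R}, ENNReal.ofReal |f (x + z) - f x|
      ≤ ENNReal.ofReal (unitBallVolume d p * R ^ d * s) := by
    rw [ENNReal.ofReal_mul (by positivity)]
    calc _ = ENNReal.ofReal (unitBallVolume d p * R ^ d) * localOscillation p f R x := by
          rw [localOscillation, ← mul_assoc, ENNReal.mul_inv_cancel hv0 ENNReal.ofReal_ne_top,
            one_mul]
      _ ≤ _ := by gcongr
  have htr : ∫⁻ y in {y : Space d | lpNorm p (y - x) ≤ r}, ENNReal.ofReal |f y - f x|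
      ≤ ∫⁻ z in {z : Space d | lpNorm p z ≤ R}, ENNReal.ofReal |f (x + z) - f x| := by
    rw [← lintegral_indicator hball, ← lintegral_indicator (measurableSet_le
      (measurable_lpNorm hp) measurable_const), ← lintegral_add_left_eq_self _ x]
    refine lintegral_mono fun z => ?_
    rw [Set.indicator_apply, Set.indicator_apply]
    simp only [Set.mem_ofPred_eq, add_sub_cancel_left]
    split_ifs with h1 h2
    · exact le_rfl
    · exact absurd (h1.trans hrR) h2
    · exact zero_le
    · exact le_rfl
  have hconst : IntegrableOn (fun _ : Space d => f x) {y : Space d | lpNorm p (y - x) ≤ r} :=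
    integrableOn_const (by rw [hvol]; exact ENNReal.ofReal_ne_top)
  have hdiff : ballMass p f x r - unitBallVolume d p * r ^ d * f x
      = ∫ y in {y | lpNorm p (y - x) ≤ r}, (f y - f x) := by
    rw [integral_sub h.integrable.integrableOn hconst, h.ballMass_eq_integral hp,
      setIntegral_const, Measure.real, hvol, ENNReal.toReal_ofReal (by positivity), smul_eq_mul]
  rw [hdiff]
  calc |∫ y in {y | lpNorm p (y - x) ≤ r}, (f y - f x)|
      ≤ ∫ y in {y | lpNorm p (y - x) ≤ r}, |f y - f x| := abs_integral_le_integral_abs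
    _ ≤ unitBallVolume d p * R ^ d * s := by
        rw [integral_eq_lintegral_of_nonneg_ae (ae_of_all _ fun _ => abs_nonneg _)
          (h.measurable.sub_const _).abs.aestronglyMeasurable]
        exact ENNReal.toReal_le_of_le_ofReal (by positivity) (htr.trans hI)
    _ ≤ unitBallVolume d p * (2 * r) ^ d * s := by gcongr
    _ = _ := by ring

end Oscillation

/-! ### Resampling one coordinate and the Efron–Stein inequality -/

section EfronStein

variable {ι E : Type*} [Fintype ι] [DecidableEq ι] [MeasurableSpace E]
  (μ : Measure E) [IsProbabilityMeasure μ]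

/-- Replacing one coordinate by an independent draw does not change the product law; conditioning on
the other coordinates is expressed this way below. -/
theorem measurePreserving_update (i : ι) :
    MeasurePreserving (fun q : (ι → E) × E => Function.update q.1 i q.2)
      ((Measure.pi fun _ : ι => μ).prod μ) (Measure.pi fun _ : ι => μ) := by
  refine ⟨measurable_update', (Measure.pi_eq fun s hs => ?_).symm⟩
  rw [Measure.map_apply measurable_update' (MeasurableSet.univ_pi hs)]
  have hpre : (fun q : (ι → E) × E => Function.update q.1 i q.2) ⁻¹' Set.univ.pi s
      = (Set.univ.pi (Function.update s i Set.univ)) ×ˢ s i := by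
    ext ⟨X, y⟩
    simp only [Set.mem_preimage, Set.mem_univ_pi, Set.mem_prod]
    constructor
    · intro h
      refine ⟨fun j => ?_, by simpa using h i⟩
      by_cases hj : j = i
      · subst hj; simp
      · simpa [Function.update_of_ne hj] using h j
    · rintro ⟨h1, h2⟩ j
      by_cases hj : j = i
      · subst hj; simpa using h2
      · simpa [Function.update_of_ne hj] using h1 j
  rw [hpre, Measure.prod_prod, Measure.pi_pi, ← Finset.mul_prod_erase _ _ (Finset.mem_univ i),
    ← Finset.mul_prod_erase _ (fun j => μ (s j)) (Finset.mem_univ i)]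
  rw [Function.update_self, measure_univ, one_mul, mul_comm]
  congr 1
  refine Finset.prod_congr rfl fun j hj => ?_
  rw [Function.update_of_ne (Finset.ne_of_mem_erase hj)]

theorem lintegral_pi_update (i : ι) {F : (ι → E) → ℝ≥0∞} (hF : Measurable F) :
    ∫⁻ X, F X ∂Measure.pi (fun _ => μ)
      = ∫⁻ X, ∫⁻ y, F (Function.update X i y) ∂μ ∂Measure.pi (fun _ => μ) := by
  rw [← (measurePreserving_update μ i).lintegral_comp hF]
  exact lintegral_prod _ (hF.comp measurable_update').aemeasurable

theorem lintegral_pi_update_symm (i : ι) {F : (ι → E) → ℝ≥0∞} (hF : Measurable F) :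
    ∫⁻ X, F X ∂Measure.pi (fun _ => μ)
      = ∫⁻ y, ∫⁻ X, F (Function.update X i y) ∂Measure.pi (fun _ => μ) ∂μ := by
  rw [← (measurePreserving_update μ i).lintegral_comp hF]
  exact lintegral_prod_symm' _ (hF.comp measurable_update')

/-- Integrating out one coordinate of a product. -/
theorem lintegral_pi_mul_le (i : ι) {G H : (ι → E) → ℝ≥0∞} (hG : Measurable G)
    (hH : Measurable H) (hGi : ∀ X y, G (Function.update X i y) = G X) {c : ℝ≥0∞}
    (hc : ∀ X, ∫⁻ y, H (Function.update X i y) ∂μ ≤ c) :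
    ∫⁻ X, G X * H X ∂Measure.pi (fun _ => μ) ≤ c * ∫⁻ X, G X ∂Measure.pi (fun _ => μ) := by
  rw [lintegral_pi_update μ i (F := fun X => G X * H X) (hG.mul hH), ← lintegral_const_mul _ hG]
  refine lintegral_mono fun X => ?_
  simp only [hGi]
  rw [lintegral_const_mul _ (show Measurable fun y => H (Function.update X i y) from
    hH.comp (measurable_update X)), mul_comm]
  gcongr
  exact hc X

variable {μ}

theorem sq_integral_le_integral_sq {w : E → ℝ} (hw : Integrable w μ)
    (hw2 : Integrable (fun x => w x ^ 2) μ) : (∫ x, w x ∂μ) ^ 2 ≤ ∫ x, w x ^ 2 ∂μ := by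
  have h : 0 ≤ ∫ x, (w x - ∫ x, w x ∂μ) ^ 2 ∂μ := integral_nonneg fun _ => sq_nonneg _
  have e : ∫ x, (w x - ∫ x, w x ∂μ) ^ 2 ∂μ = ∫ x, w x ^ 2 ∂μ - (∫ x, w x ∂μ) ^ 2 := by
    set m := ∫ x, w x ∂μ with hm
    have : ∀ x, (w x - m) ^ 2 = w x ^ 2 - 2 * m * w x + m ^ 2 := fun x => by ring
    simp_rw [this]
    have hi : Integrable (fun x => w x ^ 2 - 2 * m * w x) μ := hw2.sub (hw.const_mul _)
    rw [integral_add hi (integrable_const _), integral_sub hw2 (hw.const_mul _),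
      integral_const_mul, ← hm]
    simp
    ring
  linarith

theorem integrable_of_lintegral_sq_lt_top {w : E → ℝ} (hw : Measurable w)
    (h : ∫⁻ x, ENNReal.ofReal (w x ^ 2) ∂μ < ⊤) :
    Integrable w μ ∧ Integrable (fun x => w x ^ 2) μ := by
  have h2 : Integrable (fun x => w x ^ 2) μ := by
    refine ⟨(hw.pow_const 2).aestronglyMeasurable, ?_⟩
    rw [hasFiniteIntegral_iff_ofReal (ae_of_all _ fun _ => sq_nonneg _)]
    exact h
  refine ⟨(h2.add (integrable_const 1)).mono' hw.aestronglyMeasurable (ae_of_all _ fun x => ?_), h2⟩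
  rw [Real.norm_eq_abs, abs_le]
  simp only [Pi.add_apply]
  constructor <;> nlinarith [sq_nonneg (w x + 1), sq_nonneg (w x - 1)]

/-- Orthogonality: E(u - Ek)² = Var u + (E(u - k))², where Var u ≤ E(u - g)² and (E(u - k))² ≤ E(u -
k)². This is the one-coordinate step of the Efron–Stein inequality. -/
theorem lintegral_sq_sub_integral_le {u k : E → ℝ} (hu : Measurable u) (hk : Measurable k) (g : ℝ) :
    ∫⁻ x, ENNReal.ofReal ((u x - ∫ y, k y ∂μ) ^ 2) ∂μ
      ≤ ∫⁻ x, ENNReal.ofReal ((u x - g) ^ 2) ∂μ + ∫⁻ x, ENNReal.ofReal ((u x - k x) ^ 2) ∂μ := by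
  by_cases h1 : ∫⁻ x, ENNReal.ofReal ((u x - g) ^ 2) ∂μ = ⊤
  · simp [h1]
  by_cases h2 : ∫⁻ x, ENNReal.ofReal ((u x - k x) ^ 2) ∂μ = ⊤
  · simp [h2]
  obtain ⟨hv, hv2⟩ := integrable_of_lintegral_sq_lt_top (w := fun x => u x - g)
    (hu.sub_const g) (lt_top_iff_ne_top.2 h1)
  obtain ⟨hw, hw2⟩ := integrable_of_lintegral_sq_lt_top (w := fun x => u x - k x)
    (hu.sub hk) (lt_top_iff_ne_top.2 h2)
  have hki : ∫ x, k x ∂μ = ∫ x, (u x - g) ∂μ - ∫ x, (u x - k x) ∂μ + g := by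
    have : ∫ x, k x ∂μ = ∫ x, ((u x - g) - (u x - k x) + g) ∂μ :=
      integral_congr_ae (ae_of_all _ fun x => by ring)
    rw [this, integral_add (by exact hv.sub hw) (integrable_const g), integral_sub hv hw]
    simp
  set m := ∫ x, k x ∂μ with hm
  have hexp : ∀ x, (u x - m) ^ 2 = (u x - g) ^ 2 + 2 * (g - m) * (u x - g) + (g - m) ^ 2 :=
    fun x => by ring
  have hi : Integrable (fun x => (u x - g) ^ 2 + 2 * (g - m) * (u x - g)) μ :=
    hv2.add (hv.const_mul _)
  have hi' : Integrable (fun x => (u x - m) ^ 2) μ := by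
    simp_rw [hexp]
    exact hi.add (integrable_const _)
  rw [← ofReal_integral_eq_lintegral_ofReal hi' (ae_of_all _ fun _ => sq_nonneg _),
    ← ofReal_integral_eq_lintegral_ofReal hv2 (ae_of_all _ fun _ => sq_nonneg _),
    ← ofReal_integral_eq_lintegral_ofReal hw2 (ae_of_all _ fun _ => sq_nonneg _),
    ← ENNReal.ofReal_add (integral_nonneg fun _ => sq_nonneg _)
      (integral_nonneg fun _ => sq_nonneg _)]
  refine ENNReal.ofReal_le_ofReal ?_
  have e : ∫ x, (u x - m) ^ 2 ∂μ = ∫ x, (u x - g) ^ 2 ∂μ + 2 * (g - m) * ∫ x, (u x - g) ∂μ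
      + (g - m) ^ 2 := by
    simp_rw [hexp]
    rw [integral_add hi (integrable_const _), integral_add hv2 (hv.const_mul _),
      integral_const_mul]
    simp
  have hj := sq_integral_le_integral_sq hw hw2
  have hmw : ∫ x, (u x - k x) ∂μ = ∫ x, (u x - g) ∂μ + (g - m) := by linarith
  rw [hmw] at hj
  rw [e]
  nlinarith [sq_nonneg (∫ x, (u x - g) ∂μ)]

variable (μ) in
/-- The Efron–Stein inequality, with an arbitrary constant in place of the mean. -/
theorem efron_stein [Nonempty E] {F : (ι → E) → ℝ} (hF : Measurable F) {G : ι → (ι → E) → ℝ}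
    (hG : ∀ i, Measurable (G i)) (hGi : ∀ i X y, G i (Function.update X i y) = G i X) :
    ∃ c : ℝ, ∫⁻ X, ENNReal.ofReal ((F X - c) ^ 2) ∂Measure.pi (fun _ => μ)
      ≤ ∑ i, ∫⁻ X, ENNReal.ofReal ((F X - G i X) ^ 2) ∂Measure.pi (fun _ => μ) := by
  -- Coordinates are averaged out one at a time: `K` ignores those in `s`, and averaging over one
  -- more coordinate `j` adds only the error of `G j`.
  have key : ∀ s : Finset ι, ∃ K : (ι → E) → ℝ, Measurable K ∧
      (∀ i ∈ s, ∀ X y, K (Function.update X i y) = K X) ∧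
      ∫⁻ X, ENNReal.ofReal ((F X - K X) ^ 2) ∂Measure.pi (fun _ => μ)
        ≤ ∑ i ∈ s, ∫⁻ X, ENNReal.ofReal ((F X - G i X) ^ 2) ∂Measure.pi (fun _ => μ) := by
    intro s
    induction s using Finset.induction_on with
    | empty => exact ⟨F, hF, by simp, by simp⟩
    | insert j s hj ih =>
      obtain ⟨K, hK, hKs, hle⟩ := ih
      have hKp : Measurable fun X => ∫ y, K (Function.update X j y) ∂μ :=
        ((hK.comp measurable_update').stronglyMeasurable.integral_prod_right').measurable
      refine ⟨fun X => ∫ y, K (Function.update X j y) ∂μ, hKp, ?_, ?_⟩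
      · intro i hi X y
        by_cases hij : i = j
        · subst hij
          simp
        · have his : i ∈ s := (Finset.mem_insert.1 hi).resolve_left hij
          refine integral_congr_ae (ae_of_all _ fun z => ?_)
          simp only
          rw [Function.update_comm hij, hKs i his]
      · rw [Finset.sum_insert hj]
        refine le_trans ?_ (add_le_add_right hle _)
        have hres : ∀ {K' : (ι → E) → ℝ}, Measurable K' →
            ∫⁻ X, ENNReal.ofReal ((F X - K' X) ^ 2) ∂Measure.pi (fun _ => μ)
              = ∫⁻ X, ∫⁻ y, ENNReal.ofReal ((F (Function.update X j y)
                - K' (Function.update X j y)) ^ 2) ∂μ ∂Measure.pi (fun _ => μ) := fun hK' =>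
          lintegral_pi_update μ j ((hF.sub hK').pow_const 2).ennreal_ofReal
        rw [hres hKp, hres (hG j), hres hK, ← lintegral_add_left]
        · refine lintegral_mono fun X => ?_
          simp only [Function.update_idem, hGi]
          exact lintegral_sq_sub_integral_le (hF.comp (measurable_update X))
            (hK.comp (measurable_update X)) _
        · exact Measurable.lintegral_prod_right'
            (f := fun q : (ι → E) × E => ENNReal.ofReal
              ((F (Function.update q.1 j q.2) - G j (Function.update q.1 j q.2)) ^ 2))
            (((hF.comp measurable_update').sub ((hG j).comp measurable_update')).pow_const
              2).ennreal_ofReal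
  obtain ⟨K, hK, hKs, hle⟩ := key Finset.univ
  obtain ⟨y0⟩ := ‹Nonempty E›
  -- A function that ignores each coordinate is constant: overwrite the coordinates by `y0` one
  -- after another.
  have hconst : ∀ (X : ι → E) (s : Finset ι),
      K (fun i => if i ∈ s then y0 else X i) = K X := by
    intro X s
    induction s using Finset.induction_on with
    | empty => simp
    | insert j s hj ih =>
      rw [← ih, ← hKs j (Finset.mem_univ j) (fun i => if i ∈ s then y0 else X i) y0]
      congr 1
      ext i
      by_cases hij : i = j
      · subst hij; simp
      · simp [hij]
  refine ⟨K fun _ => y0, hle.trans' (le_of_eq ?_)⟩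
  refine lintegral_congr fun X => ?_
  rw [← hconst X Finset.univ]
  simp

end EfronStein

/-! ### The `k`-th smallest value of a finite family -/

section KthValue

variable {ι : Type*}

/-- The `k`-th smallest of the nonnegative numbers `D j`, `j ∈ s`. -/
def kthValue (k : ℕ) (s : Finset ι) (D : ι → ℝ) : ℝ :=
  sInf {r : ℝ | 0 ≤ r ∧ k ≤ (s.filter fun j => D j ≤ r).card}

variable {k : ℕ} {s : Finset ι} {D : ι → ℝ}

theorem kthValue_nonneg (k : ℕ) (s : Finset ι) (D : ι → ℝ) : 0 ≤ kthValue k s D :=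
  Real.sInf_nonneg fun _ hr => hr.1

/-- The infimum is attained because the admissible radii form a closed set: a finite union, over the
subsets with at least k elements, of intersections of closed half-lines. -/
theorem kthValue_mem (hk : k ≤ s.card) :
    k ≤ (s.filter fun j => D j ≤ kthValue k s D).card := by
  have hbdd : BddBelow {r : ℝ | 0 ≤ r ∧ k ≤ (s.filter fun j => D j ≤ r).card} :=
    ⟨0, fun r hr => hr.1⟩
  have hne : {r : ℝ | 0 ≤ r ∧ k ≤ (s.filter fun j => D j ≤ r).card}.Nonempty := by
    refine ⟨∑ j ∈ s, |D j|, Finset.sum_nonneg fun _ _ => abs_nonneg _, ?_⟩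
    rw [Finset.filter_true_of_mem]
    · exact hk
    · intro j hj
      exact (le_abs_self _).trans (Finset.single_le_sum (f := fun j => |D j|)
        (fun _ _ => abs_nonneg _) hj)
  have heq : {r : ℝ | 0 ≤ r ∧ k ≤ (s.filter fun j => D j ≤ r).card}
      = Set.Ici 0 ∩ ⋃ A ∈ s.powerset.filter (fun A => k ≤ A.card), ⋂ j ∈ A, Set.Ici (D j) := by
    ext r
    simp only [Set.mem_ofPred_eq, Set.mem_inter_iff, Set.mem_Ici, Set.mem_iUnion, Set.mem_iInter,
      Finset.mem_filter, Finset.mem_powerset, exists_prop]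
    refine and_congr_right fun _ => ⟨fun h => ?_, ?_⟩
    · exact ⟨s.filter fun j => D j ≤ r, ⟨Finset.filter_subset _ _, h⟩,
        fun j hj => (Finset.mem_filter.1 hj).2⟩
    · rintro ⟨A, ⟨hAs, hAk⟩, hA⟩
      exact hAk.trans (Finset.card_le_card fun j hj =>
        Finset.mem_filter.2 ⟨hAs hj, hA j hj⟩)
  have hcl : IsClosed {r : ℝ | 0 ≤ r ∧ k ≤ (s.filter fun j => D j ≤ r).card} := by
    rw [heq]
    exact isClosed_Ici.inter (Set.Finite.isClosed_biUnion (Finset.finite_toSet _)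
      fun A _ => isClosed_biInter fun j _ => isClosed_Ici)
  exact (hcl.csInf_mem hne hbdd).2

theorem kthValue_le_iff (hk : k ≤ s.card) {r : ℝ} (hr : 0 ≤ r) :
    kthValue k s D ≤ r ↔ k ≤ (s.filter fun j => D j ≤ r).card := by
  constructor
  · intro h
    refine (kthValue_mem (D := D) hk).trans (Finset.card_le_card fun j hj => ?_)
    rw [Finset.mem_filter] at hj ⊢
    exact ⟨hj.1, hj.2.trans h⟩
  · intro h
    exact csInf_le ⟨0, fun r hr => hr.1⟩ ⟨hr, h⟩

/-- For a decreasing majorant this bounds its value at the k-th distance by a sum over single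
distances, with no need for the law of the order statistic. -/
theorem exists_le_kthValue (hk1 : 1 ≤ k) (hk : k ≤ s.card) : ∃ j ∈ s, D j ≤ kthValue k s D := by
  have h := hk1.trans (kthValue_mem (D := D) hk)
  obtain ⟨j, hj⟩ := Finset.card_pos.1 h
  exact ⟨j, (Finset.mem_filter.1 hj).1, (Finset.mem_filter.1 hj).2⟩

theorem measurable_kthValue {Ω : Type*} [MeasurableSpace Ω] {D : Ω → ι → ℝ}
    (hD : ∀ j ∈ s, Measurable fun ω => D ω j) (hk : k ≤ s.card) :
    Measurable fun ω => kthValue k s (D ω) := by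
  classical
  refine measurable_of_Iic fun r => ?_
  rcases lt_or_ge r 0 with hr | hr
  · convert MeasurableSet.empty using 1
    ext ω
    simpa using hr.trans_le (kthValue_nonneg k s (D ω))
  · have : (fun ω => kthValue k s (D ω)) ⁻¹' Set.Iic r
        = {ω | (k : ℝ) ≤ ∑ j ∈ s, {ω | D ω j ≤ r}.indicator (fun _ => (1 : ℝ)) ω} := by
      ext ω
      rw [Set.mem_preimage, Set.mem_Iic, kthValue_le_iff hk hr, Set.mem_ofPred_eq,
        Finset.card_filter, ← Nat.cast_le (α := ℝ)]
      simp [Set.indicator_apply]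
    rw [this]
    refine measurableSet_le measurable_const (Finset.measurable_fun_sum _ fun j hj => ?_)
    exact measurable_const.indicator (measurableSet_le (hD j hj) measurable_const)

/-- Removing a point at distance more than `a` does not change the `k`-th value below `a`. -/
theorem kthValue_erase_le_iff [DecidableEq ι] {i : ι} (hk : k ≤ (s.erase i).card) {r : ℝ}
    (hr : 0 ≤ r) (hi : r < D i) : kthValue k (s.erase i) D ≤ r ↔ kthValue k s D ≤ r := by
  rw [kthValue_le_iff hk hr, kthValue_le_iff (hk.trans (Finset.card_le_card
    (Finset.erase_subset _ _))) hr, Finset.filter_erase, Finset.erase_eq_of_notMem]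
  simp [hi]

end KthValue

/-! ### Locality and size of the local estimate. -/

section LocalScore

/-- The local estimate as a function of the distance to the `k`-th nearest neighbour. -/
def localScore (d : ℕ) (p : ℝ≥0∞) (k : ℕ) (δ : ℝ) (N : ℕ) (ρ : ℝ) : ℝ :=
  if ρ ≤ threshold d δ N then
    -digamma k + Real.log N + Real.log (unitBallVolume d p) + d * Real.log ρ
  else 0

variable {d N k : ℕ} {p : ℝ≥0∞} {δ : ℝ}

theorem knnDist_eq_kthValue (X : Fin N → Space d) (i : Fin N) :
    knnDist p k X i
      = kthValue k (Finset.univ.erase i) fun j => lpNorm p (X j - X i) := by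
  classical
  unfold knnDist kthValue
  congr 1
  ext r
  refine and_congr_right fun _ => ?_
  rw [← Set.ncard_coe_finset]
  simp

theorem localEstimate_eq_localScore (X : Fin N → Space d) (i : Fin N) :
    localEstimate p k δ X i = localScore d p k δ N
      (kthValue k (Finset.univ.erase i) fun j => lpNorm p (X j - X i)) := by
  unfold localEstimate localScore
  rw [knnDist_eq_kthValue]

theorem measurable_localScore : Measurable (localScore d p k δ N) := by
  unfold localScore
  exact Measurable.ite (measurableSet_le measurable_id measurable_const) (by fun_prop)
    measurable_const

/-- This is what the truncation buys: below the threshold the k-th value does not see a removed far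
point, and above it both scores are 0. The estimator becomes local at scale a_N. -/
theorem localScore_kthValue_erase {ι : Type*} [DecidableEq ι] {s : Finset ι} {D : ι → ℝ} {i : ι}
    (hk : k ≤ (s.erase i).card) (hi : threshold d δ N < D i) :
    localScore d p k δ N (kthValue k (s.erase i) D) = localScore d p k δ N (kthValue k s D) := by
  have h0 := kthValue_nonneg k s D
  have h0' := kthValue_nonneg k (s.erase i) D
  by_cases h : kthValue k s D ≤ threshold d δ N
  · have h1 := (kthValue_erase_le_iff hk h0 (h.trans_lt hi)).2 le_rfl
    have h2 := (kthValue_erase_le_iff hk h0' ((h1.trans h).trans_lt hi)).1 le_rfl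
    rw [le_antisymm h1 h2]
  · have h' : ¬ kthValue k (s.erase i) D ≤ threshold d δ N := fun h1 =>
      h ((kthValue_erase_le_iff hk (h0'.trans h1) hi).1 h1)
    rw [localScore, localScore, if_neg h, if_neg h']

/-- A majorant of the square of the negative part of `log (N ρ ^ d)`, infinite at `ρ = 0`. -/
def logSqMajorant (d N : ℕ) (ρ : ℝ) : ℝ≥0∞ :=
  ∑' j : ℕ, if N * ρ ^ d ≤ Real.exp (-1) ^ j then ((2 * j + 1 : ℕ) : ℝ≥0∞) else 0

theorem logSqMajorant_anti {ρ ρ' : ℝ} (h0 : 0 ≤ ρ) (h : ρ ≤ ρ') :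
    logSqMajorant d N ρ' ≤ logSqMajorant d N ρ := by
  refine ENNReal.tsum_le_tsum fun j => ?_
  by_cases h1 : N * ρ' ^ d ≤ Real.exp (-1) ^ j
  · have h2 : N * ρ ^ d ≤ Real.exp (-1) ^ j := le_trans (by gcongr) h1
    rw [if_pos h1, if_pos h2]
  · rw [if_neg h1]
    exact zero_le

theorem logSqMajorant_zero (hd : 1 ≤ d) : logSqMajorant d N 0 = ⊤ := by
  have h0 : d ≠ 0 := by omega
  unfold logSqMajorant
  refine top_unique ?_
  calc (⊤ : ℝ≥0∞) = ∑' _j : ℕ, 1 := by rw [ENNReal.tsum_const_eq_top_of_ne_zero one_ne_zero]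
    _ ≤ _ := by
      refine ENNReal.tsum_le_tsum fun j => ?_
      rw [if_pos (by rw [zero_pow h0, mul_zero]; positivity)]
      exact_mod_cast Nat.le_add_left 1 _

/-- Put u = -log(N ρ^d) ≥ 0. The layers j ≤ ⌊u⌋ are all present, and their odd weights add up to
(⌊u⌋ + 1)² ≥ u². -/
theorem sq_log_le_logSqMajorant {ρ : ℝ} (hρ : 0 < ρ) (hN : 0 < N)
    (h : N * ρ ^ d ≤ 1) :
    ENNReal.ofReal (Real.log (N * ρ ^ d) ^ 2) ≤ logSqMajorant d N ρ := by
  have hN' : (0 : ℝ) < N := by exact_mod_cast hN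
  have ht : 0 < N * ρ ^ d := by positivity
  set u := -Real.log (N * ρ ^ d) with hu
  have hu0 : 0 ≤ u := by
    have := Real.log_nonpos ht.le h
    linarith
  have hsum : ∀ n : ℕ, ∑ j ∈ Finset.range n, (2 * j + 1) = n ^ 2 := fun n => by
    induction n with
    | zero => simp
    | succ n ih => rw [Finset.sum_range_succ, ih]; ring
  have hsq : Real.log (N * ρ ^ d) ^ 2 ≤ (((⌊u⌋₊ + 1) ^ 2 : ℕ) : ℝ) := by
    have h1 := (Nat.lt_floor_add_one u).le
    have : Real.log (N * ρ ^ d) ^ 2 = u ^ 2 := by rw [hu]; ring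
    rw [this]
    push_cast
    gcongr
  refine (ENNReal.ofReal_le_ofReal hsq).trans ?_
  rw [ENNReal.ofReal_natCast, ← hsum]
  unfold logSqMajorant
  refine le_trans ?_ (ENNReal.sum_le_tsum (Finset.range (⌊u⌋₊ + 1)))
  rw [Nat.cast_sum]
  refine Finset.sum_le_sum fun j hj => ?_
  rw [if_pos]
  have hj' : (j : ℝ) ≤ u :=
    (Nat.cast_le.2 (Nat.lt_succ_iff.1 (Finset.mem_range.1 hj))).trans (Nat.floor_le hu0)
  rw [← Real.exp_nat_mul, ← Real.exp_log ht]
  exact Real.exp_le_exp.2 (by linarith)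

theorem measurable_logSqMajorant : Measurable (logSqMajorant d N) := by
  refine Measurable.tsum fun j => Measurable.ite ?_ measurable_const measurable_const
  exact measurableSet_le (by fun_prop) measurable_const

/-- The size of the local estimate away from its singularity. -/
def scoreBound (d : ℕ) (p : ℝ≥0∞) (k : ℕ) (δ : ℝ) (N : ℕ) : ℝ :=
  |digamma k| + |Real.log (unitBallVolume d p)| + (1 + δ) * Real.log (Real.log N)

theorem natCast_mul_threshold_pow (hd : 1 ≤ d) (hN : 3 ≤ N) :
    N * threshold d δ N ^ d = Real.log N ^ (1 + δ) := by
  have hN' : (0 : ℝ) < N := by positivity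
  have hl : 0 ≤ Real.log N := Real.log_natCast_nonneg N
  have hd0 : d ≠ 0 := by omega
  rw [threshold, one_div, Real.rpow_inv_natCast_pow (by positivity) hd0]
  field_simp

theorem one_lt_log_natCast (hN : 3 ≤ N) : 1 < Real.log N := by
  have h3 : (3 : ℝ) ≤ N := by exact_mod_cast hN
  rw [Real.lt_log_iff_exp_lt (by linarith)]
  linarith [Real.exp_one_lt_d9]

theorem scoreBound_nonneg (hδ : 0 < δ) (hN : 3 ≤ N) : 0 ≤ scoreBound d p k δ N := by
  have := Real.log_nonneg (one_lt_log_natCast hN).le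
  unfold scoreBound
  positivity

/-- Because N a_N^d = (log N)^{1+δ}, the logarithm of N ρ^d lies between 0 and (1+δ) log log N when
ρ is below the threshold and 1 ≤ N ρ^d. Only small ρ produce large scores, and these are left to the
majorant. -/
theorem sq_localScore_le (hd : 1 ≤ d) (hδ : 0 < δ) (hN : 3 ≤ N) {ρ : ℝ} (hρ : 0 ≤ ρ) :
    ENNReal.ofReal (localScore d p k δ N ρ ^ 2)
      ≤ ENNReal.ofReal (2 * scoreBound d p k δ N ^ 2) + 2 * logSqMajorant d N ρ := by
  have hL := scoreBound_nonneg (d := d) (p := p) (k := k) hδ hN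
  have hN' : (0 : ℝ) < N := by positivity
  -- At ρ = 0 the real logarithm takes a default value, but the majorant is infinite there.
  rcases hρ.eq_or_lt with rfl | hρ
  · rw [logSqMajorant_zero hd]
    simp
  by_cases h : ρ ≤ threshold d δ N
  · have hscore : localScore d p k δ N ρ = -digamma k + Real.log (unitBallVolume d p)
        + Real.log (N * ρ ^ d) := by
      rw [localScore, if_pos h, Real.log_mul hN'.ne' (by positivity), Real.log_pow]
      ring
    have hup : Real.log (N * ρ ^ d) ≤ (1 + δ) * Real.log (Real.log N) := by
      rw [← Real.log_rpow (by linarith [one_lt_log_natCast hN]),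
        ← natCast_mul_threshold_pow hd hN]
      exact Real.log_le_log (by positivity) (by gcongr)
    have hb : |(-digamma k + Real.log (unitBallVolume d p))|
        ≤ |digamma k| + |Real.log (unitBallVolume d p)| := by
      refine (abs_add_le _ _).trans ?_
      rw [abs_neg]
    have hb' := abs_le.1 hb
    have hll := Real.log_nonneg (one_lt_log_natCast hN).le
    rcases le_total (N * ρ ^ d) 1 with h1 | h1
    · have hlog := Real.log_nonpos (by positivity) h1
      calc ENNReal.ofReal (localScore d p k δ N ρ ^ 2)
          ≤ ENNReal.ofReal (2 * scoreBound d p k δ N ^ 2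
            + 2 * Real.log (N * ρ ^ d) ^ 2) := by
            refine ENNReal.ofReal_le_ofReal ?_
            rw [hscore]
            have h2 : (-digamma k + Real.log (unitBallVolume d p)) ^ 2
                ≤ scoreBound d p k δ N ^ 2 := by
              refine sq_le_sq.2 ?_
              rw [abs_of_nonneg hL, scoreBound]
              have : 0 ≤ (1 + δ) * Real.log (Real.log N) := by positivity
              linarith
            nlinarith [sq_nonneg (-digamma k + Real.log (unitBallVolume d p)
              - Real.log (N * ρ ^ d))]
        _ ≤ _ := by
            rw [ENNReal.ofReal_add (by positivity) (by positivity)]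
            gcongr
            rw [ENNReal.ofReal_mul (by norm_num)]
            simpa using mul_le_mul_right (sq_log_le_logSqMajorant hρ (by omega) h1) 2
    · have hlog := Real.log_nonneg h1
      refine le_trans (ENNReal.ofReal_le_ofReal ?_) le_self_add
      have h2 : localScore d p k δ N ρ ^ 2 ≤ scoreBound d p k δ N ^ 2 := by
        refine sq_le_sq.2 ?_
        rw [abs_of_nonneg hL, scoreBound, hscore, abs_le]
        constructor <;> linarith
      nlinarith
  · rw [localScore, if_neg h]
    simp

theorem sq_localScore_kthValue_le {ι : Type*} (hd : 1 ≤ d) (hδ : 0 < δ) (hN : 3 ≤ N)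
    (hk1 : 1 ≤ k) {s : Finset ι} (hk : k ≤ s.card) {D : ι → ℝ} (hD : ∀ j, 0 ≤ D j) :
    ENNReal.ofReal (localScore d p k δ N (kthValue k s D) ^ 2)
      ≤ ENNReal.ofReal (2 * scoreBound d p k δ N ^ 2) + 2 * ∑ j ∈ s, logSqMajorant d N (D j) := by
  refine (sq_localScore_le hd hδ hN (kthValue_nonneg k s D)).trans ?_
  obtain ⟨j, hj, hle⟩ := exists_le_kthValue (D := D) hk1 hk
  gcongr
  exact (logSqMajorant_anti (hD j) hle).trans
    (Finset.single_le_sum (f := fun j => logSqMajorant d N (D j)) (fun _ _ => zero_le) hj)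

end LocalScore

/-! ### Moments of products of pair interactions -/

section PairInteraction

variable {d : ℕ} {ι : Type*} [Fintype ι] [DecidableEq ι] (μ : Measure (Space d))
  [IsProbabilityMeasure μ]

/-- The point `X l` occurs in the kernel factor only, so it is integrated first with everything else
fixed. -/
theorem lintegral_mul_pair_le {K : Space d → ℝ≥0∞} (hK : Measurable K) {c : ℝ≥0∞}
    (hc : ∀ x, ∫⁻ y, K (y - x) ∂μ ≤ c) {G : (ι → Space d) → ℝ≥0∞} (hG : Measurable G)
    {l j : ι} (hlj : l ≠ j) (hGl : ∀ X y, G (Function.update X l y) = G X) :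
    ∫⁻ X, G X * K (X l - X j) ∂Measure.pi (fun _ => μ)
      ≤ c * ∫⁻ X, G X ∂Measure.pi (fun _ => μ) := by
  refine lintegral_pi_mul_le μ l hG (by fun_prop) hGl fun X => ?_
  simp only [Function.update_self, Function.update_of_ne hlj.symm]
  exact hc _

theorem lintegral_pair_le {K : Space d → ℝ≥0∞} (hK : Measurable K) {c : ℝ≥0∞}
    (hc : ∀ x, ∫⁻ y, K (y - x) ∂μ ≤ c) {l j : ι} (hlj : l ≠ j) :
    ∫⁻ X, K (X l - X j) ∂Measure.pi (fun _ : ι => μ) ≤ c := by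
  have := lintegral_mul_pair_le μ hK hc (ι := ι) (G := fun _ => 1) measurable_const hlj
    (fun _ _ => rfl)
  simpa using this

variable {b φ : Space d → ℝ≥0∞} (hb : Measurable b) (hφ : Measurable φ)
  (hb1 : ∀ z, b z ≤ 1) {q v : ℝ≥0∞}
  (hq : ∀ x, ∫⁻ y, b (y - x) ∂μ ≤ q) (hv : ∀ x, ∫⁻ y, φ (y - x) ∂μ ≤ v)

include hφ hv in
theorem lintegral_sum_pair_le (ℓ : ℝ≥0∞) (j : ι) :
    ∫⁻ X, (ℓ + ∑ l ∈ Finset.univ.erase j, φ (X l - X j)) ∂Measure.pi (fun _ : ι => μ)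
      ≤ ℓ + Fintype.card ι * v := by
  rw [lintegral_add_left measurable_const, lintegral_finsetSum _ (fun l _ => by fun_prop)]
  simp only [lintegral_const, measure_univ, mul_one]
  refine add_le_add_right ((Finset.sum_le_sum fun l hl =>
    lintegral_pair_le μ hφ hv (Finset.ne_of_mem_erase hl)).trans ?_) _
  rw [Finset.sum_const, nsmul_eq_mul]
  gcongr
  exact Finset.card_le_univ _

include hb hφ hb1 hq hv in
-- For l ≠ i the point X_l is free and is integrated first. For l = i both kernels join the same
-- pair of points, and b ≤ 1 is simply dropped.
theorem lintegral_pair_mul_sum_le (ℓ : ℝ≥0∞) {i j : ι} (hj : j ≠ i) :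
    ∫⁻ X, b (X j - X i) * (ℓ + ∑ l ∈ Finset.univ.erase j, φ (X l - X j))
        ∂Measure.pi (fun _ : ι => μ)
      ≤ q * (ℓ + Fintype.card ι * v) + v := by
  have hB : ∫⁻ X, b (X j - X i) ∂Measure.pi (fun _ : ι => μ) ≤ q := lintegral_pair_le μ hb hq hj
  simp_rw [mul_add, Finset.mul_sum]
  rw [lintegral_add_left (by fun_prop), lintegral_mul_const _ (by fun_prop),
    lintegral_finsetSum _ (fun l _ => by fun_prop), add_assoc]
  refine add_le_add (mul_le_mul_left hB _) ?_
  have hterm : ∀ l ∈ Finset.univ.erase j,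
      ∫⁻ X, b (X j - X i) * φ (X l - X j) ∂Measure.pi (fun _ : ι => μ)
        ≤ q * v + if l = i then v else 0 := by
    intro l hl
    have hlj := Finset.ne_of_mem_erase hl
    by_cases hli : l = i
    · subst hli
      rw [if_pos rfl]
      refine le_trans ?_ le_add_self
      refine le_trans (lintegral_mono fun X => ?_) (lintegral_pair_le μ hφ hv hlj)
      exact mul_le_of_le_one_left zero_le (hb1 _)
    · rw [if_neg hli, add_zero]
      refine (lintegral_mul_pair_le μ hφ hv (by fun_prop) hlj fun X y => ?_).trans ?_
      · rw [Function.update_of_ne hlj.symm, Function.update_of_ne (Ne.symm hli)]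
      · rw [mul_comm]
        gcongr
  refine (Finset.sum_le_sum hterm).trans ?_
  rw [Finset.sum_add_distrib, Finset.sum_const, nsmul_eq_mul, Finset.sum_ite_eq']
  refine add_le_add ?_ (by split_ifs <;> simp)
  rw [mul_left_comm]
  gcongr
  exact Finset.card_le_univ _

include hb hφ hb1 hq hv in
-- A generic l contributes q² v. If l = i or l = m the three kernels live on the points i, j, m
-- only; one factor b that closes a cycle is dropped, and integrating the rest gives q v.
theorem lintegral_pair_mul_pair_mul_sum_le (ℓ : ℝ≥0∞) {i j m : ι} (hj : j ≠ i) (hm : m ≠ i)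
    (hmj : m ≠ j) :
    ∫⁻ X, b (X m - X i) * (b (X j - X i) * (ℓ + ∑ l ∈ Finset.univ.erase j, φ (X l - X j)))
        ∂Measure.pi (fun _ : ι => μ)
      ≤ q ^ 2 * (ℓ + Fintype.card ι * v) + 2 * (q * v) := by
  have hB : ∫⁻ X, b (X j - X i) ∂Measure.pi (fun _ : ι => μ) ≤ q := lintegral_pair_le μ hb hq hj
  have hBB : ∫⁻ X, b (X j - X i) * b (X m - X i) ∂Measure.pi (fun _ : ι => μ) ≤ q ^ 2 := by
    refine (lintegral_mul_pair_le μ hb hq (by fun_prop) hm fun X y => ?_).trans ?_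
    · rw [Function.update_of_ne hmj.symm, Function.update_of_ne hm.symm]
    · rw [sq]
      gcongr
  have hre : ∀ X : ι → Space d, b (X m - X i) * (b (X j - X i) *
      (ℓ + ∑ l ∈ Finset.univ.erase j, φ (X l - X j)))
      = b (X j - X i) * b (X m - X i) * ℓ
        + ∑ l ∈ Finset.univ.erase j, b (X j - X i) * b (X m - X i) * φ (X l - X j) := fun X => by
    rw [← Finset.mul_sum]
    ring
  simp_rw [hre]
  rw [lintegral_add_left (by fun_prop), lintegral_mul_const _ (by fun_prop),
    lintegral_finsetSum _ (fun l _ => by fun_prop), mul_add, add_assoc]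
  refine add_le_add (mul_le_mul_left hBB _) ?_
  have hterm : ∀ l ∈ Finset.univ.erase j,
      ∫⁻ X, b (X j - X i) * b (X m - X i) * φ (X l - X j) ∂Measure.pi (fun _ : ι => μ)
        ≤ q ^ 2 * v + ((if l = i then q * v else 0) + if l = m then q * v else 0) := by
    intro l hl
    have hlj := Finset.ne_of_mem_erase hl
    by_cases hli : l = i
    · subst hli
      rw [if_pos rfl, if_neg hm.symm, add_zero]
      refine le_trans ?_ le_add_self
      have : ∫⁻ X, φ (X l - X j) * b (X m - X l) ∂Measure.pi (fun _ : ι => μ) ≤ q * v := by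
        refine (lintegral_mul_pair_le μ hb hq (by fun_prop) hm fun X y => ?_).trans ?_
        · rw [Function.update_of_ne hm.symm, Function.update_of_ne hmj.symm]
        · gcongr
          exact lintegral_pair_le μ hφ hv hlj
      refine le_trans (lintegral_mono fun X => ?_) this
      rw [mul_assoc, mul_comm (b (X m - X l))]
      exact mul_le_of_le_one_left zero_le (hb1 _)
    · rw [if_neg hli]
      by_cases hlm : l = m
      · subst hlm
        rw [if_pos rfl, zero_add]
        refine le_trans ?_ le_add_self
        have : ∫⁻ X, b (X j - X i) * φ (X l - X j) ∂Measure.pi (fun _ : ι => μ) ≤ q * v := by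
          refine (lintegral_mul_pair_le μ hφ hv (by fun_prop) hlj fun X y => ?_).trans ?_
          · rw [Function.update_of_ne hlj.symm, Function.update_of_ne (Ne.symm hli)]
          · rw [mul_comm]
            gcongr
        refine le_trans (lintegral_mono fun X => ?_) this
        refine mul_le_mul_left ?_ _
        exact mul_le_of_le_one_right zero_le (hb1 _)
      · rw [if_neg hlm, add_zero, add_zero]
        refine (lintegral_mul_pair_le μ hφ hv (by fun_prop) hlj fun X y => ?_).trans ?_
        · rw [Function.update_of_ne hlj.symm, Function.update_of_ne (Ne.symm hli),
            Function.update_of_ne (Ne.symm hlm)]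
        · rw [mul_comm]
          gcongr
  refine (Finset.sum_le_sum hterm).trans ?_
  rw [Finset.sum_add_distrib, Finset.sum_const, nsmul_eq_mul, Finset.sum_add_distrib,
    Finset.sum_ite_eq', Finset.sum_ite_eq', two_mul]
  refine add_le_add ?_ (add_le_add (by split_ifs <;> simp) (by split_ifs <;> simp))
  rw [mul_left_comm]
  gcongr
  exact Finset.card_le_univ _

include hb hφ hb1 hq hv in
-- The double sum over m and j is expanded; on the diagonal m = j one of the two factors b is
-- dropped, and off the diagonal the three-point bound applies.
theorem lintegral_card_mul_sum_le (ℓ : ℝ≥0∞) (i : ι) :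
    ∫⁻ X, (∑ m ∈ Finset.univ.erase i, b (X m - X i)) * (∑ j ∈ Finset.univ.erase i,
        b (X j - X i) * (ℓ + ∑ l ∈ Finset.univ.erase j, φ (X l - X j)))
        ∂Measure.pi (fun _ : ι => μ)
      ≤ 2 * (1 + Fintype.card ι * q) ^ 2 * (ℓ + Fintype.card ι * v) := by
  set n : ℝ≥0∞ := (Fintype.card ι : ℝ≥0∞) with hn
  simp_rw [Finset.sum_mul_sum]
  rw [lintegral_finsetSum _ (fun m _ => by fun_prop)]
  have hcard : (((Finset.univ.erase i : Finset ι).card : ℕ) : ℝ≥0∞) ≤ n := by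
    rw [hn]
    exact_mod_cast Finset.card_le_univ _
  have hrow : ∀ m ∈ Finset.univ.erase i,
      ∫⁻ X, ∑ j ∈ Finset.univ.erase i, b (X m - X i) *
        (b (X j - X i) * (ℓ + ∑ l ∈ Finset.univ.erase j, φ (X l - X j)))
        ∂Measure.pi (fun _ : ι => μ)
      ≤ n * (q ^ 2 * (ℓ + n * v) + 2 * (q * v)) + (q * (ℓ + n * v) + v) := by
    intro m hm
    rw [lintegral_finsetSum _ (fun m _ => by fun_prop)]
    have hterm : ∀ j ∈ Finset.univ.erase i,
        ∫⁻ X, b (X m - X i) * (b (X j - X i) *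
          (ℓ + ∑ l ∈ Finset.univ.erase j, φ (X l - X j))) ∂Measure.pi (fun _ : ι => μ)
        ≤ (q ^ 2 * (ℓ + n * v) + 2 * (q * v)) + if j = m then q * (ℓ + n * v) + v else 0 := by
      intro j hj
      by_cases hjm : j = m
      · subst hjm
        rw [if_pos rfl]
        refine le_trans ?_ le_add_self
        refine le_trans (lintegral_mono fun X => ?_) (lintegral_pair_mul_sum_le μ hb hφ hb1
         hq hv ℓ (Finset.ne_of_mem_erase hj))
        exact mul_le_of_le_one_left zero_le (hb1 _)
      · rw [if_neg hjm, add_zero]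
        exact lintegral_pair_mul_pair_mul_sum_le μ hb hφ hb1 hq hv ℓ
          (Finset.ne_of_mem_erase hj) (Finset.ne_of_mem_erase hm) (Ne.symm hjm)
    refine (Finset.sum_le_sum hterm).trans ?_
    rw [Finset.sum_add_distrib, Finset.sum_const, nsmul_eq_mul, Finset.sum_ite_eq']
    refine add_le_add (by gcongr) (by split_ifs <;> simp)
  refine (Finset.sum_le_sum hrow).trans ?_
  rw [Finset.sum_const, nsmul_eq_mul]
  calc _ ≤ n * (n * (q ^ 2 * (ℓ + n * v) + 2 * (q * v)) + (q * (ℓ + n * v) + v)) := by gcongr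
    _ = (n * q + (n * q) ^ 2) * (ℓ + n * v) + (1 + 2 * (n * q)) * (n * v) := by ring
    _ ≤ (n * q + (n * q) ^ 2) * (ℓ + n * v) + (1 + 2 * (n * q)) * (ℓ + n * v) := by
        gcongr
        exact le_add_self
    _ = (1 + 3 * (n * q) + (n * q) ^ 2) * (ℓ + n * v) := by ring
    -- The added polynomial completes the factor to 2 (1 + nq)².
    _ ≤ (1 + 3 * (n * q) + (n * q) ^ 2) * (ℓ + n * v)
        + (1 + n * q + (n * q) ^ 2) * (ℓ + n * v) := le_self_add
    _ = _ := by ring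

end PairInteraction

/-! ### The variance of the estimator -/

section Variance

variable {d k N : ℕ} {p : ℝ≥0∞} {δ : ℝ} {f : Space d → ℝ} {Ca Cb Cc Cd Ce C0 : ℝ}

theorem Regular.law_lpBall_le (h : Regular Ca Cb Cc Cd Ce C0 f) (hC0 : 0 < C0) (hd : 1 ≤ d)
    (hp : 1 ≤ p) (x : Space d) {r : ℝ} (hr : 0 ≤ r) :
    law f {y | lpNorm p (y - x) ≤ r} ≤ ENNReal.ofReal (Ca * (unitBallVolume d p * r ^ d)) := by
  rw [ENNReal.ofReal_mul (hC0.le.trans h.lower_le_upper), ← volume_lpBall hd hp x hr]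
  exact h.law_le _

/-- The sum of `(2 j + 1) exp (-j)`. -/
def expMoment : ℝ := ∑' j : ℕ, ((2 * j + 1 : ℕ) : ℝ) * Real.exp (-1) ^ j

theorem summable_expMoment : Summable fun j : ℕ => ((2 * j + 1 : ℕ) : ℝ) * Real.exp (-1) ^ j := by
  have hr : ‖Real.exp (-1)‖ < 1 := by
    rw [Real.norm_of_nonneg (Real.exp_pos _).le]
    rw [Real.exp_lt_one_iff]
    norm_num
  have h1 := (hasSum_coe_mul_geometric_of_norm_lt_one hr).summable
  have h2 := summable_geometric_of_norm_lt_one hr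
  refine ((h1.mul_left 2).add h2).congr fun j => ?_
  push_cast
  ring

theorem expMoment_nonneg : 0 ≤ expMoment := tsum_nonneg fun _ => by positivity

/-- Layer j is a ball with r^d = e^{-j}/N, of probability at most Ca c e^{-j}/N; the weighted layers
sum to the constant `expMoment`. -/
theorem Regular.lintegral_logSqMajorant_le (h : Regular Ca Cb Cc Cd Ce C0 f) (hC0 : 0 < C0)
    (hd : 1 ≤ d) (hp : 1 ≤ p) (hN : 0 < N) (x : Space d) :
    ∫⁻ y, logSqMajorant d N (lpNorm p (y - x)) ∂law f
      ≤ ENNReal.ofReal (Ca * unitBallVolume d p * expMoment / N) := by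
  have hCa := hC0.le.trans h.lower_le_upper
  have hc := unitBallVolume_pos (d := d) hp
  have hN' : (0 : ℝ) < N := by exact_mod_cast hN
  have hd0 : d ≠ 0 := by omega
  have hmeas : Measurable fun y : Space d => lpNorm p (y - x) :=
    (measurable_lpNorm hp).comp (measurable_id.sub_const x)
  have hset : ∀ j : ℕ, MeasurableSet {y : Space d | N * lpNorm p (y - x) ^ d ≤ Real.exp (-1) ^ j} :=
    fun j => measurableSet_le ((hmeas.pow_const d).const_mul _) measurable_const
  unfold logSqMajorant
  rw [lintegral_tsum fun j => (Measurable.ite (hset j) measurable_const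
    measurable_const).aemeasurable]
  have hterm : ∀ j : ℕ, ∫⁻ y, (if N * lpNorm p (y - x) ^ d ≤ Real.exp (-1) ^ j then
      ((2 * j + 1 : ℕ) : ℝ≥0∞) else 0) ∂law f
      ≤ ENNReal.ofReal (Ca * unitBallVolume d p / N *
        (((2 * j + 1 : ℕ) : ℝ) * Real.exp (-1) ^ j)) := by
    intro j
    set r : ℝ := (Real.exp (-1) ^ j / N) ^ ((d : ℝ)⁻¹) with hr
    have hr0 : 0 ≤ r := by positivity
    have hrd : r ^ d = Real.exp (-1) ^ j / N := Real.rpow_inv_natCast_pow (by positivity) hd0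
    have hle : law f {y : Space d | N * lpNorm p (y - x) ^ d ≤ Real.exp (-1) ^ j}
        ≤ ENNReal.ofReal (Ca * (unitBallVolume d p * r ^ d)) := by
      refine (measure_mono fun y hy => ?_).trans (h.law_lpBall_le hC0 hd hp x hr0)
      refine le_of_pow_le_pow_left₀ hd0 hr0 ?_
      rw [hrd, le_div_iff₀ hN', mul_comm]
      exact hy
    have heq : ∀ y : Space d, (if N * lpNorm p (y - x) ^ d ≤ Real.exp (-1) ^ j then
        ((2 * j + 1 : ℕ) : ℝ≥0∞) else 0)
        = {y : Space d | N * lpNorm p (y - x) ^ d ≤ Real.exp (-1) ^ j}.indicator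
          (fun _ => ((2 * j + 1 : ℕ) : ℝ≥0∞)) y := fun y => rfl
    simp_rw [heq]
    rw [lintegral_indicator_const (hset j)]
    refine (mul_le_mul_right hle _).trans (le_of_eq ?_)
    rw [hrd, ← ENNReal.ofReal_natCast, ← ENNReal.ofReal_mul (by positivity)]
    congr 1
    field_simp
  refine (ENNReal.tsum_le_tsum hterm).trans (le_of_eq ?_)
  rw [← ENNReal.ofReal_tsum_of_nonneg (fun j => by positivity) (summable_expMoment.mul_left _),
    tsum_mul_left, ← expMoment]
  congr 1
  ring

theorem measurable_kthValue_lpNorm (hp : 1 ≤ p) {s : Finset (Fin N)} (hk : k ≤ s.card)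
    (j : Fin N) :
    Measurable fun X : Fin N → Space d => kthValue k s fun l => lpNorm p (X l - X j) :=
  measurable_kthValue (fun l _ => (measurable_lpNorm hp).comp (by fun_prop)) hk

theorem measurable_estimator (hp : 1 ≤ p) (hk : k + 1 ≤ N) :
    Measurable (estimator p k δ : (Fin N → Space d) → ℝ) := by
  unfold estimator
  simp_rw [localEstimate_eq_localScore]
  refine Measurable.const_mul (Finset.measurable_fun_sum _ fun i _ =>
    measurable_localScore.comp (measurable_kthValue_lpNorm hp ?_ i)) _
  rw [Finset.card_erase_of_mem (Finset.mem_univ i), Finset.card_univ, Fintype.card_fin]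
  omega

/-- The estimator with the `i`-th sample point left out. -/
def leaveOneOut (p : ℝ≥0∞) (k : ℕ) (δ : ℝ) (i : Fin N) (X : Fin N → Space d) : ℝ :=
  (1 / (N : ℝ)) * ∑ j ∈ Finset.univ.erase i, localScore d p k δ N
    (kthValue k ((Finset.univ.erase j).erase i) fun l => lpNorm p (X l - X j))

theorem card_erase_erase {i j : Fin N} (hk : k + 2 ≤ N) :
    k ≤ ((Finset.univ.erase j).erase i).card := by
  have h1 := Finset.pred_card_le_card_erase (s := (Finset.univ : Finset (Fin N)).erase j) (a := i)
  have h2 := Finset.pred_card_le_card_erase (s := (Finset.univ : Finset (Fin N))) (a := j)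
  rw [Finset.card_univ, Fintype.card_fin] at h2
  omega

theorem measurable_leaveOneOut (hp : 1 ≤ p) (hk : k + 2 ≤ N) (i : Fin N) :
    Measurable (leaveOneOut p k δ i : (Fin N → Space d) → ℝ) :=
  Measurable.const_mul (Finset.measurable_fun_sum _ fun _ _ =>
    measurable_localScore.comp (measurable_kthValue_lpNorm hp (card_erase_erase hk) _)) _

theorem kthValue_congr {ι : Type*} {s : Finset ι} {D D' : ι → ℝ} (h : ∀ j ∈ s, D j = D' j) :
    kthValue k s D = kthValue k s D' := by
  unfold kthValue
  congr 1
  ext r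
  rw [Set.mem_ofPred_eq, Set.mem_ofPred_eq,
    Finset.filter_congr fun j hj => by rw [h j hj]]

theorem leaveOneOut_update (i : Fin N) (X : Fin N → Space d) (y : Space d) :
    leaveOneOut p k δ i (Function.update X i y) = leaveOneOut p k δ i X := by
  unfold leaveOneOut
  congr 1
  refine Finset.sum_congr rfl fun j hj => ?_
  congr 1
  refine kthValue_congr fun l hl => ?_
  rw [Function.update_of_ne (Finset.ne_of_mem_erase hj),
    Function.update_of_ne (Finset.ne_of_mem_erase hl)]

/-- The bound for the squared local estimate at the `j`-th sample point. -/
def scoreMajorant (p : ℝ≥0∞) (k : ℕ) (δ : ℝ) (j : Fin N) (X : Fin N → Space d) : ℝ≥0∞ :=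
  ENNReal.ofReal (scoreBound d p k δ N ^ 2)
    + ∑ l ∈ Finset.univ.erase j, logSqMajorant d N (lpNorm p (X l - X j))

theorem sq_localScore_le_scoreMajorant (hd : 1 ≤ d) (hp : 1 ≤ p) (hδ : 0 < δ) (hN : 3 ≤ N)
    (hk1 : 1 ≤ k) {s : Finset (Fin N)} {j : Fin N} (hk : k ≤ s.card)
    (hs : s ⊆ Finset.univ.erase j) (X : Fin N → Space d) :
    ENNReal.ofReal (localScore d p k δ N (kthValue k s fun l => lpNorm p (X l - X j)) ^ 2)
      ≤ 2 * scoreMajorant p k δ j X := by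
  refine (sq_localScore_kthValue_le hd hδ hN hk1 hk fun l => lpNorm_nonneg hp _).trans ?_
  rw [scoreMajorant, mul_add, ENNReal.ofReal_mul (by norm_num), ENNReal.ofReal_ofNat]
  gcongr

/-- Deleting X_i removes the i-th score and alters the j-th one only if X_j is within the threshold
of X_i. Both averages carry 1/N, so all other terms cancel exactly. Cauchy–Schwarz then separates
the number of neighbours from the sum of their squared scores. -/
theorem sq_estimator_sub_leaveOneOut_le (hd : 1 ≤ d) (hp : 1 ≤ p) (hδ : 0 < δ) (hN : 3 ≤ N)
    (hk1 : 1 ≤ k) (hk : k + 2 ≤ N) (i : Fin N) (X : Fin N → Space d) :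
    ENNReal.ofReal ((estimator p k δ X - leaveOneOut p k δ i X) ^ 2)
      ≤ ENNReal.ofReal (1 / (N : ℝ) ^ 2) * (4 * scoreMajorant p k δ i X
        + 16 * ((∑ m ∈ Finset.univ.erase i,
            if lpNorm p (X m - X i) ≤ threshold d δ N then 1 else 0) *
          ∑ j ∈ Finset.univ.erase i,
            (if lpNorm p (X j - X i) ≤ threshold d δ N then 1 else 0) *
              scoreMajorant p k δ j X)) := by
  set a := threshold d δ N with ha
  let ξ : Fin N → ℝ := fun j => localScore d p k δ N
    (kthValue k (Finset.univ.erase j) fun l => lpNorm p (X l - X j))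
  let ξ' : Fin N → ℝ := fun j => localScore d p k δ N
    (kthValue k ((Finset.univ.erase j).erase i) fun l => lpNorm p (X l - X j))
  let β : Fin N → ℝ := fun j => if lpNorm p (X j - X i) ≤ a then 1 else 0
  have hβ0 : ∀ j, 0 ≤ β j := fun j => by simp only [β]; split_ifs <;> norm_num
  have hββ : ∀ j, β j * β j = β j := fun j => by simp only [β]; split_ifs <;> norm_num
  -- The indicator appears twice on purpose: in Cauchy–Schwarz one copy becomes the neighbour count,
  -- the other restricts the sum of squares.
  have hΔ : ∀ j, ξ j - ξ' j = β j * (β j * (ξ j - ξ' j)) := by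
    intro j
    by_cases hj : lpNorm p (X j - X i) ≤ a
    · simp [β, hj]
    · have : ξ' j = ξ j := by
        refine localScore_kthValue_erase (card_erase_erase hk) ?_
        rw [lpNorm_sub_comm hp]
        exact not_le.1 hj
      rw [this]
      simp
  have hdiff : estimator p k δ X - leaveOneOut p k δ i X
      = (1 / (N : ℝ)) * (ξ i + ∑ j ∈ Finset.univ.erase i, β j * (β j * (ξ j - ξ' j))) := by
    unfold estimator leaveOneOut
    simp_rw [localEstimate_eq_localScore]
    rw [← Finset.add_sum_erase _ _ (Finset.mem_univ i), ← mul_sub, add_sub_assoc,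
      ← Finset.sum_sub_distrib]
    congr 2
    exact Finset.sum_congr rfl fun j _ => hΔ j
  have hCS : (∑ j ∈ Finset.univ.erase i, β j * (β j * (ξ j - ξ' j))) ^ 2
      ≤ (∑ j ∈ Finset.univ.erase i, β j) *
        ∑ j ∈ Finset.univ.erase i, β j * (2 * ξ j ^ 2 + 2 * ξ' j ^ 2) := by
    refine (Finset.sum_mul_sq_le_sq_mul_sq _ _ _).trans ?_
    have h1 : ∀ j, β j ^ 2 = β j := fun j => by rw [sq, hββ]
    simp_rw [mul_pow, h1]
    refine mul_le_mul_of_nonneg_left (Finset.sum_le_sum fun j _ => ?_)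
      (Finset.sum_nonneg fun j _ => hβ0 j)
    refine mul_le_mul_of_nonneg_left ?_ (hβ0 j)
    nlinarith [sq_nonneg (ξ j + ξ' j)]
  have hreal : (estimator p k δ X - leaveOneOut p k δ i X) ^ 2
      ≤ 1 / (N : ℝ) ^ 2 * (2 * ξ i ^ 2 + 2 * ((∑ j ∈ Finset.univ.erase i, β j) *
        ∑ j ∈ Finset.univ.erase i, β j * (2 * ξ j ^ 2 + 2 * ξ' j ^ 2))) := by
    rw [hdiff, mul_pow, div_pow, one_pow]
    refine mul_le_mul_of_nonneg_left ?_ (by positivity)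
    nlinarith [sq_nonneg (ξ i - ∑ j ∈ Finset.univ.erase i, β j * (β j * (ξ j - ξ' j)))]
  have hSβ : 0 ≤ ∑ j ∈ Finset.univ.erase i, β j := Finset.sum_nonneg fun j _ => hβ0 j
  have hSβ2 : ∀ j, 0 ≤ β j * (2 * ξ j ^ 2 + 2 * ξ' j ^ 2) := fun j =>
    mul_nonneg (hβ0 j) (by positivity)
  have hβE : ∀ j, ENNReal.ofReal (β j)
      = if lpNorm p (X j - X i) ≤ a then 1 else 0 := fun j => by
    simp only [β]
    split_ifs <;> simp
  have hcard : ∀ j : Fin N, k ≤ (Finset.univ.erase j).card := fun j =>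
    (card_erase_erase (i := j) hk).trans (Finset.card_le_card (Finset.erase_subset _ _))
  have hξ : ∀ j, ENNReal.ofReal (ξ j ^ 2) ≤ 2 * scoreMajorant p k δ j X := fun j =>
    sq_localScore_le_scoreMajorant hd hp hδ hN hk1 (hcard j) subset_rfl X
  have hξ' : ∀ j, ENNReal.ofReal (ξ' j ^ 2) ≤ 2 * scoreMajorant p k δ j X := fun j =>
    sq_localScore_le_scoreMajorant hd hp hδ hN hk1 (card_erase_erase hk)
      (Finset.erase_subset _ _) X
  refine (ENNReal.ofReal_le_ofReal hreal).trans ?_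
  rw [ENNReal.ofReal_mul (by positivity)]
  refine mul_le_mul_right ?_ _
  rw [ENNReal.ofReal_add (by positivity)
    (mul_nonneg (by norm_num) (mul_nonneg hSβ (Finset.sum_nonneg fun j _ => hSβ2 j)))]
  refine add_le_add ?_ ?_
  · rw [ENNReal.ofReal_mul (by norm_num), ENNReal.ofReal_ofNat]
    calc 2 * ENNReal.ofReal (ξ i ^ 2) ≤ 2 * (2 * scoreMajorant p k δ i X) := by gcongr; exact hξ i
      _ = _ := by ring
  · rw [ENNReal.ofReal_mul (by norm_num), ENNReal.ofReal_ofNat, ENNReal.ofReal_mul hSβ,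
      ENNReal.ofReal_sum_of_nonneg (fun j _ => hβ0 j),
      ENNReal.ofReal_sum_of_nonneg (fun j _ => hSβ2 j)]
    simp_rw [ENNReal.ofReal_mul (hβ0 _), hβE]
    have : ∀ j, ENNReal.ofReal (2 * ξ j ^ 2 + 2 * ξ' j ^ 2) ≤ 8 * scoreMajorant p k δ j X := by
      intro j
      rw [ENNReal.ofReal_add (by positivity) (by positivity), ENNReal.ofReal_mul (by norm_num),
        ENNReal.ofReal_mul (by norm_num), ENNReal.ofReal_ofNat]
      calc 2 * ENNReal.ofReal (ξ j ^ 2) + 2 * ENNReal.ofReal (ξ' j ^ 2)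
          ≤ 2 * (2 * scoreMajorant p k δ j X) + 2 * (2 * scoreMajorant p k δ j X) := by
            gcongr
            · exact hξ j
            · exact hξ' j
        _ = _ := by ring
    calc _ ≤ 2 * ((∑ m ∈ Finset.univ.erase i,
            if lpNorm p (X m - X i) ≤ a then 1 else 0) *
          ∑ j ∈ Finset.univ.erase i,
            (if lpNorm p (X j - X i) ≤ a then 1 else 0) *
              (8 * scoreMajorant p k δ j X)) := by
          gcongr
          exact this _
      _ = _ := by
          simp_rw [mul_left_comm _ (8 : ℝ≥0∞)]
          rw [← Finset.mul_sum]
          ring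

/-- The bound for the variance. -/
def varianceBound (d : ℕ) (p : ℝ≥0∞) (k : ℕ) (δ Ca : ℝ) (N : ℕ) : ℝ :=
  36 * (1 + Ca * unitBallVolume d p * Real.log N ^ (1 + δ)) ^ 2 *
    (scoreBound d p k δ N ^ 2 + Ca * unitBallVolume d p * expMoment) / N

/-- Here N q is a multiple of (log N)^{1+δ} and N v is a constant, so each Efron–Stein term is (1 +
Nq)² (ℓ + Nv) / N² up to a factor, and summing over i leaves 1/N. -/
theorem Regular.exists_lintegral_sq_sub_le (h : Regular Ca Cb Cc Cd Ce C0 f) (hC0 : 0 < C0)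
    (hd : 1 ≤ d) (hp : 1 ≤ p) (hδ : 0 < δ) (hN : 3 ≤ N) (hk1 : 1 ≤ k) (hk : k + 2 ≤ N) :
    ∃ c : ℝ, ∫⁻ X, ENNReal.ofReal ((estimator p k δ X - c) ^ 2) ∂sampleLaw f N
      ≤ ENNReal.ofReal (varianceBound d p k δ Ca N) := by
  have := h.isDensity.isProbabilityMeasure_law
  have hCa := hC0.le.trans h.lower_le_upper
  have hc := unitBallVolume_pos (d := d) hp
  have hκ := expMoment_nonneg
  have hN' : (0 : ℝ) < N := by positivity
  have hlog : 0 ≤ Real.log N := Real.log_natCast_nonneg N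
  have ha : 0 ≤ threshold d δ N := by unfold threshold; positivity
  obtain ⟨c, hle⟩ := efron_stein (law f) (measurable_estimator (δ := δ) (d := d) (p := p) hp
    (show k + 1 ≤ N by omega)) (fun i => measurable_leaveOneOut (δ := δ) hp hk i)
    (fun i X y => leaveOneOut_update i X y)
  refine ⟨c, hle.trans ?_⟩
  let b : Space d → ℝ≥0∞ := fun z => if lpNorm p z ≤ threshold d δ N then 1 else 0
  let φ : Space d → ℝ≥0∞ := fun z => logSqMajorant d N (lpNorm p z)
  have hb : Measurable b := Measurable.ite
    (measurableSet_le (measurable_lpNorm hp) measurable_const) measurable_const measurable_const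
  have hφ : Measurable φ := measurable_logSqMajorant.comp (measurable_lpNorm hp)
  have hb1 : ∀ z, b z ≤ 1 := fun z => by simp only [b]; split_ifs <;> simp
  have hv : ∀ x, ∫⁻ y, φ (y - x) ∂law f
      ≤ ENNReal.ofReal (Ca * unitBallVolume d p * expMoment / N) := fun x =>
    h.lintegral_logSqMajorant_le hC0 hd hp (by omega) x
  have hq : ∀ x, ∫⁻ y, b (y - x) ∂law f
      ≤ ENNReal.ofReal (Ca * (unitBallVolume d p * threshold d δ N ^ d)) := fun x => by
    refine le_of_eq_of_le ?_ (h.law_lpBall_le hC0 hd hp x ha)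
    rw [← lintegral_indicator_one (measurableSet_lpBall hp x _)]
    rfl
  set v := ENNReal.ofReal (Ca * unitBallVolume d p * expMoment / N) with hvdef
  set q := ENNReal.ofReal (Ca * (unitBallVolume d p * threshold d δ N ^ d)) with hqdef
  set ℓ := ENNReal.ofReal (scoreBound d p k δ N ^ 2) with hℓ
  have hNv : (N : ℝ≥0∞) * v = ENNReal.ofReal (Ca * unitBallVolume d p * expMoment) := by
    rw [hvdef, ← ENNReal.ofReal_natCast, ← ENNReal.ofReal_mul (by positivity)]
    congr 1
    field_simp
  have hNq : (N : ℝ≥0∞) * q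
      = ENNReal.ofReal (Ca * unitBallVolume d p * Real.log N ^ (1 + δ)) := by
    rw [hqdef, ← ENNReal.ofReal_natCast, ← ENNReal.ofReal_mul (by positivity),
      ← natCast_mul_threshold_pow hd hN]
    congr 1
    ring
  have hterm : ∀ i : Fin N, ∫⁻ X, ENNReal.ofReal ((estimator p k δ X
      - leaveOneOut p k δ i X) ^ 2) ∂Measure.pi (fun _ => law f)
      ≤ ENNReal.ofReal (1 / (N : ℝ) ^ 2) * (36 * (1 + N * q) ^ 2 * (ℓ + N * v)) := by
    intro i
    have h1 := lintegral_sum_pair_le (law f) hφ hv ℓ i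
    have h2 := lintegral_card_mul_sum_le (law f) hb hφ hb1 hq hv ℓ i
    rw [Fintype.card_fin] at h1 h2
    have hm1 : Measurable fun X : Fin N → Space d =>
        ℓ + ∑ l ∈ Finset.univ.erase i, φ (X l - X i) := by fun_prop
    have hm2 : Measurable fun X : Fin N → Space d =>
        (∑ m ∈ Finset.univ.erase i, b (X m - X i)) * (∑ j ∈ Finset.univ.erase i,
        b (X j - X i) * (ℓ + ∑ l ∈ Finset.univ.erase j, φ (X l - X j))) := by fun_prop
    refine (lintegral_mono fun X =>
      sq_estimator_sub_leaveOneOut_le hd hp hδ hN hk1 hk i X).trans ?_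
    rw [lintegral_const_mul' _ _ ENNReal.ofReal_ne_top]
    refine mul_le_mul_right ?_ _
    refine le_trans (le_of_eq ((lintegral_add_left (hm1.const_mul 4) _).trans
      (congrArg₂ (· + ·) (lintegral_const_mul 4 hm1) (lintegral_const_mul 16 hm2)))) ?_
    calc _ ≤ 4 * (ℓ + N * v) + 16 * (2 * (1 + N * q) ^ 2 * (ℓ + N * v)) :=
          add_le_add (mul_le_mul_right h1 _) (mul_le_mul_right h2 _)
      -- Inflating the first part by (1 + Nq)² ≥ 1 lets the two parts merge, with 36 = 4 + 16 · 2.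
      _ ≤ 4 * ((1 + N * q) ^ 2 * (ℓ + N * v)) + 16 * (2 * (1 + N * q) ^ 2 * (ℓ + N * v)) := by
          gcongr
          exact le_mul_of_one_le_left zero_le (one_le_pow₀ le_self_add)
      _ = _ := by ring
  refine (Finset.sum_le_sum fun i _ => hterm i).trans ?_
  rw [Finset.sum_const, Finset.card_univ, Fintype.card_fin, nsmul_eq_mul, hNv, hNq, hℓ,
    ← ENNReal.ofReal_one, ← ENNReal.ofReal_add (by norm_num) (by positivity),
    ← ENNReal.ofReal_add (by positivity) (by positivity), ← ENNReal.ofReal_pow (by positivity),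
    ← ENNReal.ofReal_ofNat 36, ← ENNReal.ofReal_mul (by norm_num),
    ← ENNReal.ofReal_mul (by positivity), ← ENNReal.ofReal_mul (by positivity),
    ← ENNReal.ofReal_natCast, ← ENNReal.ofReal_mul (by positivity)]
  refine le_of_eq (congrArg _ ?_)
  unfold varianceBound
  field_simp

end Variance

/-! ### Order statistics of independent samples -/

section ExpIntegral

theorem integrableOn_exp_mul_one_sub_exp (m l : ℕ) :
    IntegrableOn (fun t : ℝ => Real.exp (-t) ^ (m + 1) * (1 - Real.exp (-t)) ^ l) (Set.Ioi 0) := by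
  refine (integrableOn_exp_neg_Ioi 0).mono' (by fun_prop) ?_
  refine (ae_restrict_iff' measurableSet_Ioi).2 (ae_of_all _ fun t ht => ?_)
  have h0 := Real.exp_pos (-t)
  have h1 : Real.exp (-t) ≤ 1 := Real.exp_le_one_iff.2 (by linarith [Set.mem_Ioi.1 ht])
  have h2 : 0 ≤ 1 - Real.exp (-t) := by linarith
  rw [Real.norm_of_nonneg (by positivity), pow_succ, mul_right_comm]
  refine mul_le_of_le_one_left h0.le (mul_le_one₀ (pow_le_one₀ h0.le h1) (by positivity)
    (pow_le_one₀ h2 (by linarith)))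

/-- A Beta integral in the variable u = e^{-t}; the induction uses (1 - u)^{l+1} = (1 - u)^l - u (1
- u)^l. -/
theorem integral_exp_mul_one_sub_exp (m l : ℕ) :
    ∫ t in Set.Ioi (0 : ℝ), Real.exp (-t) ^ (m + 1) * (1 - Real.exp (-t)) ^ l
      = (m.factorial * l.factorial : ℝ) / (m + l + 1).factorial := by
  induction l generalizing m with
  | zero =>
    have h : ∀ t : ℝ, Real.exp (-t) ^ (m + 1) * (1 - Real.exp (-t)) ^ 0
        = Real.exp (-((m : ℝ) + 1) * t) := fun t => by
      rw [pow_zero, mul_one, ← Real.exp_nat_mul]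
      congr 1
      push_cast
      ring
    simp_rw [h]
    rw [integral_exp_mul_Ioi (by linarith [(Nat.cast_nonneg m : (0 : ℝ) ≤ m)]), add_zero,
      Nat.factorial_succ]
    have hm : (m.factorial : ℝ) ≠ 0 := by positivity
    have hm1 : (m : ℝ) + 1 ≠ 0 := by positivity
    push_cast
    simp only [mul_zero, Real.exp_zero, Nat.factorial_zero, Nat.cast_one, mul_one]
    field_simp
  | succ l ih =>
    have h : ∀ t : ℝ, Real.exp (-t) ^ (m + 1) * (1 - Real.exp (-t)) ^ (l + 1)
        = Real.exp (-t) ^ (m + 1) * (1 - Real.exp (-t)) ^ l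
          - Real.exp (-t) ^ (m + 1 + 1) * (1 - Real.exp (-t)) ^ l := fun t => by ring
    simp_rw [h]
    rw [integral_sub (integrableOn_exp_mul_one_sub_exp m l)
      (integrableOn_exp_mul_one_sub_exp (m + 1) l), ih, ih]
    have e1 : m + 1 + l + 1 = m + l + 1 + 1 := by ring
    have e2 : m + (l + 1) + 1 = m + l + 1 + 1 := by ring
    rw [e1, e2, Nat.factorial_succ (m + l + 1), Nat.factorial_succ m, Nat.factorial_succ l]
    have h1 : ((m + l + 1).factorial : ℝ) ≠ 0 := by positivity
    have h2 : (m : ℝ) + l + 1 + 1 ≠ 0 := by positivity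
    push_cast
    field_simp
    ring

end ExpIntegral

/-! ### Binomial counts and the law of an order statistic. -/

section Pattern

variable {ι E : Type*} [Fintype ι] [DecidableEq ι] [MeasurableSpace E]
  (μ : Measure E) [IsProbabilityMeasure μ]

/-- The set of indices whose sample falls in `B` is a Bernoulli random subset of `s`: each of its
values `A` is a product event. Both the exact binomial law and the Chernoff bound are read off from
this. -/
theorem measure_pattern {B : Set E} [DecidablePred (· ∈ B)] (hB : MeasurableSet B) (s : Finset ι)
    (P : Finset ι → Prop) [DecidablePred P] :
    (Measure.pi fun _ : ι => μ) {X | P (s.filter fun j => X j ∈ B)}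
      = ENNReal.ofReal (∑ A ∈ s.powerset.filter P,
        μ.real B ^ A.card * (1 - μ.real B) ^ (s.card - A.card)) := by
  have ht1 : μ.real B ≤ 1 := measureReal_le_one
  have ht0 : 0 ≤ μ.real B := measureReal_nonneg
  let S : Finset ι → ι → Set E := fun A j => if j ∈ A then B else if j ∈ s then Bᶜ else Set.univ
  have hSm : ∀ A j, MeasurableSet (S A j) := fun A j => by
    simp only [S]
    split_ifs
    exacts [hB, hB.compl, MeasurableSet.univ]
  have hmem : ∀ A ∈ s.powerset, ∀ X : ι → E,
      X ∈ Set.univ.pi (S A) ↔ (s.filter fun j => X j ∈ B) = A := by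
    intro A hA X
    rw [Finset.mem_powerset] at hA
    simp only [Set.mem_univ_pi, S]
    constructor
    · intro h
      ext j
      have hj := h j
      rw [Finset.mem_filter]
      by_cases h1 : j ∈ A
      · rw [if_pos h1] at hj
        exact ⟨fun _ => h1, fun _ => ⟨hA h1, hj⟩⟩
      · rw [if_neg h1] at hj
        refine ⟨fun h2 => ?_, fun h2 => absurd h2 h1⟩
        rw [if_pos h2.1] at hj
        exact absurd h2.2 hj
    · rintro rfl j
      by_cases h2 : j ∈ s <;> by_cases h3 : X j ∈ B <;> simp [h2, h3]
  have hunion : {X : ι → E | P (s.filter fun j => X j ∈ B)}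
      = ⋃ A ∈ s.powerset.filter P, Set.univ.pi (S A) := by
    ext X
    simp only [Set.mem_iUnion, exists_prop, Finset.mem_filter]
    constructor
    · intro h
      have hm := Finset.mem_powerset.2 (Finset.filter_subset (fun j => X j ∈ B) s)
      exact ⟨_, ⟨hm, h⟩, (hmem _ hm X).2 rfl⟩
    · rintro ⟨A, ⟨hA, hPA⟩, hX⟩
      rw [Set.mem_ofPred_eq, (hmem A hA X).1 hX]
      exact hPA
  have hval : ∀ A ∈ s.powerset, (Measure.pi fun _ : ι => μ) (Set.univ.pi (S A))
      = ENNReal.ofReal (μ.real B ^ A.card * (1 - μ.real B) ^ (s.card - A.card)) := by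
    intro A hA
    rw [Finset.mem_powerset] at hA
    rw [Measure.pi_pi]
    have h1 : ∀ j, μ (S A j) = ENNReal.ofReal
        (if j ∈ s then (if j ∈ A then μ.real B else 1 - μ.real B) else 1) := by
      intro j
      by_cases h2 : j ∈ A
      · simp [S, h2, hA h2]
      · by_cases h3 : j ∈ s
        · simp only [S, h2, h3, if_true, if_false]
          rw [← probReal_compl_eq_one_sub hB, ofReal_measureReal]
        · simp [S, h2, h3]
    simp_rw [h1]
    rw [← ENNReal.ofReal_prod_of_nonneg]
    · congr 1
      rw [Finset.prod_ite_mem, Finset.univ_inter, Finset.prod_ite, Finset.prod_const,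
        Finset.prod_const, Finset.filter_mem_eq_inter, Finset.inter_eq_right.2 hA,
        Finset.filter_notMem_eq_sdiff, Finset.card_sdiff_of_subset hA]
    · intro j _
      split_ifs <;> linarith
  rw [hunion, measure_biUnion_finset]
  · rw [ENNReal.ofReal_sum_of_nonneg]
    · exact Finset.sum_congr rfl fun A hA => hval A (Finset.mem_filter.1 hA).1
    · intro A _
      have : 0 ≤ 1 - μ.real B := by linarith
      positivity
  · intro A hA A' hA' hne
    refine Set.disjoint_left.2 fun X h1 h2 => hne ?_
    rw [← (hmem A (Finset.mem_filter.1 hA).1 X).1 h1, (hmem A' (Finset.mem_filter.1 hA').1 X).1 h2]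
  · exact fun A _ => MeasurableSet.univ_pi (hSm A)

/-- The probability that at least `k` of the `s`-samples fall in a set of probability `t`. -/
def atLeastProb (n k : ℕ) (t : ℝ) : ℝ :=
  ∑ m ∈ Finset.range (n + 1), if k ≤ m then n.choose m * (t ^ m * (1 - t) ^ (n - m)) else 0

variable {g : E → ℝ} (hg : Measurable g)

include hg in
theorem measure_kthValue_le {s : Finset ι} {k : ℕ} (hk : k ≤ s.card) {r : ℝ} (hr : 0 ≤ r) :
    (Measure.pi fun _ : ι => μ) {X | kthValue k s (fun j => g (X j)) ≤ r}
      = ENNReal.ofReal (atLeastProb s.card k (μ.real {y | g y ≤ r})) := by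
  classical
  have h := measure_pattern μ (measurableSet_le hg (measurable_const (a := r))) s
    fun A => k ≤ A.card
  simp_rw [kthValue_le_iff hk hr]
  refine Eq.trans ?_ (h.trans ?_)
  · congr 1
  · congr 1
    rw [Finset.sum_filter]
    refine (Finset.sum_powerset_apply_card (fun m => if k ≤ m then μ.real {y | g y ≤ r} ^ m *
      (1 - μ.real {y | g y ≤ r}) ^ (s.card - m) else 0)).trans ?_
    unfold atLeastProb
    refine Finset.sum_congr rfl fun m _ => ?_
    split_ifs <;> simp

include hg in
-- Chernoff: a pattern with fewer than k hits satisfies 1 ≤ 2^k 2^{-|A|}, and the sum of 2^{-|A|}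
-- against the probabilities of all patterns is (1 - t/2)^n ≤ e^{-nt/2}.
theorem measure_lt_kthValue_le {s : Finset ι} {k : ℕ} (hk : k ≤ s.card) {r : ℝ} (hr : 0 ≤ r) :
    (Measure.pi fun _ : ι => μ) {X | r < kthValue k s (fun j => g (X j))}
      ≤ ENNReal.ofReal (2 ^ k * Real.exp (-(s.card * μ.real {y | g y ≤ r} / 2))) := by
  classical
  have h := measure_pattern μ (measurableSet_le hg (measurable_const (a := r))) s
    fun A => ¬ k ≤ A.card
  have hset : {X : ι → E | r < kthValue k s (fun j => g (X j))}
      = {X | ¬ k ≤ (s.filter fun j => X j ∈ {y | g y ≤ r}).card} := by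
    ext X
    rw [Set.mem_ofPred_eq, ← not_le, kthValue_le_iff hk hr, Set.mem_ofPred_eq]
    simp only [Set.mem_ofPred_eq]
  rw [hset]
  refine h.trans_le (ENNReal.ofReal_le_ofReal ?_)
  set t := μ.real {y | g y ≤ r} with ht
  have ht1 : t ≤ 1 := measureReal_le_one
  have ht0 : 0 ≤ t := measureReal_nonneg
  have ht2 : 0 ≤ 1 - t := by linarith
  calc ∑ A ∈ s.powerset.filter (fun A => ¬ k ≤ A.card), t ^ A.card * (1 - t) ^ (s.card - A.card)
      ≤ ∑ A ∈ s.powerset.filter (fun A => ¬ k ≤ A.card),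
        2 ^ k * ((t / 2) ^ A.card * (1 - t) ^ (s.card - A.card)) := by
        refine Finset.sum_le_sum fun A hA => ?_
        have hAk : A.card ≤ k := (not_le.1 (Finset.mem_filter.1 hA).2).le
        rw [div_pow, ← mul_assoc]
        refine mul_le_mul_of_nonneg_right ?_ (by positivity)
        rw [mul_div_assoc', mul_comm, mul_div_assoc]
        refine le_mul_of_one_le_right (by positivity) ?_
        rw [one_le_div (by positivity)]
        exact pow_le_pow_right₀ (by norm_num) hAk
    _ ≤ ∑ A ∈ s.powerset, 2 ^ k * ((t / 2) ^ A.card * (1 - t) ^ (s.card - A.card)) :=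
        Finset.sum_le_sum_of_subset_of_nonneg (Finset.filter_subset _ _)
          fun A _ _ => by positivity
    _ = 2 ^ k * (t / 2 + (1 - t)) ^ s.card := by
        rw [← Finset.mul_sum, Finset.sum_pow_mul_eq_add_pow]
    _ ≤ 2 ^ k * Real.exp (-(t / 2)) ^ s.card := by
        refine mul_le_mul_of_nonneg_left (pow_le_pow_left₀ (by linarith) ?_ _) (by positivity)
        linarith [Real.add_one_le_exp (-(t / 2))]
    _ = _ := by
        rw [← Real.exp_nat_mul]
        ring_nf

theorem integrableOn_atLeastProb_exp (n : ℕ) {k : ℕ} (hk1 : 1 ≤ k) :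
    IntegrableOn (fun t => atLeastProb n k (Real.exp (-t))) (Set.Ioi 0) := by
  refine integrable_finsetSum _ fun m _ => ?_
  by_cases h : k ≤ m
  · obtain ⟨m', rfl⟩ : ∃ m', m = m' + 1 := ⟨m - 1, by omega⟩
    simp only [h, if_true]
    exact (integrableOn_exp_mul_one_sub_exp m' _).const_mul _
  · simp [h]

/-- Each binomial term integrates to a binomial coefficient times a Beta value, which is 1/m; `1 ≤
k` excludes the divergent term m = 0. -/
theorem integral_atLeastProb_exp (n : ℕ) {k : ℕ} (hk1 : 1 ≤ k) :
    ∫ t in Set.Ioi (0 : ℝ), atLeastProb n k (Real.exp (-t))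
      = ∑ m ∈ Finset.range (n + 1), if k ≤ m then 1 / (m : ℝ) else 0 := by
  unfold atLeastProb
  rw [integral_finsetSum]
  · refine Finset.sum_congr rfl fun m hm => ?_
    by_cases h : k ≤ m
    · obtain ⟨m', rfl⟩ : ∃ m', m = m' + 1 := ⟨m - 1, by omega⟩
      have hmn : m' + 1 ≤ n := Nat.lt_succ_iff.1 (Finset.mem_range.1 hm)
      simp only [h, if_true]
      rw [integral_const_mul, integral_exp_mul_one_sub_exp, Nat.cast_choose ℝ hmn,
        show m' + (n - (m' + 1)) + 1 = n by omega, Nat.factorial_succ]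
      have h1 : (n.factorial : ℝ) ≠ 0 := by positivity
      have h2 : ((n - (m' + 1)).factorial : ℝ) ≠ 0 := by positivity
      have h3 : (m'.factorial : ℝ) ≠ 0 := by positivity
      have h4 : (m' : ℝ) + 1 ≠ 0 := by positivity
      push_cast
      field_simp
    · simp [h]
  · intro m _
    by_cases h : k ≤ m
    · obtain ⟨m', rfl⟩ : ∃ m', m = m' + 1 := ⟨m - 1, by omega⟩
      simp only [h, if_true]
      exact (integrableOn_exp_mul_one_sub_exp m' _).const_mul _
    · simp [h]

theorem exists_lt_measureReal_le {t : ℝ} (ht : t < 1) :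
    ∃ R : ℝ, 0 ≤ R ∧ t < μ.real {y | g y ≤ R} := by
  have hmono : Monotone fun n : ℕ => {y | g y ≤ n} := fun m n hmn y hy =>
    le_trans (show g y ≤ m from hy) (Nat.cast_le.2 hmn)
  have hU : ⋃ n : ℕ, {y | g y ≤ n} = Set.univ :=
    Set.eq_univ_of_forall fun y => Set.mem_iUnion.2 (exists_nat_ge (g y))
  have h := tendsto_measure_iUnion_atTop (μ := μ) hmono
  rw [hU, measure_univ] at h
  have h2 := (ENNReal.tendsto_toReal ENNReal.one_ne_top).comp h
  rw [ENNReal.toReal_one] at h2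
  obtain ⟨n, hn⟩ := (h2.eventually (lt_mem_nhds ht)).exists
  exact ⟨n, Nat.cast_nonneg n, hn⟩

theorem monotone_measureReal_le : Monotone fun r : ℝ => μ.real {y | g y ≤ r} := fun _ _ h =>
  measureReal_mono fun _ hy => le_trans (Set.mem_ofPred.1 hy) h

variable (hc : Continuous fun r : ℝ => μ.real {y | g y ≤ r}) (h0 : μ.real {y | g y ≤ 0} = 0)

include hg hc h0 in
/-- The probability transform of an order statistic. -/
theorem measure_cdf_kthValue_le {s : Finset ι} {k : ℕ} (hk : k ≤ s.card) {t : ℝ} (ht0 : 0 ≤ t)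
    (ht1 : t < 1) :
    (Measure.pi fun _ : ι => μ) {X | μ.real {y | g y ≤ kthValue k s fun j => g (X j)} ≤ t}
      = ENNReal.ofReal (atLeastProb s.card k t) := by
  have hmono := monotone_measureReal_le μ (g := g)
  obtain ⟨R, hR0, hR⟩ := exists_lt_measureReal_le μ (g := g) ht1
  obtain ⟨r₀, hr₀, hFr₀⟩ : t ∈ (fun r : ℝ => μ.real {y | g y ≤ r}) '' Set.Icc 0 R :=
    intermediate_value_Icc hR0 hc.continuousOn ⟨by rw [h0]; exact ht0, hR.le⟩
  -- The largest radius with distribution function at most t is the right endpoint of a possible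
  -- flat stretch; with this choice the event becomes exactly {k-th value ≤ r}.
  obtain ⟨r, hr, hmax⟩ : ∃ r, IsGreatest
      (Set.Icc 0 R ∩ (fun r : ℝ => μ.real {y | g y ≤ r}) ⁻¹' Set.Iic t) r :=
    (isCompact_Icc.inter_right (isClosed_Iic.preimage hc)).exists_isGreatest
      ⟨r₀, hr₀, hFr₀.le⟩
  have hFr : μ.real {y | g y ≤ r} = t := le_antisymm hr.2 (hFr₀.symm.le.trans
    (hmono (hmax ⟨hr₀, hFr₀.le⟩)))
  have hset : {X : ι → E | μ.real {y | g y ≤ kthValue k s fun j => g (X j)} ≤ t}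
      = {X | kthValue k s (fun j => g (X j)) ≤ r} := by
    ext X
    constructor
    · intro h
      refine hmax ⟨⟨kthValue_nonneg _ _ _, ?_⟩, h⟩
      by_contra hlt
      exact absurd ((hmono (not_le.1 hlt).le).trans h) (not_le.2 hR)
    · intro h
      exact (hmono h).trans hFr.le
  rw [hset, measure_kthValue_le μ hg hk hr.1.1, hFr]

theorem atLeastProb_nonneg {n k : ℕ} {t : ℝ} (h0 : 0 ≤ t) (h1 : t ≤ 1) :
    0 ≤ atLeastProb n k t := by
  have : 0 ≤ 1 - t := by linarith
  refine Finset.sum_nonneg fun m _ => ?_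
  split_ifs <;> positivity

include hg hc h0 in
-- The level t = 0 of the probability transform. It keeps the default value of `Real.log 0` out of
-- the layer-cake computation.
theorem ae_cdf_kthValue_pos {s : Finset ι} {k : ℕ} (hk1 : 1 ≤ k) (hk : k ≤ s.card) :
    ∀ᵐ X ∂Measure.pi fun _ : ι => μ, 0 < μ.real {y | g y ≤ kthValue k s fun j => g (X j)} := by
  have h := measure_cdf_kthValue_le μ hg hc h0 hk le_rfl zero_lt_one
  have hz : atLeastProb s.card k 0 = 0 := by
    refine Finset.sum_eq_zero fun m _ => ?_
    by_cases hm : k ≤ m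
    · rw [if_pos hm, zero_pow (by omega)]
      simp
    · rw [if_neg hm]
  rw [hz, ENNReal.ofReal_zero] at h
  rw [ae_iff]
  simpa only [not_lt] using h

include hg in
omit [Fintype ι] [DecidableEq ι] in
theorem measurable_cdf_kthValue {s : Finset ι} {k : ℕ} (hk : k ≤ s.card) :
    Measurable fun X : ι → E => μ.real {y | g y ≤ kthValue k s fun j => g (X j)} :=
  (monotone_measureReal_le μ (g := g)).measurable.comp
    (measurable_kthValue (fun j _ => hg.comp (measurable_pi_apply j)) hk)

include hg hc h0 in
-- Layer cake: -log F ≥ t means F ≤ e^{-t}, which has the binomial tail probability at e^{-t}; its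
-- integral over t is a harmonic sum.
theorem lintegral_neg_log_cdf_kthValue {s : Finset ι} {k : ℕ} (hk1 : 1 ≤ k) (hk : k ≤ s.card) :
    ∫⁻ X, ENNReal.ofReal (-Real.log (μ.real {y | g y ≤ kthValue k s fun j => g (X j)}))
        ∂Measure.pi (fun _ : ι => μ)
      = ENNReal.ofReal (∑ m ∈ Finset.range (s.card + 1), if k ≤ m then 1 / (m : ℝ) else 0) := by
  have hm : Measurable fun X : ι → E =>
      -Real.log (μ.real {y | g y ≤ kthValue k s fun j => g (X j)}) :=
    (measurable_cdf_kthValue μ hg hk).log.neg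
  have hnn : ∀ X : ι → E,
      0 ≤ -Real.log (μ.real {y | g y ≤ kthValue k s fun j => g (X j)}) := fun X =>
    neg_nonneg.2 (Real.log_nonpos measureReal_nonneg measureReal_le_one)
  have hlayer := lintegral_eq_lintegral_meas_le (Measure.pi fun _ : ι => μ)
    (ae_of_all _ hnn) hm.aemeasurable
  rw [hlayer, ← integral_atLeastProb_exp _ hk1,
    ofReal_integral_eq_lintegral_ofReal (integrableOn_atLeastProb_exp _ hk1)]
  · refine setLIntegral_congr_fun measurableSet_Ioi fun t ht => ?_
    have ht' : Real.exp (-t) < 1 := by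
      rw [Real.exp_lt_one_iff]
      linarith [Set.mem_Ioi.1 ht]
    rw [← measure_cdf_kthValue_le μ hg hc h0 hk (Real.exp_pos _).le ht']
    refine measure_congr ?_
    filter_upwards [ae_cdf_kthValue_pos μ hg hc h0 hk1 hk] with X hX
    refine propext ?_
    change t ≤ -Real.log _ ↔ _ ≤ Real.exp (-t)
    rw [le_neg, Real.log_le_iff_le_exp hX]
  · refine (ae_restrict_iff' measurableSet_Ioi).2 (ae_of_all _ fun t ht => ?_)
    exact atLeastProb_nonneg (Real.exp_pos _).le
      (Real.exp_le_one_iff.2 (by linarith [Set.mem_Ioi.1 ht]))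

include hg hc h0 in
theorem integral_log_cdf_kthValue {s : Finset ι} {k : ℕ} (hk1 : 1 ≤ k) (hk : k ≤ s.card) :
    Integrable (fun X => Real.log (μ.real {y | g y ≤ kthValue k s fun j => g (X j)}))
      (Measure.pi fun _ : ι => μ) ∧
    ∫ X, Real.log (μ.real {y | g y ≤ kthValue k s fun j => g (X j)})
        ∂Measure.pi (fun _ : ι => μ)
      = -∑ m ∈ Finset.range (s.card + 1), if k ≤ m then 1 / (m : ℝ) else 0 := by
  have hl := lintegral_neg_log_cdf_kthValue μ hg hc h0 hk1 hk
  have hm := (measurable_cdf_kthValue μ hg hk).log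
  have hnn : ∀ X : ι → E,
      0 ≤ -Real.log (μ.real {y | g y ≤ kthValue k s fun j => g (X j)}) := fun X =>
    neg_nonneg.2 (Real.log_nonpos measureReal_nonneg measureReal_le_one)
  have hi : Integrable (fun X => -Real.log (μ.real {y | g y ≤ kthValue k s fun j => g (X j)}))
      (Measure.pi fun _ : ι => μ) := by
    refine ⟨hm.neg.aestronglyMeasurable, ?_⟩
    rw [hasFiniteIntegral_iff_ofReal (ae_of_all _ hnn), hl]
    exact ENNReal.ofReal_lt_top
  refine ⟨by simpa using hi.neg, ?_⟩
  have hv := integral_eq_lintegral_of_nonneg_ae (ae_of_all _ hnn) hm.neg.aestronglyMeasurable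
    (μ := Measure.pi fun _ : ι => μ)
  rw [hl, ENNReal.toReal_ofReal (Finset.sum_nonneg fun m _ => by split_ifs <;> positivity),
    integral_neg] at hv
  linarith

end Pattern

/-! ### The bias of the estimator -/

section Digamma

theorem digamma_natCast {k : ℕ} (hk : 1 ≤ k) :
    digamma k = -Real.eulerMascheroniConstant + harmonic (k - 1) := by
  obtain ⟨m, rfl⟩ : ∃ m, k = m + 1 := ⟨k - 1, by omega⟩
  have hm : (m.factorial : ℝ) ≠ 0 := by positivity
  rw [digamma, logDeriv_apply]
  push_cast
  rw [Real.deriv_Gamma_nat, Real.Gamma_nat_eq_factorial, mul_div_cancel_left₀ _ hm]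

theorem sum_inv_eq_harmonic_sub {k n : ℕ} (hk : 1 ≤ k) (hkn : k ≤ n) :
    (∑ m ∈ Finset.range (n + 1), if k ≤ m then 1 / (m : ℝ) else 0)
      = (harmonic n : ℝ) - harmonic (k - 1) := by
  induction n, hkn using Nat.le_induction with
  | base =>
    obtain ⟨m, rfl⟩ : ∃ m, k = m + 1 := ⟨k - 1, by omega⟩
    rw [Finset.sum_range_succ, Finset.sum_eq_zero, Nat.add_sub_cancel, harmonic_succ]
    · push_cast
      simp
    · intro j hj
      rw [if_neg]
      have := Finset.mem_range.1 hj
      omega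
  | succ n hkn ih =>
    rw [Finset.sum_range_succ, ih, harmonic_succ, if_pos (by omega)]
    push_cast
    rw [one_div]
    ring

/-- The terms `harmonic (k - 1)` cancel, leaving log N + γ - harmonic (N - 1). The two sequences
that bracket γ differ by exactly 1/N at these indices. -/
theorem abs_log_sub_digamma_sub_sum_le {k N : ℕ} (hk : 1 ≤ k) (hkN : k + 1 ≤ N) :
    |Real.log N - digamma k
      - ∑ m ∈ Finset.range (N - 1 + 1), if k ≤ m then 1 / (m : ℝ) else 0| ≤ 1 / N := by
  rw [digamma_natCast hk, sum_inv_eq_harmonic_sub hk (by omega)]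
  have h1 := Real.eulerMascheroniSeq_lt_eulerMascheroniConstant (N - 1)
  have h2 := Real.eulerMascheroniConstant_lt_eulerMascheroniSeq' N
  obtain ⟨n, rfl⟩ : ∃ n, N = n + 1 := ⟨N - 1, by omega⟩
  rw [Nat.add_sub_cancel] at h1 ⊢
  rw [Real.eulerMascheroniSeq] at h1
  rw [Real.eulerMascheroniSeq', if_neg (by omega), harmonic_succ] at h2
  push_cast at h1 h2 ⊢
  rw [← one_div] at h2
  have : 0 < 1 / ((n : ℝ) + 1) := by positivity
  rw [abs_le]
  constructor <;> linarith

end Digamma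

/-! ### The conditional mean of a local estimate given its centre. -/

section CondScore

variable {d k N : ℕ} {p : ℝ≥0∞} {δ : ℝ} {f : Space d → ℝ} {Ca Cb Cc Cd Ce C0 : ℝ}

/-- A shell has mass at most Ca times its volume. The truncation `max r 0` makes the estimate valid
on the whole line, as the continuity required by the probability transform demands. -/
theorem Regular.ballMass_sub_le (h : Regular Ca Cb Cc Cd Ce C0 f) (hC0 : 0 < C0) (hd : 1 ≤ d)
    (hp : 1 ≤ p) (x : Space d) {s r : ℝ} (hsr : s ≤ r) :
    ballMass p f x r - ballMass p f x s
      ≤ Ca * unitBallVolume d p * (max r 0 ^ d - max s 0 ^ d) := by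
  have := h.isDensity.isProbabilityMeasure_law
  have hCa := hC0.le.trans h.lower_le_upper
  have hc := unitBallVolume_pos (d := d) hp
  have hd0 : d ≠ 0 := by omega
  have hvol : ∀ r : ℝ, volume {y : Space d | lpNorm p (y - x) ≤ r}
      = ENNReal.ofReal (unitBallVolume d p * max r 0 ^ d) := by
    intro r
    rcases le_or_gt 0 r with hr | hr
    · rw [max_eq_left hr, volume_lpBall hd hp x hr]
    · rw [max_eq_right hr.le, zero_pow hd0, mul_zero, ENNReal.ofReal_zero]
      have : {y : Space d | lpNorm p (y - x) ≤ r} = ∅ :=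
        Set.eq_empty_of_forall_notMem fun y hy =>
          absurd ((lpNorm_nonneg hp (y - x)).trans hy) (not_le.2 hr)
      rw [this, measure_empty]
  have hsub : {y : Space d | lpNorm p (y - x) ≤ s} ⊆ {y : Space d | lpNorm p (y - x) ≤ r} :=
    fun y hy => le_trans (Set.mem_ofPred.1 hy) hsr
  have hmono : max s 0 ^ d ≤ max r 0 ^ d := by gcongr
  have h1 : ballMass p f x r - ballMass p f x s
      = (law f ({y : Space d | lpNorm p (y - x) ≤ r} \
        {y : Space d | lpNorm p (y - x) ≤ s})).toReal :=
    (measureReal_sdiff hsub (measurableSet_lpBall hp x s)).symm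
  rw [h1]
  refine ENNReal.toReal_le_of_le_ofReal (mul_nonneg (by positivity) (by linarith)) ?_
  refine (h.law_le _).trans (le_of_eq ?_)
  rw [Measure.smul_apply, measure_sdiff hsub (measurableSet_lpBall hp x s).nullMeasurableSet
    (by rw [hvol]; exact ENNReal.ofReal_ne_top), hvol, hvol, smul_eq_mul,
    ← ENNReal.ofReal_sub _ (by positivity), ← ENNReal.ofReal_mul hCa]
  congr 1
  ring

theorem ballMass_mono (h : IsDensity f) (x : Space d) : Monotone (ballMass p f x) := by
  have := h.isProbabilityMeasure_law
  exact fun r s hrs => measureReal_mono fun y hy => le_trans (Set.mem_ofPred.1 hy) hrs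

theorem Regular.continuous_ballMass (h : Regular Ca Cb Cc Cd Ce C0 f) (hC0 : 0 < C0)
    (hd : 1 ≤ d) (hp : 1 ≤ p) (x : Space d) : Continuous (ballMass p f x) := by
  rw [continuous_iff_continuousAt]
  intro r₀
  have hmono := ballMass_mono (p := p) h.isDensity x
  have hb : ∀ r, |ballMass p f x r - ballMass p f x r₀|
      ≤ |Ca * unitBallVolume d p * (max r 0 ^ d - max r₀ 0 ^ d)| := by
    intro r
    rcases le_total r r₀ with hr | hr
    · rw [abs_sub_comm, abs_of_nonneg (sub_nonneg.2 (hmono hr)), ← abs_neg (Ca * _ * _)]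
      refine ((h.ballMass_sub_le hC0 hd hp x hr).trans (le_of_eq ?_)).trans (le_abs_self _)
      ring
    · rw [abs_of_nonneg (sub_nonneg.2 (hmono hr))]
      exact (h.ballMass_sub_le hC0 hd hp x hr).trans (le_abs_self _)
  rw [ContinuousAt, tendsto_iff_norm_sub_tendsto_zero]
  refine squeeze_zero (fun _ => norm_nonneg _) hb ?_
  have hcont : Continuous fun r : ℝ =>
      |Ca * unitBallVolume d p * (max r 0 ^ d - max r₀ 0 ^ d)| := by fun_prop
  have := hcont.tendsto r₀
  simpa using this

theorem Regular.ballMass_zero (h : Regular Ca Cb Cc Cd Ce C0 f) (hC0 : 0 < C0)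
    (hd : 1 ≤ d) (hp : 1 ≤ p) (x : Space d) : ballMass p f x 0 = 0 := by
  have hd0 : d ≠ 0 := by omega
  have h1 := h.law_lpBall_le hC0 hd hp x le_rfl
  rw [zero_pow hd0, mul_zero, mul_zero, ENNReal.ofReal_zero] at h1
  rw [ballMass, le_antisymm h1 zero_le, ENNReal.toReal_zero]

/-- The distance from `x` to its `k`-th nearest neighbour among the sample points other than the
`i`-th one. -/
def knnDistAt (p : ℝ≥0∞) (k : ℕ) (i : Fin N) (x : Space d) (X : Fin N → Space d) : ℝ :=
  kthValue k (Finset.univ.erase i) fun j => lpNorm p (X j - x)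

theorem localEstimate_update (i : Fin N) (x : Space d) (X : Fin N → Space d) :
    localEstimate p k δ (Function.update X i x) i
      = localScore d p k δ N (knnDistAt p k i x X) := by
  rw [localEstimate_eq_localScore, knnDistAt]
  congr 1
  refine kthValue_congr fun j hj => ?_
  rw [Function.update_self, Function.update_of_ne (Finset.ne_of_mem_erase hj)]

theorem card_erase_univ (i : Fin N) : (Finset.univ.erase i).card = N - 1 := by
  rw [Finset.card_erase_of_mem (Finset.mem_univ i), Finset.card_univ, Fintype.card_fin]

theorem measurable_knnDistAt (hp : 1 ≤ p) (hk : k + 1 ≤ N) (i : Fin N) (x : Space d) :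
    Measurable (knnDistAt p k i x : (Fin N → Space d) → ℝ) :=
  measurable_kthValue (fun j _ => (measurable_lpNorm hp).comp (by fun_prop))
    (by rw [card_erase_univ]; omega)

theorem abs_log_sub_log_le {m u v : ℝ} (hm : 0 < m) (hu : m ≤ u) (hv : m ≤ v) :
    |Real.log u - Real.log v| ≤ |u - v| / m := by
  have key : ∀ {u v : ℝ}, m ≤ u → m ≤ v → Real.log u - Real.log v ≤ |u - v| / m := by
    intro u v hu hv
    have hu0 := hm.trans_le hu
    have hv0 := hm.trans_le hv
    rw [← Real.log_div hu0.ne' hv0.ne']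
    calc Real.log (u / v) ≤ u / v - 1 := Real.log_le_sub_one_of_pos (by positivity)
      _ = (u - v) / v := by field_simp
      _ ≤ |u - v| / v := by gcongr; exact le_abs_self _
      _ ≤ |u - v| / m := by gcongr
  refine abs_le.2 ⟨?_, key hu hv⟩
  have := key hv hu
  rw [abs_sub_comm] at this
  linarith

/-- The size of the local error on the event of truncation. -/
def truncationError (d : ℕ) (p : ℝ≥0∞) (k : ℕ) (Ca C0 : ℝ) (N : ℕ) : ℝ :=
  Real.log N + (logBound C0 Ca + |digamma k| + |Real.log (unitBallVolume d p * (C0 / 2))|)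

theorem truncationError_nonneg : 0 ≤ truncationError d p k Ca C0 N := by
  have := Real.log_natCast_nonneg N
  have := logBound_nonneg (C0 := C0) (Ca := Ca)
  unfold truncationError
  positivity

theorem one_le_natCast_mul_threshold_pow (hd : 1 ≤ d) (hδ : 0 < δ) (hN : 3 ≤ N) :
    1 ≤ N * threshold d δ N ^ d := by
  rw [natCast_mul_threshold_pow hd hN]
  exact Real.one_le_rpow (one_lt_log_natCast hN).le (by linarith)

theorem threshold_pos (hN : 3 ≤ N) : 0 < threshold d δ N := by
  have := one_lt_log_natCast hN
  have hN' : (0 : ℝ) < N := by positivity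
  unfold threshold
  positivity

theorem half_le_ballMass (hden : IsDensity f) (hd : 1 ≤ d) (hp : 1 ≤ p) {a s : ℝ}
    (ha : 0 < a) (hs : 0 ≤ s) (hs' : 2 ^ d * s ≤ C0 / 2) {x : Space d}
    (hx : dyadicOscillation p f a x ≤ ENNReal.ofReal s) (hfx : C0 ≤ f x) {r : ℝ} (hr : 0 < r)
    (hra : r ≤ a) : unitBallVolume d p * r ^ d * (C0 / 2) ≤ ballMass p f x r := by
  have hc := unitBallVolume_pos (d := d) hp
  have h1 := (abs_le.1 (hden.abs_ballMass_sub_le hd hp ha hs hx hr hra)).1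
  have hw : 0 < unitBallVolume d p * r ^ d := by positivity
  nlinarith

/-- Below the threshold the difference is log f(x) minus the log of the mean density of the ball;
both densities are at least C0/2, where the logarithm is (2/C0)-Lipschitz. Above it the score is 0,
and the ball mass is at least a constant over N because N a_N^d ≥ 1, so the error is log N plus a
constant. -/
theorem Regular.abs_localScore_add_log_sub_le (h : Regular Ca Cb Cc Cd Ce C0 f) (hC0 : 0 < C0)
    (hd : 1 ≤ d) (hp : 1 ≤ p) (hδ : 0 < δ) (hN : 3 ≤ N) {s : ℝ} (hs : 0 ≤ s)
    (hs' : 2 ^ d * s ≤ C0 / 2) {x : Space d}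
    (hx : dyadicOscillation p f (threshold d δ N) x ≤ ENNReal.ofReal s)
    (hfx : f x ∈ Set.Icc C0 Ca) {ρ : ℝ} (hρ : 0 < ρ) :
    |localScore d p k δ N ρ + Real.log (f x)
      - (Real.log N - digamma k + Real.log (ballMass p f x ρ))|
      ≤ 2 ^ (d + 1) / C0 * s + (Set.Ioi (threshold d δ N)).indicator
        (fun _ => truncationError d p k Ca C0 N) ρ := by
  have := h.isDensity.isProbabilityMeasure_law
  have hc := unitBallVolume_pos (d := d) hp
  have hN' : (0 : ℝ) < N := by positivity
  have ha := threshold_pos (d := d) (δ := δ) hN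
  have hf0 := hC0.trans_le hfx.1
  by_cases hρa : ρ ≤ threshold d δ N
  · rw [Set.indicator_of_notMem (by simpa using hρa), add_zero, localScore, if_pos hρa]
    have hw : 0 < unitBallVolume d p * ρ ^ d := by positivity
    have hU := half_le_ballMass h.isDensity hd hp ha hs hs' hx hfx.1 hρ hρa
    have hU0 : 0 < ballMass p f x ρ := lt_of_lt_of_le (by positivity) hU
    have e : -digamma k + Real.log N + Real.log (unitBallVolume d p) + d * Real.log ρ
        + Real.log (f x) - (Real.log N - digamma k + Real.log (ballMass p f x ρ))
        = Real.log (f x) - Real.log (ballMass p f x ρ / (unitBallVolume d p * ρ ^ d)) := by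
      rw [Real.log_div hU0.ne' hw.ne', Real.log_mul hc.ne' (by positivity), Real.log_pow]
      ring
    rw [e]
    refine (abs_log_sub_log_le (half_pos hC0) (by linarith [hfx.1])
      ((le_div_iff₀ hw).2 (by linarith))).trans ?_
    have h2 : |f x - ballMass p f x ρ / (unitBallVolume d p * ρ ^ d)| ≤ 2 ^ d * s := by
      have h3 := h.isDensity.abs_ballMass_sub_le hd hp ha hs hx hρ hρa
      have h4 : f x - ballMass p f x ρ / (unitBallVolume d p * ρ ^ d)
          = -(ballMass p f x ρ - unitBallVolume d p * ρ ^ d * f x)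
            / (unitBallVolume d p * ρ ^ d) := by
        field_simp
        ring
      rw [h4, abs_div, abs_neg, abs_of_pos hw, div_le_iff₀ hw]
      exact h3
    calc _ ≤ 2 ^ d * s / (C0 / 2) := by gcongr
      _ = _ := by
        rw [pow_succ]
        field_simp
  · have hρa' := not_le.1 hρa
    rw [Set.indicator_of_mem (Set.mem_Ioi.2 hρa'), localScore, if_neg hρa]
    have h1 : 0 ≤ 2 ^ (d + 1) / C0 * s := by positivity
    refine le_trans ?_ (le_add_of_nonneg_left h1)
    have hUa := half_le_ballMass h.isDensity hd hp ha hs hs' hx hfx.1 ha le_rfl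
    have hU := hUa.trans (ballMass_mono (p := p) h.isDensity x hρa'.le)
    have hU1 : ballMass p f x ρ ≤ 1 := measureReal_le_one
    have hm : 0 < unitBallVolume d p * (C0 / 2) / N := by positivity
    have hlow : unitBallVolume d p * (C0 / 2) / N ≤ ballMass p f x ρ := by
      refine le_trans ?_ hU
      rw [div_le_iff₀ hN']
      have h2 := one_le_natCast_mul_threshold_pow (N := N) hd hδ hN
      have h3 : 0 < unitBallVolume d p * (C0 / 2) := by positivity
      nlinarith
    have hl1 := Real.log_nonpos (hm.le.trans hlow) hU1
    have hl2 := Real.log_le_log hm hlow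
    rw [Real.log_div (by positivity) hN'.ne'] at hl2
    have hf := abs_le.1 (abs_log_le_logBound hC0 hfx)
    have hψ := abs_le.1 (le_refl |digamma k|)
    have hlc := abs_le.1 (le_refl |Real.log (unitBallVolume d p * (C0 / 2))|)
    have hlN := Real.log_natCast_nonneg N
    have hab := abs_nonneg (Real.log (unitBallVolume d p * (C0 / 2)))
    unfold truncationError
    rw [abs_le]
    constructor <;> linarith

/-- The bound for the probability of truncation at a regular point. -/
def truncationProb (d : ℕ) (p : ℝ≥0∞) (k : ℕ) (δ C0 : ℝ) (N : ℕ) : ℝ :=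
  2 ^ k * Real.exp (-(unitBallVolume d p * C0 / 8 * Real.log N ^ (1 + δ)))

/-- The comparison variable log N - ψ(k) + log P(B(x,ρ)) has mean at most 1/N in absolute value, by
the exact order statistic computation; the pointwise discrepancy adds the oscillation and the error
on the event of truncation. -/
theorem Regular.abs_integral_localScore_add_log_le (h : Regular Ca Cb Cc Cd Ce C0 f)
    (hC0 : 0 < C0) (hd : 1 ≤ d) (hp : 1 ≤ p) (hδ : 0 < δ) (hN : 3 ≤ N) (hk1 : 1 ≤ k)
    (hk : k + 1 ≤ N) (i : Fin N) {s : ℝ} (hs : 0 ≤ s) (hs' : 2 ^ d * s ≤ C0 / 2) {x : Space d}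
    (hx : dyadicOscillation p f (threshold d δ N) x ≤ ENNReal.ofReal s)
    (hfx : f x ∈ Set.Icc C0 Ca) :
    |∫ X, localScore d p k δ N (knnDistAt p k i x X) ∂sampleLaw f N + Real.log (f x)|
      ≤ 1 / N + truncationError d p k Ca C0 N * truncationProb d p k δ C0 N
        + 2 ^ (d + 1) / C0 * s := by
  have := h.isDensity.isProbabilityMeasure_law
  have hprob : IsProbabilityMeasure (sampleLaw f N) := by unfold sampleLaw; infer_instance
  have hc := unitBallVolume_pos (d := d) hp
  have ha := threshold_pos (d := d) (δ := δ) hN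
  have hN' : (0 : ℝ) < N := by positivity
  have hcard : (Finset.univ.erase i).card = N - 1 := card_erase_univ i
  have hks : k ≤ (Finset.univ.erase i).card := by omega
  have hg : Measurable fun y : Space d => lpNorm p (y - x) :=
    (measurable_lpNorm hp).comp (measurable_id.sub_const x)
  have hcont := h.continuous_ballMass hC0 hd hp x
  have hzero := h.ballMass_zero hC0 hd hp x
  have hpos : ∀ᵐ X ∂sampleLaw f N, 0 < ballMass p f x (knnDistAt p k i x X) :=
    ae_cdf_kthValue_pos (law f) hg hcont hzero hk1 hks
  have hlog : Integrable (fun X => Real.log (ballMass p f x (knnDistAt p k i x X)))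
        (sampleLaw f N) ∧
      ∫ X, Real.log (ballMass p f x (knnDistAt p k i x X)) ∂sampleLaw f N
        = -∑ m ∈ Finset.range ((Finset.univ.erase i).card + 1),
          if k ≤ m then 1 / (m : ℝ) else 0 :=
    integral_log_cdf_kthValue (law f) hg hcont hzero hk1 hks
  rw [hcard] at hlog
  have htail : (sampleLaw f N) {X | threshold d δ N < knnDistAt p k i x X}
      ≤ ENNReal.ofReal (2 ^ k * Real.exp (-(((Finset.univ.erase i).card : ℝ) *
        ballMass p f x (threshold d δ N) / 2))) :=
    measure_lt_kthValue_le (law f) hg hks ha.le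
  have htail' : (sampleLaw f N).real {X | threshold d δ N < knnDistAt p k i x X}
      ≤ truncationProb d p k δ C0 N := by
    have hq : 0 ≤ truncationProb d p k δ C0 N := by unfold truncationProb; positivity
    refine ENNReal.toReal_le_of_le_ofReal hq (htail.trans (ENNReal.ofReal_le_ofReal ?_))
    unfold truncationProb
    refine mul_le_mul_of_nonneg_left (Real.exp_le_exp.2 (neg_le_neg ?_)) (by positivity)
    have hUa := half_le_ballMass h.isDensity hd hp ha hs hs' hx hfx.1 ha le_rfl
    rw [hcard, ← natCast_mul_threshold_pow hd hN, Nat.cast_sub (by omega), Nat.cast_one]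
    have h3 : (3 : ℝ) ≤ N := by exact_mod_cast hN
    have h4 : 0 < unitBallVolume d p * threshold d δ N ^ d * (C0 / 2) := by positivity
    -- The factor 1/8 collects three halves: N - 1 ≥ N/2, the lower density bound C0/2, and the
    -- Chernoff exponent.
    calc unitBallVolume d p * C0 / 8 * (N * threshold d δ N ^ d)
        = (N / 2) * (unitBallVolume d p * threshold d δ N ^ d * (C0 / 2)) / 2 := by ring
      _ ≤ (N - 1) * ballMass p f x (threshold d δ N) / 2 := by
        gcongr
        · linarith
        · linarith
  set B := truncationError d p k Ca C0 N with hB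
  have hB0 : 0 ≤ B := truncationError_nonneg
  set score : (Fin N → Space d) → ℝ := fun X => localScore d p k δ N (knnDistAt p k i x X)
    with hscore
  set T : (Fin N → Space d) → ℝ := fun X =>
    Real.log N - digamma k + Real.log (ballMass p f x (knnDistAt p k i x X)) with hT
  have hmρ := measurable_knnDistAt (p := p) hp hk i x
  have hTi : Integrable T (sampleLaw f N) := (integrable_const _).add hlog.1
  have hTint : ∫ X, T X ∂sampleLaw f N = Real.log N - digamma k
      - ∑ m ∈ Finset.range (N - 1 + 1), if k ≤ m then 1 / (m : ℝ) else 0 := by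
    rw [hT, integral_add (integrable_const _) hlog.1, hlog.2]
    simp [sub_eq_add_neg]
  have htailm : MeasurableSet {X : Fin N → Space d | threshold d δ N < knnDistAt p k i x X} :=
    measurableSet_lt measurable_const hmρ
  let R : (Fin N → Space d) → ℝ := fun X => 2 ^ (d + 1) / C0 * s
    + {X | threshold d δ N < knnDistAt p k i x X}.indicator (fun _ => B) X
  have hRi1 : Integrable ({X : Fin N → Space d | threshold d δ N < knnDistAt p k i x X}.indicator
      fun _ => B) (sampleLaw f N) := (integrable_const B).indicator htailm
  have hRi : Integrable R (sampleLaw f N) := (integrable_const _).add hRi1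
  have hbound : ∀ᵐ X ∂sampleLaw f N, |score X + Real.log (f x) - T X| ≤ R X := by
    filter_upwards [hpos] with X hX
    have hρ : 0 < knnDistAt p k i x X := by
      refine lt_of_le_of_ne (kthValue_nonneg _ _ _) fun h0 => ?_
      rw [← h0, hzero] at hX
      exact lt_irrefl _ hX
    exact h.abs_localScore_add_log_sub_le hC0 hd hp hδ hN hs hs' hx hfx hρ
  have hms : Measurable score := measurable_localScore.comp hmρ
  have hdi : Integrable (fun X => score X + Real.log (f x) - T X) (sampleLaw f N) :=
    hRi.mono' ((hms.add_const _).aestronglyMeasurable.sub hTi.aestronglyMeasurable) hbound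
  have hsi : Integrable score (sampleLaw f N) := by
    have : Integrable (fun X => score X + Real.log (f x) - T X + T X - Real.log (f x))
        (sampleLaw f N) := (hdi.add hTi).sub (integrable_const _)
    refine this.congr (ae_of_all _ fun X => ?_)
    ring
  have hsplit : ∫ X, score X ∂sampleLaw f N + Real.log (f x)
      = ∫ X, (score X + Real.log (f x) - T X) ∂sampleLaw f N + ∫ X, T X ∂sampleLaw f N := by
    rw [← integral_add hdi hTi]
    have e : ∀ X, score X + Real.log (f x) - T X + T X = score X + Real.log (f x) :=
      fun X => by ring
    simp_rw [e]
    rw [integral_add hsi (integrable_const _)]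
    simp
  have hRint : ∫ X, R X ∂sampleLaw f N ≤ 2 ^ (d + 1) / C0 * s
      + B * truncationProb d p k δ C0 N := by
    rw [integral_add (integrable_const _) hRi1, integral_indicator_const _ htailm]
    simp only [integral_const, probReal_univ, smul_eq_mul, one_mul]
    rw [mul_comm _ B]
    gcongr
  have hfirst : |∫ X, (score X + Real.log (f x) - T X) ∂sampleLaw f N|
      ≤ 2 ^ (d + 1) / C0 * s + B * truncationProb d p k δ C0 N :=
    (abs_integral_le_integral_abs.trans (integral_mono_ae hdi.abs hRi hbound)).trans hRint
  have hsecond : |∫ X, T X ∂sampleLaw f N| ≤ 1 / N := by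
    rw [hTint]
    exact abs_log_sub_digamma_sub_sum_le hk1 hk
  rw [hsplit]
  refine (abs_add_le _ _).trans ?_
  linarith

end CondScore

/-! ### The mean squared error -/

section MeanSquaredError

variable {d k N : ℕ} {p : ℝ≥0∞} {δ : ℝ} {f : Space d → ℝ} {Ca Cb Cc Cd Ce C0 : ℝ}

/-- The bound for the second moment of a local estimate. -/
def secondMomentBound (d : ℕ) (p : ℝ≥0∞) (k : ℕ) (δ Ca : ℝ) (N : ℕ) : ℝ :=
  2 * scoreBound d p k δ N ^ 2 + 2 * (Ca * unitBallVolume d p * expMoment)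

theorem Regular.secondMomentBound_nonneg (h : Regular Ca Cb Cc Cd Ce C0 f) (hC0 : 0 < C0)
    (hp : 1 ≤ p) : 0 ≤ secondMomentBound d p k δ Ca N := by
  have hCa := hC0.le.trans h.lower_le_upper
  have hc := unitBallVolume_pos (d := d) hp
  have := expMoment_nonneg
  unfold secondMomentBound
  positivity

theorem Regular.lintegral_sq_localScore_le (h : Regular Ca Cb Cc Cd Ce C0 f) (hC0 : 0 < C0)
    (hd : 1 ≤ d) (hp : 1 ≤ p) (hδ : 0 < δ) (hN : 3 ≤ N) (hk1 : 1 ≤ k) (hk : k + 1 ≤ N)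
    (i : Fin N) (x : Space d) :
    ∫⁻ X, ENNReal.ofReal (localScore d p k δ N (knnDistAt p k i x X) ^ 2) ∂sampleLaw f N
      ≤ ENNReal.ofReal (secondMomentBound d p k δ Ca N) := by
  have := h.isDensity.isProbabilityMeasure_law
  have hprob : IsProbabilityMeasure (sampleLaw f N) := by unfold sampleLaw; infer_instance
  have hCa := hC0.le.trans h.lower_le_upper
  have hc := unitBallVolume_pos (d := d) hp
  have hκ := expMoment_nonneg
  have hN' : (0 : ℝ) < N := by positivity
  have hφ : Measurable fun y : Space d => logSqMajorant d N (lpNorm p (y - x)) :=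
    measurable_logSqMajorant.comp ((measurable_lpNorm hp).comp (measurable_id.sub_const x))
  have hone : ∀ j : Fin N, ∫⁻ X, logSqMajorant d N (lpNorm p (X j - x)) ∂sampleLaw f N
      ≤ ENNReal.ofReal (Ca * unitBallVolume d p * expMoment / N) := fun j => by
    have h1 := (measurePreserving_eval (fun _ : Fin N => law f) j).lintegral_comp hφ
    exact h1.trans_le (h.lintegral_logSqMajorant_le hC0 hd hp (by omega) x)
  have hcard : k ≤ (Finset.univ.erase i).card := by
    rw [card_erase_univ]
    omega
  have hpt : ∀ X : Fin N → Space d,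
      ENNReal.ofReal (localScore d p k δ N (knnDistAt p k i x X) ^ 2)
        ≤ ENNReal.ofReal (2 * scoreBound d p k δ N ^ 2)
          + 2 * ∑ j ∈ Finset.univ.erase i, logSqMajorant d N (lpNorm p (X j - x)) := fun X =>
    sq_localScore_kthValue_le hd hδ hN hk1 hcard fun j => lpNorm_nonneg hp (X j - x)
  have hφj : ∀ j : Fin N, Measurable fun X : Fin N → Space d =>
      logSqMajorant d N (lpNorm p (X j - x)) := fun j => hφ.comp (measurable_pi_apply j)
  refine (lintegral_mono hpt).trans ?_
  rw [lintegral_add_left measurable_const, lintegral_const_mul' _ _ (by simp),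
    lintegral_finsetSum _ fun j _ => hφj j]
  simp only [lintegral_const, measure_univ, mul_one]
  calc _ ≤ ENNReal.ofReal (2 * scoreBound d p k δ N ^ 2)
        + 2 * (N * ENNReal.ofReal (Ca * unitBallVolume d p * expMoment / N)) := by
        refine add_le_add_right (mul_le_mul_right ((Finset.sum_le_sum fun j _ => hone j).trans ?_)
          _) _
        rw [Finset.sum_const, nsmul_eq_mul, card_erase_univ]
        gcongr
        exact Nat.sub_le _ _
    _ = _ := by
        rw [secondMomentBound, ENNReal.ofReal_add (by positivity) (by positivity),
          ENNReal.ofReal_mul (p := 2) (q := Ca * _ * _) (by norm_num), ENNReal.ofReal_ofNat,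
          ← ENNReal.ofReal_natCast, ← ENNReal.ofReal_mul hN'.le]
        congr 3
        field_simp

theorem abs_integral_le_one_add {Ω : Type*} [MeasurableSpace Ω] {μ : Measure Ω}
    [IsProbabilityMeasure μ] {w : Ω → ℝ} (hw : Measurable w) {b : ℝ} (hb : 0 ≤ b)
    (h : ∫⁻ x, ENNReal.ofReal (w x ^ 2) ∂μ ≤ ENNReal.ofReal b) : |∫ x, w x ∂μ| ≤ 1 + b := by
  obtain ⟨hi, hi2⟩ := integrable_of_lintegral_sq_lt_top hw (h.trans_lt ENNReal.ofReal_lt_top)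
  have h1 : ∫ x, w x ^ 2 ∂μ ≤ b := by
    rw [← ofReal_integral_eq_lintegral_ofReal hi2 (ae_of_all _ fun _ => sq_nonneg _)] at h
    exact (ENNReal.ofReal_le_ofReal_iff hb).1 h
  have h2 := sq_integral_le_integral_sq hi hi2
  rw [abs_le]
  constructor <;> nlinarith [sq_nonneg (∫ x, w x ∂μ + 1), sq_nonneg (∫ x, w x ∂μ - 1)]

/-- The bound for the error of the conditional mean of a local estimate at an arbitrary point. -/
def crudeBound (d : ℕ) (p : ℝ≥0∞) (k : ℕ) (δ Ca C0 : ℝ) (N : ℕ) : ℝ :=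
  1 + secondMomentBound d p k δ Ca N + logBound C0 Ca

/-- The bound for the bias. -/
def biasBound (d : ℕ) (p : ℝ≥0∞) (k : ℕ) (δ Ca Cd Ce C0 : ℝ) (N M : ℕ) : ℝ :=
  1 / N + truncationError d p k Ca C0 N * truncationProb d p k δ C0 N
    + crudeBound d p k δ Ca C0 N * (2 ^ (d + 1) / C0) *
      (Ca * (d * threshold d δ N * (4 + 2 * secondDifferenceConst Ca Cd Ce C0 * (M + 1))))

/-- The bound is affine in the oscillation at every centre. Below s₀ the refined estimate applies;
above it the crude bound is multiplied by S/s₀ ≥ 1, as in Markov's inequality. -/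
theorem Regular.ofReal_abs_integral_localScore_add_log_le (h : Regular Ca Cb Cc Cd Ce C0 f)
    (hC0 : 0 < C0) (hd : 1 ≤ d) (hp : 1 ≤ p) (hδ : 0 < δ) (hN : 3 ≤ N) (hk1 : 1 ≤ k)
    (hk : k + 1 ≤ N) (i : Fin N) {x : Space d} (hfx : f x ∈ Set.Icc C0 Ca) :
    ENNReal.ofReal |∫ X, localScore d p k δ N (knnDistAt p k i x X) ∂sampleLaw f N
        + Real.log (f x)|
      ≤ ENNReal.ofReal (1 / N + truncationError d p k Ca C0 N * truncationProb d p k δ C0 N)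
        + ENNReal.ofReal (crudeBound d p k δ Ca C0 N * (2 ^ (d + 1) / C0)) *
          dyadicOscillation p f (threshold d δ N) x := by
  have := h.isDensity.isProbabilityMeasure_law
  have hprob : IsProbabilityMeasure (sampleLaw f N) := by unfold sampleLaw; infer_instance
  have hV := h.secondMomentBound_nonneg (k := k) (δ := δ) (N := N) hC0 hp
  have hLB := logBound_nonneg (C0 := C0) (Ca := Ca)
  have hG : 1 ≤ crudeBound d p k δ Ca C0 N := by
    unfold crudeBound
    linarith
  set S := dyadicOscillation p f (threshold d δ N) x with hS
  -- The largest level with 2^d s ≤ C0/2, so that ball masses keep mean density at least C0/2.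
  set s₀ : ℝ := C0 / 2 ^ (d + 1) with hs₀
  have hs₀pos : 0 < s₀ := by positivity
  have hinv : 2 ^ (d + 1) / C0 * s₀ = 1 := by
    rw [hs₀]
    field_simp
  have he : 0 ≤ truncationError d p k Ca C0 N * truncationProb d p k δ C0 N :=
    mul_nonneg truncationError_nonneg (by unfold truncationProb; positivity)
  by_cases hSle : S ≤ ENNReal.ofReal s₀
  · have hStop : S ≠ ⊤ := (hSle.trans_lt ENNReal.ofReal_lt_top).ne
    have hs : S.toReal ≤ s₀ := ENNReal.toReal_le_of_le_ofReal hs₀pos.le hSle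
    have hs' : 2 ^ d * S.toReal ≤ C0 / 2 := by
      calc 2 ^ d * S.toReal ≤ 2 ^ d * s₀ := by gcongr
        _ = C0 / 2 := by
          rw [hs₀, pow_succ]
          field_simp
    have hb := h.abs_integral_localScore_add_log_le hC0 hd hp hδ hN hk1 hk i
      ENNReal.toReal_nonneg hs' (by rw [ENNReal.ofReal_toReal hStop]) hfx
    refine (ENNReal.ofReal_le_ofReal hb).trans ?_
    rw [ENNReal.ofReal_add (by positivity) (by positivity)]
    gcongr
    rw [ENNReal.ofReal_mul (by positivity), ENNReal.ofReal_toReal hStop]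
    gcongr
    exact le_mul_of_one_le_left (by positivity) hG
  · have hρ := measurable_knnDistAt (p := p) hp hk i x
    have h2 := abs_integral_le_one_add (measurable_localScore.comp hρ) hV
      (h.lintegral_sq_localScore_le hC0 hd hp hδ hN hk1 hk i x)
    have h3 : |∫ X, localScore d p k δ N (knnDistAt p k i x X) ∂sampleLaw f N
        + Real.log (f x)| ≤ crudeBound d p k δ Ca C0 N :=
      (abs_add_le _ _).trans (add_le_add h2 (abs_log_le_logBound hC0 hfx))
    refine (ENNReal.ofReal_le_ofReal h3).trans (le_trans ?_ le_add_self)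
    calc ENNReal.ofReal (crudeBound d p k δ Ca C0 N)
        = ENNReal.ofReal (crudeBound d p k δ Ca C0 N * (2 ^ (d + 1) / C0)) *
          ENNReal.ofReal s₀ := by
          rw [← ENNReal.ofReal_mul (by positivity), mul_assoc, hinv, mul_one]
      _ ≤ _ := by
          gcongr
          exact (not_le.1 hSle).le

theorem measurable_localEstimate (hp : 1 ≤ p) (hk : k + 1 ≤ N) (i : Fin N) :
    Measurable fun X : Fin N → Space d => localEstimate p k δ X i := by
  simp_rw [localEstimate_eq_localScore]
  exact measurable_localScore.comp
    (measurable_kthValue_lpNorm hp (by rw [card_erase_univ]; omega) i)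

/-- Resampling X_i turns the mean into an average over centres x of conditional means. Since the law
is at most Ca times Lebesgue measure, the L¹ bound on the oscillation carries over to it. -/
theorem Regular.abs_integral_localEstimate_sub_entropy_le (h : Regular Ca Cb Cc Cd Ce C0 f)
    (hC0 : 0 < C0) (hd : 1 ≤ d) (hp : 1 ≤ p) (hδ : 0 < δ) (hN : 3 ≤ N) (hk1 : 1 ≤ k)
    (hk : k + 1 ≤ N) (i : Fin N) (M : ℕ) (hM : (1 / 2) ^ M ≤ threshold d δ N) :
    Integrable (fun X => localEstimate p k δ X i) (sampleLaw f N) ∧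
    |∫ X, localEstimate p k δ X i ∂sampleLaw f N - entropy f|
      ≤ biasBound d p k δ Ca Cd Ce C0 N M := by
  have := h.isDensity.isProbabilityMeasure_law
  have hprob : IsProbabilityMeasure (sampleLaw f N) := by unfold sampleLaw; infer_instance
  have hCa := hC0.le.trans h.lower_le_upper
  have ha := threshold_pos (d := d) (δ := δ) hN
  have hm := measurable_localEstimate (δ := δ) (d := d) (p := p) hp hk i
  have hV := h.secondMomentBound_nonneg (k := k) (δ := δ) (N := N) hC0 hp
  have hLB := logBound_nonneg (C0 := C0) (Ca := Ca)
  have hK := secondDifferenceConst_pos (Ca := Ca) (Cd := Cd) (Ce := Ce) hC0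
  have hsq : ∫⁻ X, ENNReal.ofReal (localEstimate p k δ X i ^ 2) ∂sampleLaw f N < ⊤ := by
    refine lt_of_le_of_lt (le_of_eq (lintegral_pi_update_symm (law f) i
      (hm.pow_const 2).ennreal_ofReal)) ?_
    simp_rw [localEstimate_update]
    refine (lintegral_mono fun x =>
      h.lintegral_sq_localScore_le hC0 hd hp hδ hN hk1 hk i x).trans_lt ?_
    simp
  have hint := (integrable_of_lintegral_sq_lt_top hm hsq).1
  refine ⟨hint, ?_⟩
  have hmp := measurePreserving_update (law f) i
  have hintprod : Integrable (fun q : (Fin N → Space d) × Space d =>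
      localScore d p k δ N (knnDistAt p k i q.2 q.1)) ((sampleLaw f N).prod (law f)) := by
    refine (hmp.integrable_comp_of_integrable hint).congr (ae_of_all _ fun q => ?_)
    exact localEstimate_update i q.2 q.1
  have hmean : ∫ X, localEstimate p k δ X i ∂sampleLaw f N
      = ∫ x, ∫ X, localScore d p k δ N (knnDistAt p k i x X) ∂sampleLaw f N ∂law f := by
    have h1 : ∫ X, localEstimate p k δ X i ∂sampleLaw f N
        = ∫ q, localEstimate p k δ (Function.update q.1 i q.2) i
          ∂(sampleLaw f N).prod (law f) := by
      have h2 := integral_map hmp.aemeasurable (hm.aestronglyMeasurable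
        (μ := (Measure.map (fun q => Function.update q.1 i q.2)
          ((Measure.pi fun _ : Fin N => law f).prod (law f)))))
      rw [hmp.map_eq] at h2
      exact h2
    rw [h1]
    simp_rw [localEstimate_update]
    exact integral_prod_symm _ hintprod
  have hlogi : Integrable (fun x => Real.log (f x)) (law f) :=
    (integrable_const (logBound C0 Ca)).mono' h.isDensity.measurable.log.aestronglyMeasurable
      (h.ae_law.mono fun x hx => abs_log_le_logBound hC0 hx)
  rw [entropy_eq_integral_law h.isDensity, sub_neg_eq_add, hmean,
    ← integral_add hintprod.integral_prod_right hlogi]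
  have hnn : 0 ≤ 1 / (N : ℝ)
      + truncationError d p k Ca C0 N * truncationProb d p k δ C0 N :=
    add_nonneg (by positivity)
      (mul_nonneg truncationError_nonneg (by unfold truncationProb; positivity))
  have hGnn : 0 ≤ crudeBound d p k δ Ca C0 N := by unfold crudeBound; linarith
  have hS : ∫⁻ x, dyadicOscillation p f (threshold d δ N) x ∂law f
      ≤ ENNReal.ofReal (Ca * (d * threshold d δ N *
        (4 + 2 * secondDifferenceConst Ca Cd Ce C0 * (M + 1)))) := by
    rw [ENNReal.ofReal_mul hCa]
    refine (lintegral_mono' h.law_le le_rfl).trans ?_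
    rw [lintegral_smul_measure, smul_eq_mul]
    gcongr
    exact h.lintegral_dyadicOscillation_le hd hC0 hp ha M hM
  have hbb : 0 ≤ biasBound d p k δ Ca Cd Ce C0 N M :=
    add_nonneg hnn (by positivity)
  refine (ENNReal.ofReal_le_ofReal_iff hbb).1 ?_
  rw [← Real.enorm_eq_ofReal_abs]
  refine (enorm_integral_le_lintegral_enorm _).trans ?_
  simp_rw [Real.enorm_eq_ofReal_abs]
  refine (lintegral_mono_ae (h.ae_law.mono fun x hx =>
    h.ofReal_abs_integral_localScore_add_log_le hC0 hd hp hδ hN hk1 hk i hx)).trans ?_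
  rw [lintegral_add_left measurable_const, lintegral_const_mul _
    (measurable_dyadicOscillation h.isDensity.measurable _), lintegral_const, measure_univ,
    mul_one, biasBound, ENNReal.ofReal_add hnn (by positivity),
    ENNReal.ofReal_mul (p := crudeBound d p k δ Ca C0 N * (2 ^ (d + 1) / C0)) (by positivity)]
  gcongr

/-- E(F - H)² = E(F - c)² - (EF - c)² + (EF - H)². The negative term is dropped, so the Efron–Stein
constant c need not be the mean. -/
theorem Regular.mse_le (h : Regular Ca Cb Cc Cd Ce C0 f) (hC0 : 0 < C0) (hd : 1 ≤ d)
    (hp : 1 ≤ p) (hδ : 0 < δ) (hN : 3 ≤ N) (hk1 : 1 ≤ k) (hk : k + 2 ≤ N) (M : ℕ)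
    (hM : (1 / 2) ^ M ≤ threshold d δ N) :
    Integrable (sqError p k δ f) (sampleLaw f N) ∧
    mse p k δ f N
      ≤ varianceBound d p k δ Ca N + biasBound d p k δ Ca Cd Ce C0 N M ^ 2 := by
  have := h.isDensity.isProbabilityMeasure_law
  have hprob : IsProbabilityMeasure (sampleLaw f N) := by unfold sampleLaw; infer_instance
  have hCa := hC0.le.trans h.lower_le_upper
  have hc := unitBallVolume_pos (d := d) hp
  have hκ := expMoment_nonneg
  have hN' : (0 : ℝ) < N := by positivity
  have hlogN := Real.log_natCast_nonneg N
  have hVnn : 0 ≤ varianceBound d p k δ Ca N := by unfold varianceBound; positivity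
  obtain ⟨c, hvar⟩ := h.exists_lintegral_sq_sub_le hC0 hd hp hδ hN hk1 hk
  have hm := measurable_estimator (δ := δ) (d := d) (p := p) hp (show k + 1 ≤ N by omega)
  obtain ⟨hi, hi2⟩ := integrable_of_lintegral_sq_lt_top (hm.sub_const c)
    (hvar.trans_lt ENNReal.ofReal_lt_top)
  have hvar' : ∫ X, (estimator p k δ X - c) ^ 2 ∂sampleLaw f N ≤ varianceBound d p k δ Ca N := by
    rw [← ofReal_integral_eq_lintegral_ofReal hi2 (ae_of_all _ fun _ => sq_nonneg _)] at hvar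
    exact (ENNReal.ofReal_le_ofReal_iff hVnn).1 hvar
  have hloc := fun i =>
    h.abs_integral_localEstimate_sub_entropy_le hC0 hd hp hδ hN hk1 (by omega) i M hM
  set H := entropy f with hH
  set b := biasBound d p k δ Ca Cd Ce C0 N M with hb
  have hmean : |∫ X, estimator p k δ X ∂sampleLaw f N - H| ≤ b := by
    unfold estimator
    rw [integral_const_mul, integral_finsetSum _ fun i _ => (hloc i).1]
    have e : 1 / (N : ℝ) * ∑ i, ∫ X, localEstimate p k δ X i ∂sampleLaw f N - H
        = 1 / (N : ℝ) * ∑ i, (∫ X, localEstimate p k δ X i ∂sampleLaw f N - H) := by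
      rw [Finset.sum_sub_distrib, Finset.sum_const, Finset.card_univ, Fintype.card_fin,
        nsmul_eq_mul]
      field_simp
    rw [e, abs_mul, abs_of_pos (by positivity)]
    calc _ ≤ 1 / (N : ℝ) * ∑ _i : Fin N, b := by
          gcongr
          refine (Finset.abs_sum_le_sum_abs _ _).trans (Finset.sum_le_sum fun i _ => (hloc i).2)
      _ = b := by
          rw [Finset.sum_const, Finset.card_univ, Fintype.card_fin, nsmul_eq_mul]
          field_simp
  have hexp : ∀ X : Fin N → Space d, sqError p k δ f X = (estimator p k δ X - c) ^ 2
      + 2 * (c - H) * (estimator p k δ X - c) + (c - H) ^ 2 := fun X => by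
    unfold sqError
    ring
  have hi3 : Integrable (fun X => (estimator p k δ X - c) ^ 2
      + 2 * (c - H) * (estimator p k δ X - c)) (sampleLaw f N) := hi2.add (hi.const_mul _)
  have hie : Integrable (fun X : Fin N → Space d => estimator p k δ X) (sampleLaw f N) := by
    refine (hi.add (integrable_const c)).congr (ae_of_all _ fun X => ?_)
    simp
  refine ⟨(hi3.add (integrable_const _)).congr (ae_of_all _ fun X => (hexp X).symm), ?_⟩
  have hmse : mse p k δ f N = ∫ X, (estimator p k δ X - c) ^ 2 ∂sampleLaw f N
      + 2 * (c - H) * (∫ X, estimator p k δ X ∂sampleLaw f N - c) + (c - H) ^ 2 := by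
    unfold mse
    simp_rw [hexp]
    rw [integral_add hi3 (integrable_const _), integral_add hi2 (hi.const_mul _),
      integral_const_mul, integral_sub hie (integrable_const _)]
    simp
  have hbsq : (∫ X, estimator p k δ X ∂sampleLaw f N - H) ^ 2 ≤ b ^ 2 :=
    sq_le_sq' (abs_le.1 hmean).1 (abs_le.1 hmean).2
  rw [hmse]
  nlinarith [sq_nonneg (∫ X, estimator p k δ X ∂sampleLaw f N - c)]

end MeanSquaredError

/-! ### Rates -/

section Rates

variable {d k N : ℕ} {p : ℝ≥0∞} {δ : ℝ} {Ca Cd Ce C0 : ℝ}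

/-- The value 16 works because log 16 = 4 log 2 exceeds e. -/
theorem one_le_log_log_natCast (hN : 16 ≤ N) : 1 ≤ Real.log (Real.log N) := by
  have h16 : (16 : ℝ) ≤ N := by exact_mod_cast hN
  have h1 := one_lt_log_natCast (N := N) (by omega)
  rw [Real.le_log_iff_exp_le (by linarith)]
  have h2 : Real.log 16 ≤ Real.log N := Real.log_le_log (by norm_num) h16
  have h3 : Real.log 16 = 4 * Real.log 2 := by
    rw [show (16 : ℝ) = 2 ^ 4 by norm_num, Real.log_pow]
    norm_num
  linarith [Real.exp_one_lt_d9, Real.log_two_gt_d9]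

/-- The constant bounding `scoreBound` by a multiple of `log log N`. -/
def scoreConst (d : ℕ) (p : ℝ≥0∞) (k : ℕ) (δ : ℝ) : ℝ :=
  |digamma k| + |Real.log (unitBallVolume d p)| + (1 + δ)

theorem scoreBound_le (hN : 16 ≤ N) :
    scoreBound d p k δ N ≤ scoreConst d p k δ * Real.log (Real.log N) := by
  have h := one_le_log_log_natCast hN
  have h1 := abs_nonneg (digamma k)
  have h2 := abs_nonneg (Real.log (unitBallVolume d p))
  unfold scoreBound scoreConst
  nlinarith

theorem sq_scoreBound_le (hδ : 0 < δ) (hN : 16 ≤ N) :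
    scoreBound d p k δ N ^ 2 ≤ scoreConst d p k δ ^ 2 * Real.log (Real.log N) ^ 2 := by
  rw [← mul_pow]
  exact pow_le_pow_left₀ (scoreBound_nonneg hδ (by omega)) (scoreBound_le hN) 2

theorem exists_varianceBound_le (hp : 1 ≤ p) (hδ : 0 < δ) (hCa : 0 < Ca) :
    ∃ C : ℝ, 0 ≤ C ∧ ∀ N : ℕ, 16 ≤ N → varianceBound d p k δ Ca N
      ≤ C * (Real.log (Real.log N) ^ 2 * Real.log N ^ ((2 * (k : ℝ) + 2) * (1 + δ)) / N) := by
  have hc := unitBallVolume_pos (d := d) hp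
  have hκ := expMoment_nonneg
  set Q := Ca * unitBallVolume d p with hQ
  have hQ0 : 0 < Q := by positivity
  refine ⟨36 * (1 + Q) ^ 2 * (scoreConst d p k δ ^ 2 + Q * expMoment), by positivity, ?_⟩
  intro N hN
  have hN' : (0 : ℝ) < N := by positivity
  have hlog := one_lt_log_natCast (N := N) (by omega)
  have hll := one_le_log_log_natCast hN
  have hpow : 1 ≤ Real.log N ^ (1 + δ) := Real.one_le_rpow hlog.le (by linarith)
  have h1 : (1 + Q * Real.log N ^ (1 + δ)) ^ 2
      ≤ (1 + Q) ^ 2 * Real.log N ^ ((2 * (k : ℝ) + 2) * (1 + δ)) := by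
    calc (1 + Q * Real.log N ^ (1 + δ)) ^ 2
        ≤ ((1 + Q) * Real.log N ^ (1 + δ)) ^ 2 := by
          refine pow_le_pow_left₀ (by positivity) ?_ 2
          linarith
      _ = (1 + Q) ^ 2 * Real.log N ^ ((1 + δ) * (2 : ℕ)) := by
          rw [mul_pow, Real.rpow_mul_natCast (by linarith)]
      _ ≤ _ := by
          refine mul_le_mul_of_nonneg_left (Real.rpow_le_rpow_of_exponent_le hlog.le ?_)
            (by positivity)
          have : (0 : ℝ) ≤ k := Nat.cast_nonneg k
          push_cast
          nlinarith
  have h2 : scoreBound d p k δ N ^ 2 + Q * expMoment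
      ≤ (scoreConst d p k δ ^ 2 + Q * expMoment) * Real.log (Real.log N) ^ 2 := by
    have h3 := sq_scoreBound_le (d := d) (p := p) (k := k) hδ hN
    have h4 : 1 ≤ Real.log (Real.log N) ^ 2 := one_le_pow₀ hll
    have h5 : 0 ≤ Q * expMoment := by positivity
    nlinarith
  unfold varianceBound
  rw [← hQ]
  calc 36 * (1 + Q * Real.log N ^ (1 + δ)) ^ 2
        * (scoreBound d p k δ N ^ 2 + Q * expMoment) / N
      ≤ 36 * ((1 + Q) ^ 2 * Real.log N ^ ((2 * (k : ℝ) + 2) * (1 + δ)))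
        * ((scoreConst d p k δ ^ 2 + Q * expMoment) * Real.log (Real.log N) ^ 2) / N := by
        gcongr
    _ = _ := by ring

theorem inv_natCast_le_threshold (hd : 1 ≤ d) (hδ : 0 < δ) (hN : 3 ≤ N) :
    1 / (N : ℝ) ≤ threshold d δ N := by
  have hN' : (0 : ℝ) < N := by positivity
  have hN1 : (1 : ℝ) ≤ N := by exact_mod_cast (by omega : 1 ≤ N)
  have hlog := one_lt_log_natCast hN
  have hpow : 1 ≤ Real.log N ^ (1 + δ) := Real.one_le_rpow hlog.le (by linarith)
  have hd' : (1 : ℝ) ≤ d := by exact_mod_cast hd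
  unfold threshold
  calc 1 / (N : ℝ) = (1 / (N : ℝ)) ^ (1 : ℝ) := (Real.rpow_one _).symm
    _ ≤ (1 / (N : ℝ)) ^ (1 / (d : ℝ)) :=
        Real.rpow_le_rpow_of_exponent_ge (by positivity) ((div_le_one hN').2 hN1)
          ((div_le_one (by linarith)).2 hd')
    _ ≤ _ := by gcongr

/-- `Nat.clog 2 N` doublings bring 2^{-M} down to 1/N ≤ a_N, and cost only a factor of order log N.
-/
theorem half_pow_clog_le_threshold (hd : 1 ≤ d) (hδ : 0 < δ) (hN : 3 ≤ N) :
    (1 / 2 : ℝ) ^ Nat.clog 2 N ≤ threshold d δ N := by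
  refine le_trans ?_ (inv_natCast_le_threshold hd hδ hN)
  rw [one_div_pow]
  have hN' : (0 : ℝ) < N := by positivity
  refine one_div_le_one_div_of_le hN' ?_
  exact_mod_cast Nat.le_pow_clog one_lt_two N

theorem clog_le (hN : 3 ≤ N) : (Nat.clog 2 N : ℝ) ≤ 3 * Real.log N := by
  have hN' : (0 : ℝ) < N := by positivity
  have hlog := one_lt_log_natCast hN
  have h1 : 2 ^ (Nat.clog 2 N - 1) < N := Nat.pow_pred_clog_lt_self one_lt_two (by omega)
  have h2 : ((2 : ℝ) ^ (Nat.clog 2 N - 1)) ≤ N := by exact_mod_cast h1.le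
  have h3 := Real.log_le_log (by positivity) h2
  rw [Real.log_pow] at h3
  have h4 : (Nat.clog 2 N : ℝ) ≤ ((Nat.clog 2 N - 1 : ℕ) : ℝ) + 1 := by
    exact_mod_cast (by omega : Nat.clog 2 N ≤ Nat.clog 2 N - 1 + 1)
  have h5 := Real.log_two_gt_d9
  have h6 : (0 : ℝ) ≤ ((Nat.clog 2 N - 1 : ℕ) : ℝ) := Nat.cast_nonneg _
  nlinarith

/-- Once (log N)^δ ≥ 1/c the exponent exceeds log N; for the remaining N, log N ≤ B and the right
side is at least 1. -/
theorem exists_exp_neg_le (hδ : 0 < δ) {c : ℝ} (hc : 0 < c) :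
    ∃ C : ℝ, 0 ≤ C ∧ ∀ N : ℕ, 3 ≤ N → Real.exp (-(c * Real.log N ^ (1 + δ))) ≤ C / N := by
  set B := (1 / c) ^ (1 / δ) with hB
  refine ⟨Real.exp B, (Real.exp_pos _).le, fun N hN => ?_⟩
  have hN' : (0 : ℝ) < N := by positivity
  have hlog := one_lt_log_natCast hN
  have hl0 : 0 < Real.log N := by linarith
  have hexp : Real.exp B / N = Real.exp (B - Real.log N) := by
    rw [Real.exp_sub, Real.exp_log hN']
  rw [hexp]
  refine Real.exp_le_exp.2 ?_
  rw [Real.rpow_add hl0, Real.rpow_one]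
  rcases le_total (Real.log N) B with h | h
  · have : 0 ≤ c * (Real.log N * Real.log N ^ δ) := by positivity
    linarith
  · have h1 : 1 / c ≤ Real.log N ^ δ := by
      calc 1 / c = B ^ δ := by
            rw [hB, ← Real.rpow_mul (by positivity), one_div_mul_cancel hδ.ne', Real.rpow_one]
        _ ≤ _ := by gcongr
    rw [div_le_iff₀ hc] at h1
    have hB0 : 0 ≤ B := by positivity
    nlinarith

/-- In the oscillation term the crude bound is O((log log N)²), absorbed by (log N)^δ, while the
doublings give a_N log N. Together they give a_N (log N)^{1+δ}, which also dominates 1/N and the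
truncation term. -/
theorem exists_biasBound_le (hd : 1 ≤ d) (hp : 1 ≤ p) (hδ : 0 < δ) (hCa : 0 < Ca) (hC0 : 0 < C0) :
    ∃ C : ℝ, 0 ≤ C ∧ ∀ N : ℕ, 16 ≤ N → biasBound d p k δ Ca Cd Ce C0 N (Nat.clog 2 N)
      ≤ C * (threshold d δ N * Real.log N ^ (1 + δ)) := by
  have hc := unitBallVolume_pos (d := d) hp
  have hκ := expMoment_nonneg
  have hK := secondDifferenceConst_pos (Ca := Ca) (Cd := Cd) (Ce := Ce) hC0
  have hLB := logBound_nonneg (C0 := C0) (Ca := Ca)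
  obtain ⟨D, hD0, hD⟩ := exists_exp_neg_le hδ (c := unitBallVolume d p * C0 / 8) (by positivity)
  set K := secondDifferenceConst Ca Cd Ce C0 with hKdef
  set β := logBound C0 Ca + |digamma k| + |Real.log (unitBallVolume d p * (C0 / 2))| with hβ
  have hβ0 : 0 ≤ β := by positivity
  set V := Ca * unitBallVolume d p * expMoment with hV
  have hV0 : 0 ≤ V := by positivity
  set G := (1 + 2 * scoreConst d p k δ ^ 2 + 2 * V + logBound C0 Ca) * (4 / δ ^ 2) with hG
  have hG0 : 0 ≤ G := by positivity
  refine ⟨1 + (1 + β) * (2 ^ k * D) + G * (2 ^ (d + 1) / C0) * (Ca * (d * (4 + 8 * K))),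
    by positivity, fun N hN => ?_⟩
  have hN3 : 3 ≤ N := by omega
  have hN' : (0 : ℝ) < N := by positivity
  have hlog := one_lt_log_natCast hN3
  have hl0 : 0 < Real.log N := by linarith
  have hll := one_le_log_log_natCast hN
  have ha := threshold_pos (d := d) (δ := δ) hN3
  have hinv := inv_natCast_le_threshold (d := d) hd hδ hN3
  have hpow1 : Real.log N ≤ Real.log N ^ (1 + δ) := by
    calc Real.log N = Real.log N ^ (1 : ℝ) := (Real.rpow_one _).symm
      _ ≤ _ := Real.rpow_le_rpow_of_exponent_le hlog.le (by linarith)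
  have hpow0 : 1 ≤ Real.log N ^ (1 + δ) := hlog.le.trans hpow1
  have hll2 : Real.log (Real.log N) ^ 2 ≤ 4 / δ ^ 2 * Real.log N ^ δ := by
    have h1 := Real.log_le_rpow_div hl0.le (half_pos hδ)
    calc Real.log (Real.log N) ^ 2 ≤ (Real.log N ^ (δ / 2) / (δ / 2)) ^ 2 :=
          pow_le_pow_left₀ (by linarith) h1 2
      _ = 4 / δ ^ 2 * Real.log N ^ (δ / 2 * (2 : ℕ)) := by
          rw [Real.rpow_mul_natCast hl0.le, div_pow]
          field_simp
          norm_num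
      _ = _ := by
          congr 2
          push_cast
          ring
  have hcrude : crudeBound d p k δ Ca C0 N ≤ G * Real.log N ^ δ := by
    have h3 := sq_scoreBound_le (d := d) (p := p) (k := k) hδ hN
    have h4 : 1 ≤ Real.log (Real.log N) ^ 2 := one_le_pow₀ hll
    calc crudeBound d p k δ Ca C0 N
        ≤ (1 + 2 * scoreConst d p k δ ^ 2 + 2 * V + logBound C0 Ca)
          * Real.log (Real.log N) ^ 2 := by
          unfold crudeBound secondMomentBound
          nlinarith
      _ ≤ (1 + 2 * scoreConst d p k δ ^ 2 + 2 * V + logBound C0 Ca)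
          * (4 / δ ^ 2 * Real.log N ^ δ) := by gcongr
      _ = _ := by rw [hG]; ring
  have hfirst : 1 / (N : ℝ) ≤ threshold d δ N * Real.log N ^ (1 + δ) := by nlinarith
  have hsecond : truncationError d p k Ca C0 N * truncationProb d p k δ C0 N
      ≤ (1 + β) * (2 ^ k * D) * (threshold d δ N * Real.log N ^ (1 + δ)) := by
    have h1 : truncationError d p k Ca C0 N ≤ (1 + β) * Real.log N := by
      unfold truncationError
      rw [← hβ]
      nlinarith
    have h2 : truncationProb d p k δ C0 N ≤ 2 ^ k * (D / N) := by
      unfold truncationProb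
      gcongr
      exact hD N hN3
    have h3 : 0 ≤ truncationProb d p k δ C0 N := by unfold truncationProb; positivity
    calc _ ≤ (1 + β) * Real.log N * (2 ^ k * (D / N)) := by gcongr
      _ = (1 + β) * (2 ^ k * D) * (1 / N * Real.log N) := by ring
      _ ≤ _ := by gcongr
  have hthird : 4 + 2 * K * ((Nat.clog 2 N : ℝ) + 1) ≤ (4 + 8 * K) * Real.log N := by
    have := clog_le hN3
    nlinarith
  unfold biasBound
  rw [← hKdef]
  have hprod : Real.log N ^ δ * Real.log N = Real.log N ^ (1 + δ) := by
    rw [add_comm 1 δ, Real.rpow_add hl0, Real.rpow_one]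
  calc 1 / (N : ℝ) + truncationError d p k Ca C0 N * truncationProb d p k δ C0 N
        + crudeBound d p k δ Ca C0 N * (2 ^ (d + 1) / C0) *
          (Ca * (d * threshold d δ N * (4 + 2 * K * ((Nat.clog 2 N : ℝ) + 1))))
      ≤ threshold d δ N * Real.log N ^ (1 + δ)
        + (1 + β) * (2 ^ k * D) * (threshold d δ N * Real.log N ^ (1 + δ))
        + G * Real.log N ^ δ * (2 ^ (d + 1) / C0) *
          (Ca * (d * threshold d δ N * ((4 + 8 * K) * Real.log N))) := by
        gcongr
    _ = _ := by
        rw [← hprod]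
        ring

theorem sq_threshold_mul_log (hN : 3 ≤ N) :
    (threshold d δ N * Real.log N ^ (1 + δ)) ^ 2
      = Real.log N ^ ((1 + δ) * (2 + 2 / (d : ℝ))) / (N : ℝ) ^ (2 / (d : ℝ)) := by
  have hN' : (0 : ℝ) < N := by positivity
  have hlog := one_lt_log_natCast hN
  have hl0 : 0 < Real.log N := by linarith
  unfold threshold
  rw [mul_pow, ← Real.rpow_mul_natCast (by positivity), ← Real.rpow_mul_natCast hl0.le,
    Real.div_rpow (by positivity) hN'.le, ← Real.rpow_mul hl0.le, div_mul_eq_mul_div,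
    ← Real.rpow_add hl0]
  congr 2 <;> push_cast <;> ring

theorem exists_mse_le (hd : 1 ≤ d) (hk : 1 ≤ k) (hp : 1 ≤ p) (hδ : 0 < δ) (Cb Cc : ℝ)
    (hC0 : 0 < C0) :
    ∃ C : ℝ, 0 ≤ C ∧ ∀ f : Space d → ℝ, Regular Ca Cb Cc Cd Ce C0 f → ∀ N : ℕ, k + 16 ≤ N →
      Integrable (sqError p k δ f) (sampleLaw f N) ∧ mse p k δ f N ≤ C * rate d k δ N := by
  rcases lt_or_ge 0 Ca with hCa | hCa
  · obtain ⟨C1, hC1, h1⟩ := exists_varianceBound_le (d := d) (k := k) hp hδ hCa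
    obtain ⟨C2, hC2, h2⟩ := exists_biasBound_le (d := d) (k := k) (Cd := Cd) (Ce := Ce) hd hp hδ
      hCa hC0
    refine ⟨C1 + C2 ^ 2, by positivity, fun f hf N hN => ?_⟩
    have hN3 : 3 ≤ N := by omega
    have hN' : (0 : ℝ) < N := by positivity
    have hlog := one_lt_log_natCast hN3
    obtain ⟨hi, hm⟩ := hf.mse_le hC0 hd hp hδ hN3 hk (by omega) (Nat.clog 2 N)
      (half_pow_clog_le_threshold hd hδ hN3)
    refine ⟨hi, hm.trans ?_⟩
    have hb0 : 0 ≤ biasBound d p k δ Ca Cd Ce C0 N (Nat.clog 2 N) := by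
      have h3 := hf.secondMomentBound_nonneg (k := k) (δ := δ) (N := N) hC0 hp
      have h4 := logBound_nonneg (C0 := C0) (Ca := Ca)
      have h5 := truncationError_nonneg (d := d) (p := p) (k := k) (Ca := Ca) (C0 := C0) (N := N)
      have h6 := secondDifferenceConst_pos (Ca := Ca) (Cd := Cd) (Ce := Ce) hC0
      have h7 := threshold_pos (d := d) (δ := δ) hN3
      unfold biasBound crudeBound truncationProb
      positivity
    have hbias : biasBound d p k δ Ca Cd Ce C0 N (Nat.clog 2 N) ^ 2
        ≤ C2 ^ 2 * (Real.log N ^ ((1 + δ) * (2 + 2 / (d : ℝ))) / (N : ℝ) ^ (2 / (d : ℝ))) := by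
      rw [← sq_threshold_mul_log hN3, ← mul_pow]
      exact pow_le_pow_left₀ hb0 (h2 N (by omega)) 2
    have hvar := h1 N (by omega)
    have ht1 : 0 ≤ Real.log N ^ ((1 + δ) * (2 + 2 / (d : ℝ))) / (N : ℝ) ^ (2 / (d : ℝ)) := by
      positivity
    have ht2 : 0 ≤ Real.log (Real.log N) ^ 2 *
        Real.log N ^ ((2 * (k : ℝ) + 2) * (1 + δ)) / N := by positivity
    unfold rate
    nlinarith [mul_nonneg hC1 ht1, mul_nonneg (sq_nonneg C2) ht2]
  -- For Ca ≤ 0 the class is empty, as its members force C0 ≤ Ca.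
  · exact ⟨0, le_rfl, fun f hf => absurd (hC0.trans_le hf.lower_le_upper) (not_lt.2 hCa)⟩

/-- For d ≤ 2 one has N^{2/d} ≥ N, and 2/d ≤ 2 with k ≥ 1 keeps the first exponent below the second;
the extra 2 in the exponent pays for (log log N)² ≤ (log N)². -/
theorem rate_le_of_le_two (hd : 1 ≤ d) (hd2 : d ≤ 2) (hk : 1 ≤ k) (hδ : 0 < δ) (hN : 16 ≤ N) :
    rate d k δ N ≤ 2 * (Real.log N ^ ((2 * (k : ℝ) + 2) * (1 + δ) + 2) / N) := by
  have hN' : (0 : ℝ) < N := by positivity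
  have hN1 : (1 : ℝ) ≤ N := by exact_mod_cast (by omega : 1 ≤ N)
  have hlog := one_lt_log_natCast (N := N) (by omega)
  have hl0 : 0 < Real.log N := by linarith
  have hll := one_le_log_log_natCast hN
  have hd' : (1 : ℝ) ≤ d := by exact_mod_cast hd
  have hd2' : (d : ℝ) ≤ 2 := by exact_mod_cast hd2
  have hk' : (1 : ℝ) ≤ k := by exact_mod_cast hk
  have hdiv1 : 1 ≤ 2 / (d : ℝ) := (one_le_div (by linarith)).2 hd2'
  have hdiv2 : 2 / (d : ℝ) ≤ 2 := by
    rw [div_le_iff₀ (by linarith)]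
    linarith
  have h1 : Real.log N ^ ((1 + δ) * (2 + 2 / (d : ℝ))) / (N : ℝ) ^ (2 / (d : ℝ))
      ≤ Real.log N ^ ((2 * (k : ℝ) + 2) * (1 + δ) + 2) / N := by
    have hNp : (N : ℝ) ≤ (N : ℝ) ^ (2 / (d : ℝ)) := by
      calc (N : ℝ) = (N : ℝ) ^ (1 : ℝ) := (Real.rpow_one _).symm
        _ ≤ _ := Real.rpow_le_rpow_of_exponent_le hN1 hdiv1
    have he : (1 + δ) * (2 + 2 / (d : ℝ)) ≤ (2 * (k : ℝ) + 2) * (1 + δ) + 2 := by nlinarith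
    exact div_le_div₀ (by positivity) (Real.rpow_le_rpow_of_exponent_le hlog.le he) hN' hNp
  have h2 : Real.log (Real.log N) ^ 2 * Real.log N ^ ((2 * (k : ℝ) + 2) * (1 + δ)) / N
      ≤ Real.log N ^ ((2 * (k : ℝ) + 2) * (1 + δ) + 2) / N := by
    have hle : Real.log (Real.log N) ≤ Real.log N :=
      (Real.log_le_sub_one_of_pos hl0).trans (by linarith)
    have hp : Real.log N ^ ((2 * (k : ℝ) + 2) * (1 + δ) + 2)
        = Real.log N ^ 2 * Real.log N ^ ((2 * (k : ℝ) + 2) * (1 + δ)) := by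
      rw [Real.rpow_add hl0, Real.rpow_two, mul_comm]
    rw [hp]
    gcongr
  unfold rate
  linarith

end Rates

end TruncKL

end

theorem mainTheorem7 (d k : ℕ) (hd : 1 ≤ d) (hk : 1 ≤ k) (p : ENNReal) (hp : 1 ≤ p)
    (δ : ℝ) (hδ : 0 < δ) (Ca Cb Cc Cd Ce C0 : ℝ) (hC0 : 0 < C0) :
    (∃ (C : ℝ) (N0 : ℕ), ∀ f : TruncKL.Space d → ℝ, TruncKL.Regular Ca Cb Cc Cd Ce C0 f →
      MeasureTheory.Integrable (fun x => f x * Real.log (f x)) ∧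
      ∀ N : ℕ, N0 ≤ N →
        MeasureTheory.Integrable (TruncKL.sqError p k δ f) (TruncKL.sampleLaw f N) ∧
        TruncKL.mse p k δ f N ≤ C * TruncKL.rate d k δ N) ∧
    (d ≤ 2 → ∃ (A C : ℝ) (N0 : ℕ), ∀ f : TruncKL.Space d → ℝ,
      TruncKL.Regular Ca Cb Cc Cd Ce C0 f → ∀ N : ℕ, N0 ≤ N →
        TruncKL.mse p k δ f N ≤ C * (Real.log N ^ A / N)) := by
  obtain ⟨C, hC, h⟩ := TruncKL.exists_mse_le (Ca := Ca) (Cd := Cd) (Ce := Ce) hd hk hp hδ Cb Cc hC0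
  refine ⟨⟨C, k + 16, fun f hf => ⟨hf.integrable_mul_log hC0, h f hf⟩⟩, fun hd2 => ?_⟩
  refine ⟨(2 * (k : ℝ) + 2) * (1 + δ) + 2, 2 * C, k + 16, fun f hf N hN => ?_⟩
  refine (h f hf N hN).2.trans ?_
  rw [mul_comm 2 C, mul_assoc]
  exact mul_le_mul_of_nonneg_left
    (TruncKL.rate_le_of_le_two hd hd2 hk hδ (by omega)) hC
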